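/- Let $d\ge 2$. For $N$ independent measurements with effects $\Pi_x$ on copies of a state $\rho$ on $\mathbb C^d$, and reconstruction operators $\Theta_x$ (i.e. $\sum_x|\Theta_x\rangle\!\rangle\langle\!\langle\Pi_x|=\mathbf I$; sums become integrals for continuous outcomes), let $\hat\rho=\frac1N\sum_{i=1}^N\Theta_{x_i}$, where $x_1,\dots,x_N$ are the outcomes, and $\Delta\rho=\sqrt N(\hat\rho-\rho)$. The scaled MSE matrix is $\mathrm E\,|\Delta\rho\rangle\!\rangle\langle\!\langle\Delta\rho|$, the scaled MSE is $\mathrm E\|\Delta\rho\|_{\mathrm{HS}}^2$, and the scaled mean errors are $\mathrm E\|\Delta\rho\|_{\mathrm{HS}}$ and $\mathrm E\|\Delta\rho\|_{\mathrm{tr}}$, where $\|A\|_{\mathrm{tr}}=\frac12\operatorname{tr}|A|$. The covariant measurement has the effects $d\,|\psi\rangle\langle\psi|\,\mathrm d\mu(\psi)$, with $\mu$ the normalized unitarily invariant measure on unit vectors; put $$\mathcal F(\rho)=d\int\mathrm d\mu(\psi)\,\frac{|\Pi_\psi\rangle\!\rangle\langle\!\langle\Pi_\psi|}{\langle\psi|\rho|\psi\rangle},\qquad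 \Pi_\psi=|\psi\rangle\langle\psi|,\qquad \mathcal C(\rho)=\mathcal F(\rho)^{-1}-|\rho\rangle\!\rangle\langle\!\langle\rho|.$$ (a) The covariant measurement is a POVM. For every full-rank state $\rho$, $\mathcal F(\rho)$ is invertible, and for every $N\ge1$, $\mathcal C(\rho)$ is the least scaled MSE matrix (in the positive-semidefinite order) over all square-integrable families of reconstruction operators for the covariant measurement. It is attained by $\Theta_\psi=\langle\psi|\rho|\psi\rangle^{-1}\mathcal F(\rho)^{-1}(\Pi_\psi)$, whose scaled MSE is $\operatorname{Tr}\mathcal C(\rho)$. (b) Let $|1\rangle,\dots,|d\rangle$ be any orthonormal basis, $E^+_{1j}=\frac1{\sqrt2}(|1\rangle\langle j|+|j\rangle\langle1|)$ and $E^-_{1j}=-\frac{\mathrm i}{\sqrt2}(|1\rangle\langle j|-|j\rangle\langle1|)$. As $\rho\to|1\rangle\langle1|$ through full-rank states, $$\mathcal C(\rho)\to\sum_{j=2}^d\bigl(|E^+_{1j}\rangle\!\rangle\langle\!\langle E^+_{1j}|+|E^-_{1j}\rangle\!\rangle\langle\!\langle E^-_{1j}|\bigr),$$ which is an orthogonal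 projector of rank $2(d-1)$, and the optimal scaled MSE in (a) tends to $2(d-1)$. (c) This is at least a factor $(d+2)/2$ below minimal tomography: every informationally complete measurement with $d^2$ outcomes has a unique family of reconstruction operators, and its scaled MSE, averaged over all pure states with respect to $\mu$, is at least $\frac{d+2}2\cdot2(d-1)=d^2+d-2$. Every SIC measurement (effects $|\psi_\xi\rangle\langle\psi_\xi|/d$, $1\le\xi\le d^2$, with unit vectors satisfying $|\langle\psi_\xi|\psi_\zeta\rangle|^2=\frac{d\delta_{\xi\zeta}+1}{d+1}$) is an informationally complete POVM, and its scaled MSE equals this value at every pure state. (d) For every full-rank $\rho$, the scaled mean errors of the optimal reconstruction in (a) with respect to the trace distance and the HS distance converge as $N\to\infty$ to numbers $\mathcal E_{\mathrm{tr}}(\rho)$ and $\mathcal E_{\mathrm{HS}}(\rho)$. As $\rho$ tends to any pure state through full-rank states, $$\mathcal E_{\mathrm{tr}}(\rho)\to\frac{\Gamma(d-\frac12)}{\Gamma(d-1)},\qquad \mathcal E_{\mathrm{HS}}(\rho)\to\sqrt2\,\frac{\Gamma(d-\frac12)}{\Gamma(d-1)},$$ so that in this limit the scaled mean trace distance is $1/\sqrt2$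 times the scaled mean HS error. (e) $\Gamma(d-\frac12)/\Gamma(d-1)\sim\sqrt{d-1}$ as $d\to\infty$. -/

import Mathlib

open MeasureTheory Filter Topology Matrix
open scoped ComplexOrder

noncomputable section

namespace Tomography

/-- Operators on the `d`-dimensional Hilbert space `ℂ^d`. -/
abbrev Op (d : ℕ) := Matrix (Fin d) (Fin d) ℂ

/-- Superoperators, written as matrices in the basis of matrix units of the space of operators. -/
abbrev SuperOp (d : ℕ) := Matrix (Fin d × Fin d) (Fin d × Fin d) ℂ

/-- Unit vectors of `ℂ^d`. -/
abbrev UnitVec (d : ℕ) := Metric.sphere (0 : EuclideanSpace ℂ (Fin d)) 1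

/-- The operator `|v⟩⟨w|`. -/
def ketbra {d : ℕ} (v w : EuclideanSpace ℂ (Fin d)) : Op d :=
  Matrix.of fun i j => v i * star (w j)

/-- The rank-one superoperator `|A⟩⟩⟨⟨B|`, i.e. `X ↦ tr(B† X) A`. -/
def outer {d : ℕ} (A B : Op d) : SuperOp d :=
  Matrix.of fun p q => A p.1 p.2 * star (B q.1 q.2)

/-- The action of a superoperator on an operator. -/
def SuperOp.app {d : ℕ} (S : SuperOp d) (A : Op d) : Op d :=
  Matrix.of fun i j => ∑ q : Fin d × Fin d, S (i, j) q * A q.1 q.2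

/-- Density operators. -/
def IsState {d : ℕ} (ρ : Op d) : Prop := ρ.PosSemidef ∧ ρ.trace = 1

/-- The density operators of full rank. -/
def fullRankStates (d : ℕ) : Set (Op d) := {ρ | ρ.PosDef ∧ ρ.trace = 1}

/-- The Hilbert--Schmidt norm. -/
def hsNorm {d : ℕ} (A : Op d) : ℝ := √((Aᴴ * A).trace.re)

/-- The norm that induces the trace distance: half the sum of the singular values. -/
def trNorm {d : ℕ} (A : Op d) : ℝ :=
  (1 / 2) * ∑ i, √((isHermitian_conjTranspose_mul_self A).eigenvalues i)

/-- The normalized unitarily invariant measure on the unit vectors of `ℂ^d`. -/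
def haarVec (d : ℕ) : Measure (UnitVec d) :=
  ((volume : Measure (EuclideanSpace ℂ (Fin d))).toSphere Set.univ)⁻¹ •
    (volume : Measure (EuclideanSpace ℂ (Fin d))).toSphere

/-- The scaled deviation `Δρ = √N (ρ̂ - ρ)` of the estimator `ρ̂ = N⁻¹ ∑ᵢ Θ (ω i)`, in which the
outcome frequencies of the sample `ω` replace the outcome probabilities. -/
def deviation {d : ℕ} {X : Type} (N : ℕ) (Θ : X → Op d) (ρ : Op d) (ω : Fin N → X) : Op d :=
  ((√(N : ℝ) : ℝ) : ℂ) • (((N : ℂ)⁻¹ • ∑ i, Θ (ω i)) - ρ)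

/-- The data of a measurement with outcomes in `X`: the effects `effect x ∂ref(x)`. A measurement
with finitely many outcomes has the counting measure as its reference measure. -/
structure Measurement (d : ℕ) (X : Type) [MeasurableSpace X] where
  ref : Measure X
  effect : X → Op d

namespace Measurement

variable {d : ℕ} {X : Type} [MeasurableSpace X] (M : Measurement d X)

/-- The effects are positive and sum up to the identity. -/
structure IsPOVM : Prop where
  posSemidef : ∀ x, (M.effect x).PosSemidef
  integrable : ∀ i j, Integrable (fun x => M.effect x i j) M.ref
  integral_eq : ∀ i j, ∫ x, M.effect x i j ∂M.ref = (1 : Op d) i j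

/-- Born's rule: the probability (density with respect to `ref`) of the outcome `x`. -/
def prob (ρ : Op d) (x : X) : ℝ := (M.effect x * ρ).trace.re

/-- The distribution of the outcome of one measurement on `ρ`. -/
def outcomeLaw (ρ : Op d) : Measure X :=
  M.ref.withDensity fun x => ENNReal.ofReal (M.prob ρ x)

/-- The distribution of the outcomes of `N` independent measurements on copies of `ρ`. -/
def sampleLaw (N : ℕ) (ρ : Op d) : Measure (Fin N → X) :=
  Measure.pi fun _ => M.outcomeLaw ρ

/-- Every state is determined by the outcome probabilities. -/
def IsInfoComplete : Prop :=
  ∀ ρ σ : Op d, IsState ρ → IsState σ → (∀ᵐ x ∂M.ref, M.prob ρ x = M.prob σ x) → ρ = σ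

/-- `Θ` is a family of reconstruction operators: `∑ₓ |Θₓ⟩⟩⟨⟨Πₓ| = 𝐈`. -/
def IsReconstruction (Θ : X → Op d) : Prop :=
  ∀ p q, ∫ x, outer (Θ x) (M.effect x) p q ∂M.ref = (1 : SuperOp d) p q

/-- The reconstruction operators have finite second moments at the state `ρ`. -/
def SquareIntegrable (Θ : X → Op d) (ρ : Op d) : Prop :=
  ∀ i j, MemLp (fun x => Θ x i j) 2 (M.outcomeLaw ρ)

/-- The scaled MSE matrix `E |Δρ⟩⟩⟨⟨Δρ|` of the estimator with reconstruction operators `Θ`. -/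
def mseMatrix (N : ℕ) (Θ : X → Op d) (ρ : Op d) : SuperOp d :=
  Matrix.of fun p q =>
    ∫ ω, outer (deviation N Θ ρ ω) (deviation N Θ ρ ω) p q ∂M.sampleLaw N ρ

/-- The scaled mean square error `E ‖Δρ‖²` in the Hilbert--Schmidt norm. -/
def scaledMSE (N : ℕ) (Θ : X → Op d) (ρ : Op d) : ℝ :=
  ∫ ω, hsNorm (deviation N Θ ρ ω) ^ 2 ∂M.sampleLaw N ρ

/-- The scaled mean error `E ‖Δρ‖` in the Hilbert--Schmidt norm. -/
def meanHS (N : ℕ) (Θ : X → Op d) (ρ : Op d) : ℝ :=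
  ∫ ω, hsNorm (deviation N Θ ρ ω) ∂M.sampleLaw N ρ

/-- The scaled mean trace distance. -/
def meanTr (N : ℕ) (Θ : X → Op d) (ρ : Op d) : ℝ :=
  ∫ ω, trNorm (deviation N Θ ρ ω) ∂M.sampleLaw N ρ

/-- The frame superoperator `𝓕(ρ) = ∑ₓ |Πₓ⟩⟩ pₓ⁻¹ ⟨⟨Πₓ|`. -/
def frame (ρ : Op d) : SuperOp d :=
  Matrix.of fun p q =>
    ∫ x, ((M.prob ρ x)⁻¹ : ℂ) * outer (M.effect x) (M.effect x) p q ∂M.ref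

/-- The reconstruction operators `Θₓ = pₓ⁻¹ 𝓕(ρ)⁻¹ Πₓ` of the best linear unbiased estimator. -/
def blue (ρ : Op d) (x : X) : Op d :=
  ((M.prob ρ x)⁻¹ : ℂ) • SuperOp.app (M.frame ρ)⁻¹ (M.effect x)

/-- The superoperator `𝓒(ρ) = 𝓕(ρ)⁻¹ - |ρ⟩⟩⟨⟨ρ|`. -/
def optMSEMatrix (ρ : Op d) : SuperOp d := (M.frame ρ)⁻¹ - outer ρ ρ

end Measurement

/-- The covariant measurement, with effects `d |ψ⟩⟨ψ| dμ(ψ)`. -/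
def covariant (d : ℕ) : Measurement d (UnitVec d) where
  ref := (d : ENNReal) • haarVec d
  effect ψ := ketbra ψ.1 ψ.1

/-- The measurement with the finitely many effects `P ξ`. -/
def discrete {d n : ℕ} (P : Fin n → Op d) : Measurement d (Fin n) where
  ref := Measure.count
  effect := P

/-- Symmetric informationally complete measurements. -/
def IsSIC {d : ℕ} (P : Fin (d ^ 2) → Op d) : Prop :=
  ∃ ψ : Fin (d ^ 2) → UnitVec d,
    (∀ ξ, P ξ = (d : ℂ)⁻¹ • ketbra (ψ ξ).1 (ψ ξ).1) ∧
    ∀ ξ ζ, ‖inner ℂ (ψ ξ).1 (ψ ζ).1‖ ^ 2 = ((d : ℝ) * (if ξ = ζ then 1 else 0) + 1) / (d + 1)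

/-- `E⁺_{jk} = (|j⟩⟨k| + |k⟩⟨j|)/√2` in an orthonormal basis. -/
def Eplus {d : ℕ} (e : OrthonormalBasis (Fin d) ℂ (EuclideanSpace ℂ (Fin d))) (j k : Fin d) :
    Op d :=
  ((√2 : ℝ) : ℂ)⁻¹ • (ketbra (e j) (e k) + ketbra (e k) (e j))

/-- `E⁻_{jk} = -i (|j⟩⟨k| - |k⟩⟨j|)/√2` in an orthonormal basis. -/
def Eminus {d : ℕ} (e : OrthonormalBasis (Fin d) ℂ (EuclideanSpace ℂ (Fin d))) (j k : Fin d) :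
    Op d :=
  (-Complex.I * ((√2 : ℝ) : ℂ)⁻¹) • (ketbra (e j) (e k) - ketbra (e k) (e j))

/-- `∑_{j ≠ k} (|E⁺_{kj}⟩⟩⟨⟨E⁺_{kj}| + |E⁻_{kj}⟩⟩⟨⟨E⁻_{kj}|)`. -/
def pureLimit {d : ℕ} (e : OrthonormalBasis (Fin d) ℂ (EuclideanSpace ℂ (Fin d))) (k : Fin d) :
    SuperOp d :=
  ∑ j ∈ Finset.univ.erase k,
    (outer (Eplus e k j) (Eplus e k j) + outer (Eminus e k j) (Eminus e k j))

end Tomography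

end

open Tomography

/-! Optimality is a Gauss–Markov argument. Weight and inverse probability cancel, so every
square-integrable reconstruction has the same correlation `𝓕(ρ)⁻¹` with `blue` under the outcome law
(`Measurement.integral_mul_star_blue`). Hence the second-moment matrix of `Θ` minus that of `blue`
is the second-moment matrix of the difference, which is positive. Independence of the outcomes turns
second moments into scaled MSE matrices for every `N ≥ 1`.

The limit at a pure state `P = |e⟩⟨e|` is singular. With `Q = 1 - P`, the quadratic form of `𝓕(ρ)`
diverges on operators with a nonzero block `Q A Q`, since `1/|⟨e|ψ⟩|²` is not integrable across the
hyperplane orthogonal to `e`, which has real codimension two. The frame is never computed; its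
inverse is squeezed. The inverses are uniformly bounded (`norm_frame_inv_le`), so it suffices to
identify every cluster value `M`. From below, Cauchy–Schwarz and the variational formula give
`𝓕(ρ)⁻¹ ≥` left and right multiplication by `ρ`, and this passes to `M`. From above, the form of the
frame at `P + ε`, evaluated at `M X`, stays below `⟨⟨X|M X⟩⟩` for all `ε > 0`. By the logarithmic
divergence (`expVal_eq_zero_of_lintegral_ne_top`) this forces `Q (M X) Q = 0`. On operators without
that block, averaging over the phase of the `e` component shows that the limiting form is the
Hilbert–Schmidt norm (`re_hsInner_self_le`), so `‖M X‖² ≤ ⟨⟨X|M X⟩⟩`. Together these bounds force `M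
X = X - Q X Q`; subtracting `|P⟩⟩⟨⟨P|` leaves the off-diagonal blocks.

For minimal tomography, `d²` outcomes make the analysis and synthesis matrices square, hence
mutually inverse. The pure-state average of the MSE is `∑ tr(Pₓ) ‖Θₓ‖² / d - 1`. It is bounded below
by completing the square around `(d+1) Pₓ / tr Pₓ - 1` (`two_mul_re_hsInner_le`), the form of the
SIC reconstruction; the linear terms are fixed by two contractions of the reconstruction identity.

For the mean errors, the central limit theorem gives a Gaussian law whose characteristic function
depends on `ρ` only through `𝓒(ρ)`. As `ρ → P` these laws therefore converge weakly to a standard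
Gaussian on the `2(d-1)`-dimensional tangent space. Bounded second moments let functions of linear
growth pass through both limits. A nonzero tangent operator `|e⟩⟨w| + |w⟩⟨e|` has two equal nonzero
singular values, whence the factor `1/√2`; the Gamma quotient is the mean length of a Gaussian
vector. Its growth follows from log-convexity of the Gamma function. -/

noncomputable section

open scoped Pointwise

namespace Tomography

/-! ### The invariant measure on unit vectors -/

section Haar

variable {d : ℕ}

/-- The action of a linear isometry on unit vectors. -/
def UnitVec.map (f : EuclideanSpace ℂ (Fin d) ≃ₗᵢ[ℂ] EuclideanSpace ℂ (Fin d))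
    (ψ : UnitVec d) : UnitVec d :=
  ⟨f ψ.1, by simp⟩

theorem UnitVec.continuous_map
    (f : EuclideanSpace ℂ (Fin d) ≃ₗᵢ[ℂ] EuclideanSpace ℂ (Fin d)) :
    Continuous (UnitVec.map f) :=
  (f.continuous.comp continuous_subtype_val).subtype_mk _

theorem UnitVec.norm_val (ψ : UnitVec d) : ‖ψ.1‖ = 1 := by simp

/-- A complex linear isometry, regarded as a real linear isometry. -/
def realIsometry (f : EuclideanSpace ℂ (Fin d) ≃ₗᵢ[ℂ] EuclideanSpace ℂ (Fin d)) :
    EuclideanSpace ℂ (Fin d) ≃ₗᵢ[ℝ] EuclideanSpace ℂ (Fin d) :=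
  ⟨f.toLinearEquiv.restrictScalars ℝ, f.norm_map⟩

/-- The surface measure of a set is, up to a constant, the volume of the cone over it, and a linear
isometry carries cones to cones of equal volume. -/
theorem measurePreserving_map_haarVec
    (f : EuclideanSpace ℂ (Fin d) ≃ₗᵢ[ℂ] EuclideanSpace ℂ (Fin d)) :
    MeasurePreserving (UnitVec.map f) (haarVec d) (haarVec d) := by
  have hmeas := (UnitVec.continuous_map f).measurable
  have key : MeasurePreserving (UnitVec.map f)
      (volume : Measure (EuclideanSpace ℂ (Fin d))).toSphere
      (volume : Measure (EuclideanSpace ℂ (Fin d))).toSphere := by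
    refine ⟨hmeas, ?_⟩
    ext s hs
    rw [Measure.map_apply hmeas hs, Measure.toSphere_apply' _ (hmeas hs),
      Measure.toSphere_apply' _ hs]
    congr 1
    conv_rhs => rw [← MeasurePreserving.measure_preimage_equiv
      (f := (realIsometry f).toMeasurableEquiv) (realIsometry f).measurePreserving]
    congr 1
    ext z
    simp only [Set.mem_preimage, Set.mem_smul, Set.mem_image]
    constructor
    · rintro ⟨r, hr, _, ⟨ψ, hψ, rfl⟩, rfl⟩
      exact ⟨r, hr, _, ⟨UnitVec.map f ψ, hψ, rfl⟩, ((realIsometry f).map_smul r ψ.1).symm⟩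
    · rintro ⟨r, hr, _, ⟨φ, hφ, rfl⟩, h⟩
      refine ⟨r, hr, _, ⟨UnitVec.map f.symm φ, ?_, rfl⟩, ?_⟩
      · have : UnitVec.map f (UnitVec.map f.symm φ) = φ := Subtype.ext (f.apply_symm_apply _)
        simpa [Set.mem_preimage, this] using hφ
      · apply (realIsometry f).injective
        rw [(realIsometry f).map_smul]
        refine Eq.trans ?_ h
        congr 1
        exact f.apply_symm_apply _
  exact ⟨hmeas, by rw [haarVec, Measure.map_smul, key.map_eq]⟩

instance isFiniteMeasure_haarVec : IsFiniteMeasure (haarVec d) := by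
  rw [haarVec]
  -- If the sphere has mass zero, the normalizing factor is infinite but multiplies the zero
  -- measure.
  by_cases h : (volume : Measure (EuclideanSpace ℂ (Fin d))).toSphere Set.univ = 0
  · rw [Measure.measure_univ_eq_zero] at h
    rw [h, smul_zero]
    infer_instance
  · exact Measure.smul_finite _ (ENNReal.inv_ne_top.2 h)

theorem isProbabilityMeasure_haarVec (hd : d ≠ 0) : IsProbabilityMeasure (haarVec d) := by
  have : Nonempty (Fin d) := ⟨⟨0, Nat.pos_of_ne_zero hd⟩⟩
  have : Nontrivial (EuclideanSpace ℂ (Fin d)) := inferInstance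
  refine ⟨?_⟩
  rw [haarVec, Measure.smul_apply, smul_eq_mul]
  exact ENNReal.inv_mul_cancel
    (by rw [Ne, Measure.measure_univ_eq_zero]; exact Measure.toSphere_ne_zero _)
    (measure_ne_top _ _)

instance isOpenPosMeasure_haarVec : (haarVec d).IsOpenPosMeasure := by
  refine ⟨fun U hU hne => ?_⟩
  rw [haarVec, Measure.smul_apply, smul_eq_mul]
  exact mul_ne_zero (ENNReal.inv_ne_zero.2 (measure_ne_top _ _)) (hU.measure_ne_zero _ hne)

/-- Proper complex hyperplanes are negligible. -/
theorem haarVec_inner_eq_zero {e : EuclideanSpace ℂ (Fin d)} (he : e ≠ 0) :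
    ∀ᵐ ψ ∂haarVec d, inner ℂ e ψ.1 ≠ 0 := by
  have hcont : Continuous fun ψ : UnitVec d => inner ℂ e ψ.1 := by fun_prop
  have hs : MeasurableSet {ψ : UnitVec d | ¬ inner ℂ e ψ.1 ≠ 0} := by
    simp only [not_not]
    exact (isClosed_eq hcont continuous_const).measurableSet
  rw [ae_iff, haarVec, Measure.smul_apply, smul_eq_mul, Measure.toSphere_apply' _ hs]
  let W : Submodule ℝ (EuclideanSpace ℂ (Fin d)) :=
    (LinearMap.ker (innerSL ℂ e).toLinearMap).restrictScalars ℝ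
  have hW : W ≠ ⊤ := by
    intro h
    have : e ∈ W := h ▸ Submodule.mem_top
    have h2 : inner ℂ e e = 0 := this
    exact he (inner_self_eq_zero.1 h2)
  have : volume (Set.Ioo (0 : ℝ) 1 •
      ((↑) '' {ψ : UnitVec d | ¬ inner ℂ e ψ.1 ≠ 0} : Set (EuclideanSpace ℂ (Fin d)))) = 0 := by
    refine measure_mono_null ?_ (Measure.addHaar_submodule volume W hW)
    rintro _ ⟨r, hr, _, ⟨ψ, hψ, rfl⟩, rfl⟩
    exact W.smul_mem r (show ψ.1 ∈ W from not_not.1 hψ)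
  rw [this, mul_zero, mul_zero]

theorem integrable_haarVec {F : Type*} [NormedAddCommGroup F] {f : UnitVec d → F}
    (hf : Continuous f) : Integrable f (haarVec d) :=
  hf.integrable_of_hasCompactSupport (HasCompactSupport.of_compactSpace _)

theorem integral_haarVec_map {F : Type*} [NormedAddCommGroup F] [NormedSpace ℝ F]
    (f : EuclideanSpace ℂ (Fin d) ≃ₗᵢ[ℂ] EuclideanSpace ℂ (Fin d)) {g : UnitVec d → F}
    (hg : Continuous g) : ∫ ψ, g (UnitVec.map f ψ) ∂haarVec d = ∫ ψ, g ψ ∂haarVec d := by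
  have h := (measurePreserving_map_haarVec f)
  conv_rhs => rw [← h.map_eq]
  rw [integral_map h.measurable.aemeasurable hg.aestronglyMeasurable]

/-- Multiplication of the component along the unit vector `e` by the phase `c`. -/
def phaseRotation (e : EuclideanSpace ℂ (Fin d)) (he : ‖e‖ = 1) (c : ℂ) (hc : ‖c‖ = 1) :
    EuclideanSpace ℂ (Fin d) ≃ₗᵢ[ℂ] EuclideanSpace ℂ (Fin d) where
  toFun ψ := ψ + ((c - 1) * inner ℂ e ψ) • e
  invFun ψ := ψ + ((star c - 1) * inner ℂ e ψ) • e
  map_add' x y := by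
    rw [inner_add_right]; module
  map_smul' a x := by
    rw [inner_smul_right, RingHom.id_apply]; module
  left_inv ψ := by
    have h : inner ℂ e e = 1 := by rw [inner_self_eq_norm_sq_to_K, he]; norm_num
    have hc' : star c * c = 1 := by
      rw [Complex.star_def, ← Complex.normSq_eq_conj_mul_self, Complex.normSq_eq_norm_sq, hc]
      norm_num
    simp only [inner_add_right, inner_smul_right, h, add_assoc, ← add_smul]
    rw [show (c - 1) * inner ℂ e ψ + (star c - 1) * (inner ℂ e ψ + (c - 1) * inner ℂ e ψ * 1)
      = (star c * c - 1) * inner ℂ e ψ by ring, hc']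
    simp
  right_inv ψ := by
    have h : inner ℂ e e = 1 := by rw [inner_self_eq_norm_sq_to_K, he]; norm_num
    have hc' : star c * c = 1 := by
      rw [Complex.star_def, ← Complex.normSq_eq_conj_mul_self, Complex.normSq_eq_norm_sq, hc]
      norm_num
    simp only [inner_add_right, inner_smul_right, h, add_assoc, ← add_smul]
    rw [show (star c - 1) * inner ℂ e ψ + (c - 1) * (inner ℂ e ψ + (star c - 1) * inner ℂ e ψ * 1)
      = (star c * c - 1) * inner ℂ e ψ by ring, hc']
    simp
  norm_map' ψ := by
    have h : inner ℂ e e = 1 := by rw [inner_self_eq_norm_sq_to_K, he]; norm_num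
    have hc' : star c * c = 1 := by
      rw [Complex.star_def, ← Complex.normSq_eq_conj_mul_self, Complex.normSq_eq_norm_sq, hc]
      norm_num
    have key : inner ℂ (ψ + ((c - 1) * inner ℂ e ψ) • e) (ψ + ((c - 1) * inner ℂ e ψ) • e)
        = inner ℂ ψ ψ := by
      simp only [inner_add_right, inner_add_left, inner_smul_right, inner_smul_left, h,
        map_mul, map_sub, map_one, inner_conj_symm]
      rw [Complex.star_def] at hc'
      linear_combination (inner ℂ e ψ * inner ℂ ψ e) * hc'
    rw [inner_self_eq_norm_sq_to_K, inner_self_eq_norm_sq_to_K] at key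
    have key2 : ‖ψ + ((c - 1) * inner ℂ e ψ) • e‖ ^ 2 = ‖ψ‖ ^ 2 := by exact_mod_cast key
    exact (pow_left_inj₀ (norm_nonneg _) (norm_nonneg _) two_ne_zero).1 key2

theorem phaseRotation_apply (e : EuclideanSpace ℂ (Fin d)) (he : ‖e‖ = 1) (c : ℂ) (hc : ‖c‖ = 1)
    (ψ : EuclideanSpace ℂ (Fin d)) :
    phaseRotation e he c hc ψ = ψ + ((c - 1) * inner ℂ e ψ) • e := rfl

theorem UnitVec.sum_mul_star (ψ : UnitVec d) : ∑ i, ψ.1 i * star (ψ.1 i) = 1 := by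
  have h := EuclideanSpace.norm_sq_eq ψ.1
  rw [UnitVec.norm_val] at h
  have : ∀ i, ψ.1 i * star (ψ.1 i) = ((‖ψ.1 i‖ ^ 2 : ℝ) : ℂ) := fun i => by
    rw [Complex.star_def, Complex.mul_conj, Complex.normSq_eq_norm_sq]
  simp_rw [this, ← Complex.ofReal_sum, ← h]
  norm_num

theorem continuous_coord_mul_star (i j : Fin d) :
    Continuous fun ψ : UnitVec d => ψ.1 i * star (ψ.1 j) := by fun_prop

/-- The first moments of the invariant measure. -/
theorem integral_coord_mul_star (i j : Fin d) :
    (d : ℂ) * ∫ ψ, ψ.1 i * star (ψ.1 j) ∂haarVec d = (1 : Op d) i j := by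
  have hd : d ≠ 0 := fun h => by subst h; exact i.elim0
  have := isProbabilityMeasure_haarVec hd
  by_cases hij : i = j
  · subst hij
    -- Swapping two coordinates is an isometry, so all diagonal moments agree; they sum to one.
    have hsw : ∀ j, ∫ ψ : UnitVec d, ψ.1 j * star (ψ.1 j) ∂haarVec d
        = ∫ ψ : UnitVec d, ψ.1 i * star (ψ.1 i) ∂haarVec d := fun j => by
      rw [← integral_haarVec_map (LinearIsometryEquiv.piLpCongrLeft 2 ℂ ℂ (Equiv.swap i j))
        (continuous_coord_mul_star i i)]
      refine integral_congr_ae (Eventually.of_forall fun ψ => ?_)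
      simp [UnitVec.map, LinearIsometryEquiv.piLpCongrLeft_apply, Equiv.piCongrLeft'_apply]
    have hsum : ∑ j, ∫ ψ : UnitVec d, ψ.1 j * star (ψ.1 j) ∂haarVec d = 1 := by
      rw [← integral_finsetSum _ fun j _ => integrable_haarVec (continuous_coord_mul_star j j)]
      simp only [UnitVec.sum_mul_star, integral_const, probReal_univ, one_smul]
    simp_rw [hsw] at hsum
    simpa using hsum
  -- Flipping the sign of coordinate `i` alone negates an off-diagonal moment.
  · have h := integral_haarVec_map
      (phaseRotation (EuclideanSpace.single i 1) (by simp) (-1) (by simp))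
      (continuous_coord_mul_star i j)
    have h2 : ∀ ψ : UnitVec d, (UnitVec.map (phaseRotation (EuclideanSpace.single i 1) (by simp)
        (-1) (by simp)) ψ).1 i * star ((UnitVec.map (phaseRotation (EuclideanSpace.single i 1)
        (by simp) (-1) (by simp)) ψ).1 j) = - (ψ.1 i * star (ψ.1 j)) := fun ψ => by
      simp [UnitVec.map, phaseRotation_apply, EuclideanSpace.inner_single_left, Ne.symm hij]
      ring
    simp_rw [h2, integral_neg] at h
    rw [Matrix.one_apply_ne hij, mul_eq_zero]
    exact Or.inr (self_eq_neg.1 h.symm)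

end Haar

/-- The covariant measurement is a POVM. -/
theorem covariant_isPOVM (d : ℕ) : (covariant d).IsPOVM where
  posSemidef ψ := by
    have : (covariant d).effect ψ = Matrix.vecMulVec (ψ.1 : Fin d → ℂ) (star (ψ.1 : Fin d → ℂ)) := by
      ext i j; rfl
    rw [this]
    exact Matrix.posSemidef_vecMulVec_self_star _
  integrable i j :=
    (integrable_haarVec (continuous_coord_mul_star i j)).smul_measure (ENNReal.natCast_ne_top d)
  integral_eq i j := by
    change ∫ ψ : UnitVec d, ψ.1 i * star (ψ.1 j) ∂((d : ENNReal) • haarVec d) = _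
    rw [integral_smul_measure, ← integral_coord_mul_star]
    simp

/-! ### Second moments of scaled sample means -/

section Sample

theorem memLp_star {Y : Type*} [MeasurableSpace Y] {κ : Measure Y} {v : Y → ℂ}
    (hv : MemLp v 2 κ) : MemLp (fun x => star (v x)) 2 κ := by
  refine hv.congr_norm ?_ (Eventually.of_forall fun x => by simp)
  simpa using continuous_star.comp_aestronglyMeasurable hv.1

theorem integrable_mul_star {Y : Type*} [MeasurableSpace Y] {κ : Measure Y} {u v : Y → ℂ}
    (hu : MemLp u 2 κ) (hv : MemLp v 2 κ) : Integrable (fun y => u y * star (v y)) κ :=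
  hu.integrable_mul (memLp_star hv)

/-- The scaled deviation of a sample mean of one coordinate. -/
theorem deviation_apply {d N : ℕ} {X : Type} (hN : 1 ≤ N) (Θ : X → Op d) (ρ : Op d) (ω : Fin N → X)
    (i j : Fin d) :
    deviation N Θ ρ ω i j = ((√(N : ℝ) : ℝ) : ℂ)⁻¹ * ∑ k, (Θ (ω k) i j - ρ i j) := by
  have hN' : (0 : ℝ) < N := by exact_mod_cast hN
  have h1 : ((√(N : ℝ) : ℝ) : ℂ) ≠ 0 := by exact_mod_cast (Real.sqrt_pos.2 hN').ne'
  have h2 : ((√(N : ℝ) : ℝ) : ℂ) * ((√(N : ℝ) : ℝ) : ℂ) = N := by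
    exact_mod_cast Real.mul_self_sqrt hN'.le
  have h3 : (N : ℂ) ≠ 0 := by exact_mod_cast hN'.ne'
  simp only [deviation, Matrix.smul_apply, Matrix.sub_apply, smul_eq_mul, Matrix.sum_apply,
    Finset.sum_sub_distrib, Finset.sum_const, Finset.card_univ, Fintype.card_fin, nsmul_eq_mul]
  rw [← h2]
  field_simp

variable {X : Type} [MeasurableSpace X] {ν : Measure X} [IsProbabilityMeasure ν] {N : ℕ}
  {f g : X → ℂ}

theorem memLp_eval (hf : MemLp f 2 ν) (i : Fin N) :
    MemLp (fun ω : Fin N → X => f (ω i)) 2 (Measure.pi fun _ => ν) :=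
  hf.comp_measurePreserving (measurePreserving_eval (fun _ : Fin N => ν) i)

theorem integral_eval (hf : AEStronglyMeasurable f ν) (i : Fin N) :
    ∫ ω : Fin N → X, f (ω i) ∂(Measure.pi fun _ => ν) = ∫ x, f x ∂ν := by
  have h := measurePreserving_eval (fun _ : Fin N => ν) i
  conv_rhs => rw [← h.map_eq]
  rw [integral_map h.measurable.aemeasurable (by rwa [h.map_eq])]

theorem integral_eval_mul_eval (hf : AEStronglyMeasurable f ν) (hg : AEStronglyMeasurable g ν)
    {i j : Fin N} (hij : i ≠ j) :
    ∫ ω : Fin N → X, f (ω i) * star (g (ω j)) ∂(Measure.pi fun _ => ν) =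
      (∫ x, f x ∂ν) * ∫ x, star (g x) ∂ν := by
  have hg' : AEStronglyMeasurable (fun x => star (g x)) ν := by
    simpa using continuous_star.comp_aestronglyMeasurable hg
  -- One family of coordinate functions serves both factors: `f` at `i`, and the conjugate of `g` at
  -- every other index.
  have hind := ProbabilityTheory.iIndepFun_pi (μ := fun _ : Fin N => ν)
    (X := fun k => if k = i then f else fun x => star (g x)) (fun k => by
      split_ifs
      exacts [hf.aemeasurable, hg'.aemeasurable])
  have h2 := hind.indepFun hij
  simp only [if_true, if_neg hij.symm] at h2
  rw [h2.integral_fun_mul_eq_mul_integral, integral_eval hf, integral_eval hg']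
  · exact hf.comp_measurePreserving (measurePreserving_eval (fun _ : Fin N => ν) i)
  · exact hg'.comp_measurePreserving (measurePreserving_eval (fun _ : Fin N => ν) j)

/-- The `N` diagonal terms survive; cross terms factor by independence and vanish as soon as one of
the two functions is centered. -/
theorem integral_sum_mul_star_sum (hf : MemLp f 2 ν) (hg : MemLp g 2 ν) (h0 : ∫ x, f x ∂ν = 0) :
    ∫ ω : Fin N → X, (∑ i, f (ω i)) * star (∑ i, g (ω i)) ∂(Measure.pi fun _ => ν) =
      N * ∫ x, f x * star (g x) ∂ν := by
  simp_rw [star_sum, Finset.sum_mul_sum]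
  rw [integral_finsetSum _ fun i _ => integrable_finsetSum _ fun j _ =>
    integrable_mul_star (memLp_eval hf i) (memLp_eval hg j)]
  have : ∀ i : Fin N, ∫ ω : Fin N → X, ∑ j, f (ω i) * star (g (ω j)) ∂(Measure.pi fun _ => ν) =
      ∫ x, f x * star (g x) ∂ν := fun i => by
    rw [integral_finsetSum _ fun j _ => integrable_mul_star (memLp_eval hf i) (memLp_eval hg j),
      Finset.sum_eq_single i]
    · exact integral_eval (f := fun x => f x * star (g x)) (integrable_mul_star hf hg).1 i
    · intro j _ hj
      rw [integral_eval_mul_eval hf.1 hg.1 hj.symm, h0, zero_mul]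
    · simp
  simp only [this, Finset.sum_const, Finset.card_univ, Fintype.card_fin, nsmul_eq_mul]

variable {d : ℕ} {Θ : X → Op d} {ρ : Op d}

theorem memLp_deviation (hN : 1 ≤ N) (hΘ : ∀ i j, MemLp (fun x => Θ x i j) 2 ν) (i j : Fin d) :
    MemLp (fun ω => deviation N Θ ρ ω i j) 2 (Measure.pi fun _ => ν) := by
  simp_rw [deviation_apply hN]
  have h : ∀ k ∈ Finset.univ, MemLp (fun ω : Fin N → X => Θ (ω k) i j - ρ i j) 2
      (Measure.pi fun _ => ν) := fun k _ => (memLp_eval (hΘ i j) k).sub (memLp_const _)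
  exact (memLp_finsetSum _ h).const_mul _

theorem integral_centered_mul_star (hΘ : ∀ i j, MemLp (fun x => Θ x i j) 2 ν)
    (hm : ∀ i j, ∫ x, Θ x i j ∂ν = ρ i j) (i j k l : Fin d) :
    ∫ x, (Θ x i j - ρ i j) * star (Θ x k l - ρ k l) ∂ν =
      (∫ x, Θ x i j * star (Θ x k l) ∂ν) - ρ i j * star (ρ k l) := by
  have hc : MemLp (fun x => Θ x i j - ρ i j) 2 ν := (hΘ i j).sub (memLp_const _)
  have hm0 : ∫ x, (Θ x i j - ρ i j) ∂ν = 0 := by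
    rw [integral_sub ((hΘ i j).integrable (by norm_num)) (integrable_const _), hm, integral_const,
      probReal_univ, one_smul, sub_self]
  have e2 : ∀ x, (Θ x i j - ρ i j) * star (Θ x k l - ρ k l) =
      Θ x i j * star (Θ x k l) - ρ i j * star (Θ x k l) - (Θ x i j - ρ i j) * star (ρ k l) := by
    intro x; rw [star_sub]; ring
  simp_rw [e2]
  have hs : Integrable (fun x => star (Θ x k l)) ν := (memLp_star (hΘ k l)).integrable (by norm_num)
  rw [integral_sub, integral_sub, integral_mul_const, hm0, integral_const_mul, zero_mul, sub_zero]
  · congr 2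
    have : ∫ x, star (Θ x k l) ∂ν = star (∫ x, Θ x k l ∂ν) := integral_conj
    rw [this, hm]
  · exact integrable_mul_star (hΘ i j) (hΘ k l)
  · exact hs.const_mul _
  · exact (integrable_mul_star (hΘ i j) (hΘ k l)).sub (hs.const_mul _)
  · exact (hc.integrable (by norm_num)).mul_const _

/-- The two factors `√N` absorb exactly the `1/N` of the variance of a sample mean, so the result is
the one-sample covariance for every `N ≥ 1`. -/
theorem integral_deviation (hN : 1 ≤ N) (hΘ : ∀ i j, MemLp (fun x => Θ x i j) 2 ν)
    (hm : ∀ i j, ∫ x, Θ x i j ∂ν = ρ i j) (i j k l : Fin d) :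
    ∫ ω, deviation N Θ ρ ω i j * star (deviation N Θ ρ ω k l) ∂(Measure.pi fun _ => ν) =
      (∫ x, Θ x i j * star (Θ x k l) ∂ν) - ρ i j * star (ρ k l) := by
  have hN' : (0 : ℝ) < N := by exact_mod_cast hN
  have h1 : ((√(N : ℝ) : ℝ) : ℂ) ≠ 0 := by exact_mod_cast (Real.sqrt_pos.2 hN').ne'
  have h2 : ((√(N : ℝ) : ℝ) : ℂ) * ((√(N : ℝ) : ℝ) : ℂ) = N := by
    exact_mod_cast Real.mul_self_sqrt hN'.le
  have h3 : (N : ℂ) ≠ 0 := by exact_mod_cast hN'.ne'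
  have hi : ∀ i j, Integrable (fun x => Θ x i j) ν := fun i j => (hΘ i j).integrable (by norm_num)
  have hc : ∀ i j, MemLp (fun x => Θ x i j - ρ i j) 2 ν := fun i j => (hΘ i j).sub (memLp_const _)
  have hm0 : ∀ i j, ∫ x, (Θ x i j - ρ i j) ∂ν = 0 := fun i j => by
    rw [integral_sub (hi i j) (integrable_const _), hm, integral_const, probReal_univ, one_smul,
      sub_self]
  have key := integral_sum_mul_star_sum (N := N) (hc i j) (hc k l) (hm0 i j)
  have e1 : ∀ ω : Fin N → X, deviation N Θ ρ ω i j * star (deviation N Θ ρ ω k l) =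
      (N : ℂ)⁻¹ * ((∑ m, (Θ (ω m) i j - ρ i j)) * star (∑ m, (Θ (ω m) k l - ρ k l))) := fun ω => by
    rw [deviation_apply hN, deviation_apply hN, star_mul', ← h2, mul_inv]
    have : star (((√(N : ℝ) : ℝ) : ℂ)⁻¹) = ((√(N : ℝ) : ℝ) : ℂ)⁻¹ := by simp
    rw [this]
    ring
  simp_rw [e1]
  rw [integral_const_mul, key, ← mul_assoc, inv_mul_cancel₀ h3, one_mul,
    integral_centered_mul_star hΘ hm]

theorem hsNorm_sq (A : Op d) : hsNorm A ^ 2 = ∑ p : Fin d × Fin d, ‖A p.1 p.2‖ ^ 2 := by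
  have h : ((Aᴴ * A).trace.re) = ∑ p : Fin d × Fin d, ‖A p.1 p.2‖ ^ 2 := by
    rw [Matrix.trace, Complex.re_sum, Fintype.sum_prod_type_right]
    refine Finset.sum_congr rfl fun j _ => ?_
    rw [Matrix.diag_apply, Matrix.mul_apply, Complex.re_sum]
    refine Finset.sum_congr rfl fun i _ => ?_
    rw [Matrix.conjTranspose_apply, Complex.star_def, ← Complex.normSq_eq_conj_mul_self,
      Complex.ofReal_re, Complex.normSq_eq_norm_sq]
  rw [hsNorm, h, Real.sq_sqrt (Finset.sum_nonneg fun p _ => by positivity)]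

end Sample

namespace Measurement

variable {d : ℕ} {X : Type} [MeasurableSpace X] (M : Measurement d X)

theorem sampleLaw_eq (N : ℕ) (ρ : Op d) :
    M.sampleLaw N ρ = Measure.pi fun _ => M.outcomeLaw ρ := rfl

variable {M} {Θ : X → Op d} {ρ : Op d} {N : ℕ}

theorem mseMatrix_apply [IsProbabilityMeasure (M.outcomeLaw ρ)] (hN : 1 ≤ N)
    (hΘ : M.SquareIntegrable Θ ρ) (hm : ∀ i j, ∫ x, Θ x i j ∂M.outcomeLaw ρ = ρ i j)
    (p q : Fin d × Fin d) :
    M.mseMatrix N Θ ρ p q =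
      (∫ x, Θ x p.1 p.2 * star (Θ x q.1 q.2) ∂M.outcomeLaw ρ) - outer ρ ρ p q :=
  integral_deviation hN hΘ hm p.1 p.2 q.1 q.2

theorem integrable_hsNorm_sq_deviation [IsProbabilityMeasure (M.outcomeLaw ρ)] (hN : 1 ≤ N)
    (hΘ : M.SquareIntegrable Θ ρ) :
    Integrable (fun ω => hsNorm (deviation N Θ ρ ω) ^ 2) (M.sampleLaw N ρ) := by
  simp_rw [hsNorm_sq]
  exact integrable_finsetSum _ fun p _ => (memLp_deviation hN hΘ p.1 p.2).norm.integrable_sq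

theorem scaledMSE_eq_trace [IsProbabilityMeasure (M.outcomeLaw ρ)] (hN : 1 ≤ N)
    (hΘ : M.SquareIntegrable Θ ρ) :
    M.scaledMSE N Θ ρ = (M.mseMatrix N Θ ρ).trace.re := by
  rw [scaledMSE, Matrix.trace, Complex.re_sum]
  simp_rw [hsNorm_sq]
  rw [integral_finsetSum _ fun p _ => (memLp_deviation hN hΘ p.1 p.2).norm.integrable_sq]
  refine Finset.sum_congr rfl fun p _ => ?_
  have h : ∀ z : ℂ, z * star z = ((‖z‖ ^ 2 : ℝ) : ℂ) := fun z => by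
    rw [Complex.star_def, Complex.mul_conj, Complex.normSq_eq_norm_sq]
  simp only [Matrix.diag_apply, mseMatrix, outer, Matrix.of_apply, h]
  rw [integral_complex_ofReal, Complex.ofReal_re]

end Measurement

/-! ### Linear unbiased estimation for a general measurement -/

/-- The Hilbert--Schmidt inner product `⟨⟨A|B⟩⟩`. -/
def hsInner {d : ℕ} (A B : Op d) : ℂ := ∑ q : Fin d × Fin d, star (A q.1 q.2) * B q.1 q.2

theorem hsInner_eq_trace {d : ℕ} (A B : Op d) : hsInner A B = (Aᴴ * B).trace := by
  rw [hsInner, Fintype.sum_prod_type_right, Matrix.trace]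
  rfl

/-- The quadratic form at `z` is the integral of `|∑ star (z p) * v p|²`. -/
theorem posSemidef_of_integral {X ι : Type*} [Fintype ι] [MeasurableSpace X] {ν : Measure X}
    {v : ι → X → ℂ} (hv : ∀ p, MemLp (v p) 2 ν) :
    (Matrix.of fun p q => ∫ x, v p x * star (v q x) ∂ν).PosSemidef := by
  refine PosSemidef.of_dotProduct_mulVec_nonneg ?_ fun z => ?_
  · ext p q
    rw [Matrix.conjTranspose_apply, Matrix.of_apply, Matrix.of_apply]
    have : star (∫ x, v q x * star (v p x) ∂ν) = ∫ x, star (v q x * star (v p x)) ∂ν :=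
      integral_conj.symm
    rw [this]
    refine integral_congr_ae (Eventually.of_forall fun x => ?_)
    simp [mul_comm]
  · have h : star z ⬝ᵥ (Matrix.of fun p q => ∫ x, v p x * star (v q x) ∂ν) *ᵥ z =
        ∫ x, (((‖∑ p, star (z p) * v p x‖ ^ 2 : ℝ)) : ℂ) ∂ν := by
      have e : ∀ x, (((‖∑ p, star (z p) * v p x‖ ^ 2 : ℝ)) : ℂ) =
          ∑ p, ∑ q, star (z p) * z q * (v p x * star (v q x)) := fun x => by
        rw [← Complex.normSq_eq_norm_sq, ← Complex.mul_conj, ← Complex.star_def, star_sum,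
          Finset.sum_mul_sum]
        refine Finset.sum_congr rfl fun p _ => Finset.sum_congr rfl fun q _ => ?_
        rw [star_mul', star_star]; ring
      simp_rw [e]
      have hi : ∀ p q, Integrable (fun x => star (z p) * z q * (v p x * star (v q x))) ν :=
        fun p q => (integrable_mul_star (hv p) (hv q)).const_mul _
      rw [integral_finsetSum _ fun p _ => integrable_finsetSum _ fun q _ => hi p q]
      simp_rw [dotProduct, mulVec, dotProduct, Finset.mul_sum]
      refine Finset.sum_congr rfl fun p _ => ?_
      rw [integral_finsetSum _ fun q _ => hi p q]
      refine Finset.sum_congr rfl fun q _ => ?_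
      rw [integral_const_mul, Matrix.of_apply, Pi.star_apply]; ring
    rw [h, integral_complex_ofReal]
    exact_mod_cast integral_nonneg fun x => by positivity

open scoped MatrixOrder Matrix.Norms.L2Operator in
theorem exists_eq_conjTranspose_mul_self {n : Type*} [Fintype n] [DecidableEq n]
    {A : Matrix n n ℂ} (hA : A.PosSemidef) : ∃ C : Matrix n n ℂ, A = Cᴴ * C :=
  CStarAlgebra.nonneg_iff_eq_star_mul_self.1 hA.nonneg

theorem trace_mul_nonneg {n : Type*} [Fintype n] [DecidableEq n] {A B : Matrix n n ℂ}
    (hA : A.PosSemidef) (hB : B.PosSemidef) : 0 ≤ (A * B).trace := by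
  obtain ⟨C, rfl⟩ := exists_eq_conjTranspose_mul_self hB
  rw [← Matrix.mul_assoc, Matrix.trace_mul_comm, ← Matrix.mul_assoc]
  exact (hA.mul_mul_conjTranspose_same C).trace_nonneg

namespace Measurement

variable {d : ℕ} {X : Type} [MeasurableSpace X] {M : Measurement d X} {ρ : Op d} {Θ : X → Op d}

/-- The trace of a product of two Hermitian operators is real, so the real part taken in `prob`
loses nothing. -/
theorem prob_eq (hM : M.IsPOVM) (hρ : ρ.IsHermitian) (x : X) :
    (M.prob ρ x : ℂ) = hsInner (M.effect x) ρ := by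
  have h1 := (hM.posSemidef x).isHermitian
  have h2 : star ((M.effect x * ρ).trace) = (M.effect x * ρ).trace := by
    rw [← Matrix.trace_conjTranspose, Matrix.conjTranspose_mul, h1.eq, hρ.eq, Matrix.trace_mul_comm]
  rw [hsInner_eq_trace, h1.eq, prob]
  exact Complex.conj_eq_iff_re.1 h2

theorem prob_nonneg (hM : M.IsPOVM) (hρ : ρ.PosSemidef) (x : X) : 0 ≤ M.prob ρ x :=
  (Complex.le_def.1 (trace_mul_nonneg (hM.posSemidef x) hρ)).1

theorem integrable_hsInner (hM : M.IsPOVM) (A : Op d) :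
    Integrable (fun x => hsInner (M.effect x) A) M.ref := by
  refine integrable_finsetSum _ fun q _ => ?_
  refine Integrable.mul_const ?_ _
  exact LinearIsometryEquiv.integrable_comp_iff (Complex.conjLIE) |>.2 (hM.integrable q.1 q.2)

theorem integral_hsInner (hM : M.IsPOVM) (A : Op d) :
    ∫ x, hsInner (M.effect x) A ∂M.ref = A.trace := by
  have hc : ∀ i j, Integrable (fun x => star (M.effect x i j)) M.ref := fun i j =>
    LinearIsometryEquiv.integrable_comp_iff (Complex.conjLIE) |>.2 (hM.integrable i j)
  have hs : ∀ i j, ∫ x, star (M.effect x i j) ∂M.ref = star ((1 : Op d) i j) := fun i j => by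
    rw [← hM.integral_eq]; exact integral_conj
  simp only [hsInner]
  rw [integral_finsetSum _ fun q _ => (hc q.1 q.2).mul_const _]
  simp_rw [integral_mul_const, hs]
  rw [Fintype.sum_prod_type]
  simp [Matrix.one_apply, Matrix.trace]

theorem integrable_prob (hM : M.IsPOVM) (hρ : ρ.IsHermitian) :
    Integrable (fun x => M.prob ρ x) M.ref := by
  have h := (integrable_hsInner hM ρ).re
  refine h.congr (Eventually.of_forall fun x => ?_)
  simp [← prob_eq hM hρ]

theorem isProbabilityMeasure_outcomeLaw (hM : M.IsPOVM) (hρ : IsState ρ) :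
    IsProbabilityMeasure (M.outcomeLaw ρ) := by
  have hi := integrable_prob hM hρ.1.isHermitian
  refine ⟨?_⟩
  rw [outcomeLaw, withDensity_apply _ MeasurableSet.univ, Measure.restrict_univ,
    ← ofReal_integral_eq_lintegral_ofReal hi (Eventually.of_forall (prob_nonneg hM hρ.1))]
  have h : ((∫ x, M.prob ρ x ∂M.ref : ℝ) : ℂ) = 1 := by
    rw [← integral_complex_ofReal, ← hρ.2, ← integral_hsInner hM ρ]
    exact integral_congr_ae (Eventually.of_forall fun x => prob_eq hM hρ.1.isHermitian x)
  rw [Complex.ofReal_eq_one.1 h, ENNReal.ofReal_one]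

theorem integral_outcomeLaw (hM : M.IsPOVM) (hρ : ρ.PosSemidef) (f : X → ℂ) :
    ∫ x, f x ∂M.outcomeLaw ρ = ∫ x, (M.prob ρ x : ℂ) * f x ∂M.ref := by
  rw [outcomeLaw, integral_withDensity_eq_integral_toReal_smul₀
    (integrable_prob hM hρ.isHermitian).1.aemeasurable.ennreal_ofReal (by simp)]
  refine integral_congr_ae (Eventually.of_forall fun x => ?_)
  simp only
  rw [ENNReal.toReal_ofReal (prob_nonneg hM hρ x), Complex.real_smul]

/-- Reconstruction operators are unbiased. -/
theorem integral_reconstruction (hM : M.IsPOVM) (hρ : ρ.PosSemidef)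
    (hΘ : M.IsReconstruction Θ)
    (hint : ∀ p q, Integrable (fun x => outer (Θ x) (M.effect x) p q) M.ref) (i j : Fin d) :
    ∫ x, Θ x i j ∂M.outcomeLaw ρ = ρ i j := by
  rw [integral_outcomeLaw hM hρ]
  have e : ∀ x, (M.prob ρ x : ℂ) * Θ x i j =
      ∑ q : Fin d × Fin d, outer (Θ x) (M.effect x) (i, j) q * ρ q.1 q.2 := fun x => by
    rw [prob_eq hM hρ.isHermitian, hsInner, Finset.sum_mul]
    refine Finset.sum_congr rfl fun q _ => ?_
    simp only [outer, Matrix.of_apply]; ring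
  simp_rw [e]
  rw [integral_finsetSum _ fun q _ => (hint (i, j) q).mul_const _]
  simp_rw [integral_mul_const, hΘ (i, j)]
  simp [Matrix.one_apply]

theorem frame_isHermitian : (M.frame ρ).IsHermitian := by
  ext p q
  rw [Matrix.conjTranspose_apply, frame, Matrix.of_apply, Matrix.of_apply]
  refine Eq.trans (integral_conj (f := fun x =>
    ((M.prob ρ x)⁻¹ : ℂ) * outer (M.effect x) (M.effect x) q p)).symm ?_
  refine integral_congr_ae (Eventually.of_forall fun x => ?_)
  simp [outer, mul_comm]

theorem blue_apply (x : X) (p : Fin d × Fin d) :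
    M.blue ρ x p.1 p.2 =
      ((M.prob ρ x)⁻¹ : ℂ) * ∑ q, (M.frame ρ)⁻¹ p q * M.effect x q.1 q.2 := rfl

theorem blue_isReconstruction (hF : IsUnit (M.frame ρ))
    (hint : ∀ p q, Integrable
      (fun x => ((M.prob ρ x)⁻¹ : ℂ) * outer (M.effect x) (M.effect x) p q) M.ref) :
    M.IsReconstruction (M.blue ρ) := by
  intro p q
  have e : ∀ x, outer (M.blue ρ x) (M.effect x) p q = ∑ r, (M.frame ρ)⁻¹ p r *
      (((M.prob ρ x)⁻¹ : ℂ) * outer (M.effect x) (M.effect x) r q) := fun x => by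
    simp only [outer, Matrix.of_apply, blue_apply, Finset.mul_sum, Finset.sum_mul]
    refine Finset.sum_congr rfl fun r _ => by ring
  simp_rw [e]
  rw [integral_finsetSum _ fun r _ => (hint r q).const_mul _]
  simp_rw [integral_const_mul]
  have h := Matrix.nonsing_inv_mul _ ((Matrix.isUnit_iff_isUnit_det _).1 hF)
  rw [← h, Matrix.mul_apply]
  rfl

/-- The correlation of an unbiased estimator with the best one. -/
theorem integral_mul_star_blue (hM : M.IsPOVM) (hρ : ρ.PosSemidef) (hpos : ∀ x, 0 < M.prob ρ x)
    (hΘ : M.IsReconstruction Θ)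
    (hint : ∀ p q, Integrable (fun x => outer (Θ x) (M.effect x) p q) M.ref)
    (p q : Fin d × Fin d) :
    ∫ x, Θ x p.1 p.2 * star (M.blue ρ x q.1 q.2) ∂M.outcomeLaw ρ = (M.frame ρ)⁻¹ p q := by
  rw [integral_outcomeLaw hM hρ]
  -- The density of the outcome law cancels the factor `pₓ⁻¹` in `blue`; what remains is the
  -- integrand of the reconstruction identity.
  have e : ∀ x, (M.prob ρ x : ℂ) * (Θ x p.1 p.2 * star (M.blue ρ x q.1 q.2)) =
      ∑ r, outer (Θ x) (M.effect x) p r * star ((M.frame ρ)⁻¹ q r) := fun x => by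
    have hp : (M.prob ρ x : ℂ) ≠ 0 := by exact_mod_cast (hpos x).ne'
    rw [blue_apply, star_mul', star_sum]
    have : star ((M.prob ρ x : ℂ)⁻¹) = (M.prob ρ x : ℂ)⁻¹ := by simp
    rw [this, mul_left_comm, ← mul_assoc (M.prob ρ x : ℂ), mul_inv_cancel₀ hp, one_mul,
      Finset.mul_sum]
    refine Finset.sum_congr rfl fun r _ => ?_
    simp only [outer, Matrix.of_apply, star_mul']; ring
  simp_rw [e]
  rw [integral_finsetSum _ fun r _ => (hint p r).mul_const _]
  simp_rw [integral_mul_const, hΘ p]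
  simp only [Matrix.one_apply, ite_mul, one_mul, zero_mul, Finset.sum_ite_eq, Finset.mem_univ,
    if_true]
  exact (frame_isHermitian.inv).apply p q

variable {N : ℕ}

/-- The correlation formula holds for every unbiased family, in particular for `blue` against
itself. -/
theorem mseMatrix_blue (hM : M.IsPOVM) (hρ : IsState ρ) (hpos : ∀ x, 0 < M.prob ρ x)
    (hrec : M.IsReconstruction (M.blue ρ)) (hsq : M.SquareIntegrable (M.blue ρ) ρ)
    (hint : ∀ p q, Integrable (fun x => outer (M.blue ρ x) (M.effect x) p q) M.ref)
    (hN : 1 ≤ N) : M.mseMatrix N (M.blue ρ) ρ = M.optMSEMatrix ρ := by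
  have := isProbabilityMeasure_outcomeLaw hM hρ
  ext p q
  rw [mseMatrix_apply hN hsq (integral_reconstruction hM hρ.1 hrec hint),
    integral_mul_star_blue hM hρ.1 hpos hrec hint]
  rfl

/-- Gauss–Markov: of the four terms in the second moment of `Θ - blue`, three equal `± 𝓕(ρ)⁻¹`, so
the difference of the two MSE matrices is itself a second-moment matrix. -/
theorem mseMatrix_sub_posSemidef (hM : M.IsPOVM) (hρ : IsState ρ) (hpos : ∀ x, 0 < M.prob ρ x)
    (hrec : M.IsReconstruction (M.blue ρ)) (hsq : M.SquareIntegrable (M.blue ρ) ρ)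
    (hint : ∀ p q, Integrable (fun x => outer (M.blue ρ x) (M.effect x) p q) M.ref)
    (hrec' : M.IsReconstruction Θ) (hsq' : M.SquareIntegrable Θ ρ)
    (hint' : ∀ p q, Integrable (fun x => outer (Θ x) (M.effect x) p q) M.ref)
    (hN : 1 ≤ N) : (M.mseMatrix N Θ ρ - M.optMSEMatrix ρ).PosSemidef := by
  have := isProbabilityMeasure_outcomeLaw hM hρ
  have h := posSemidef_of_integral (ι := Fin d × Fin d) (ν := M.outcomeLaw ρ)
    (v := fun p x => Θ x p.1 p.2 - M.blue ρ x p.1 p.2) fun p =>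
      (hsq' p.1 p.2).sub (hsq p.1 p.2)
  convert h using 1
  ext p q
  have hB : ∫ x, M.blue ρ x p.1 p.2 * star (Θ x q.1 q.2) ∂M.outcomeLaw ρ = (M.frame ρ)⁻¹ p q := by
    have h1 := integral_mul_star_blue hM hρ.1 hpos hrec' hint' q p
    rw [← (frame_isHermitian (M := M) (ρ := ρ)).inv.apply p q, ← h1]
    refine Eq.trans ?_ (integral_conj (f := fun x => Θ x q.1 q.2 * star (M.blue ρ x p.1 p.2)))
    refine integral_congr_ae (Eventually.of_forall fun x => ?_)
    simp [mul_comm]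
  rw [Matrix.sub_apply, mseMatrix_apply hN hsq' (integral_reconstruction hM hρ.1 hrec' hint'),
    optMSEMatrix, Matrix.sub_apply, sub_sub_sub_cancel_right, Matrix.of_apply]
  have e : ∀ x, (Θ x p.1 p.2 - M.blue ρ x p.1 p.2) * star (Θ x q.1 q.2 - M.blue ρ x q.1 q.2) =
      Θ x p.1 p.2 * star (Θ x q.1 q.2) - Θ x p.1 p.2 * star (M.blue ρ x q.1 q.2) -
      M.blue ρ x p.1 p.2 * star (Θ x q.1 q.2) + M.blue ρ x p.1 p.2 * star (M.blue ρ x q.1 q.2) :=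
    fun x => by rw [star_sub]; ring
  simp_rw [e]
  have i1 := integrable_mul_star (hsq' p.1 p.2) (hsq' q.1 q.2)
  have i2 := integrable_mul_star (hsq' p.1 p.2) (hsq q.1 q.2)
  have i3 := integrable_mul_star (hsq p.1 p.2) (hsq' q.1 q.2)
  have i4 := integrable_mul_star (hsq p.1 p.2) (hsq q.1 q.2)
  rw [integral_add ?_ i4, integral_sub ?_ i3, integral_sub i1 i2, hB,
    integral_mul_star_blue hM hρ.1 hpos hrec' hint', integral_mul_star_blue hM hρ.1 hpos hrec hint]
  · ring
  · exact i1.sub i2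
  · exact (i1.sub i2).sub i3

end Measurement

/-! ### The covariant measurement at full-rank states -/

section Covariant

variable {d : ℕ}

/-- The expectation value `⟨ψ|A|ψ⟩`. -/
def expVal (A : Op d) (ψ : EuclideanSpace ℂ (Fin d)) : ℂ :=
  star (ψ : Fin d → ℂ) ⬝ᵥ A *ᵥ (ψ : Fin d → ℂ)

theorem hsInner_ketbra_self (A : Op d) (ψ : EuclideanSpace ℂ (Fin d)) :
    hsInner (ketbra ψ ψ) A = expVal A ψ := by
  simp only [hsInner, expVal, ketbra, Matrix.of_apply, Fintype.sum_prod_type, dotProduct, mulVec,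
    Finset.mul_sum, Pi.star_apply, star_mul', star_star]
  exact Finset.sum_congr rfl fun i _ => Finset.sum_congr rfl fun j _ => by ring

theorem hsInner_conj (A B : Op d) : star (hsInner A B) = hsInner B A := by
  simp only [hsInner, star_sum, star_mul', star_star]
  exact Finset.sum_congr rfl fun q _ => mul_comm _ _

theorem continuous_expVal (A : Op d) : Continuous (expVal A) := by
  unfold expVal dotProduct mulVec dotProduct
  simp only [Pi.star_apply]
  fun_prop

theorem continuous_expVal_unitVec (A : Op d) : Continuous fun ψ : UnitVec d => expVal A ψ.1 :=
  (continuous_expVal A).comp continuous_subtype_val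

theorem covariant_prob (σ : Op d) (ψ : UnitVec d) :
    (covariant d).prob σ ψ = (expVal σ ψ.1).re := by
  change ((ketbra ψ.1 ψ.1 * σ).trace).re = _
  rw [← hsInner_ketbra_self, hsInner_eq_trace]
  have : (ketbra ψ.1 ψ.1)ᴴ = ketbra ψ.1 ψ.1 := ((covariant_isPOVM d).posSemidef ψ).isHermitian
  rw [this]

theorem UnitVec.coe_ne_zero (ψ : UnitVec d) : (ψ.1 : Fin d → ℂ) ≠ 0 := by
  intro h
  have h2 : ψ.1 = 0 := by ext i; exact congrFun h i
  have := UnitVec.norm_val ψ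
  rw [h2, norm_zero] at this
  exact zero_ne_one this

theorem covariant_prob_pos {σ : Op d} (hσ : σ.PosDef) (ψ : UnitVec d) :
    0 < (covariant d).prob σ ψ := by
  rw [covariant_prob]
  exact (Complex.lt_def.1 (hσ.dotProduct_mulVec_pos (UnitVec.coe_ne_zero ψ))).1

theorem continuous_covariant_prob (σ : Op d) : Continuous ((covariant d).prob σ) := by
  have : (covariant d).prob σ = fun ψ => (expVal σ ψ.1).re := funext (covariant_prob σ)
  rw [this]
  exact Complex.continuous_re.comp (continuous_expVal_unitVec σ)

theorem continuous_covariant_prob_inv {σ : Op d} (hσ : σ.PosDef) :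
    Continuous fun ψ => ((covariant d).prob σ ψ)⁻¹ :=
  (continuous_covariant_prob σ).inv₀ fun ψ => (covariant_prob_pos hσ ψ).ne'

instance isFiniteMeasure_covariant_ref : IsFiniteMeasure (covariant d).ref :=
  Measure.smul_finite _ (ENNReal.natCast_ne_top d)

theorem integrable_covariant {F : Type*} [NormedAddCommGroup F] {f : UnitVec d → F}
    (hf : Continuous f) : Integrable f (covariant d).ref :=
  (integrable_haarVec hf).smul_measure (ENNReal.natCast_ne_top d)

theorem continuous_covariant_effect (i j : Fin d) :
    Continuous fun ψ => (covariant d).effect ψ i j := continuous_coord_mul_star i j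

theorem continuous_covariant_outer (p q : Fin d × Fin d) :
    Continuous fun ψ => outer ((covariant d).effect ψ) ((covariant d).effect ψ) p q :=
  (continuous_covariant_effect p.1 p.2).mul (continuous_covariant_effect q.1 q.2).star

theorem continuous_covariant_frame_integrand {σ : Op d} (hσ : σ.PosDef) (p q : Fin d × Fin d) :
    Continuous fun ψ => (((covariant d).prob σ ψ)⁻¹ : ℂ) *
      outer ((covariant d).effect ψ) ((covariant d).effect ψ) p q := by
  refine Continuous.mul ?_ (continuous_covariant_outer p q)
  have := Complex.continuous_ofReal.comp (continuous_covariant_prob_inv hσ)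
  refine this.congr fun ψ => ?_
  simp

/-- The quadratic form of the frame superoperator. -/
def frameForm (σ A : Op d) : ℝ :=
  ∫ ψ : UnitVec d, ((covariant d).prob σ ψ)⁻¹ * ‖expVal A ψ.1‖ ^ 2 ∂(covariant d).ref

theorem hsInner_frame_app {σ : Op d} (hσ : σ.PosDef) (A B : Op d) :
    hsInner A (((covariant d).frame σ).app B) =
      ∫ ψ : UnitVec d, (((covariant d).prob σ ψ)⁻¹ : ℂ) *
        (star (expVal A ψ.1) * expVal B ψ.1) ∂(covariant d).ref := by
  have e : ∀ ψ : UnitVec d, (((covariant d).prob σ ψ)⁻¹ : ℂ) *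
      (star (expVal A ψ.1) * expVal B ψ.1) = ∑ p : Fin d × Fin d, ∑ q : Fin d × Fin d,
        (star (A p.1 p.2) * B q.1 q.2) * ((((covariant d).prob σ ψ)⁻¹ : ℂ) *
          outer ((covariant d).effect ψ) ((covariant d).effect ψ) p q) := fun ψ => by
    rw [← hsInner_ketbra_self, ← hsInner_ketbra_self, hsInner_conj, hsInner, hsInner,
      Finset.sum_mul_sum, Finset.mul_sum]
    refine Finset.sum_congr rfl fun p _ => ?_
    rw [Finset.mul_sum]
    refine Finset.sum_congr rfl fun q _ => ?_
    simp only [outer, Matrix.of_apply, covariant]; ring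
  have hi : ∀ p q : Fin d × Fin d, Integrable (fun ψ => (star (A p.1 p.2) * B q.1 q.2) *
      ((((covariant d).prob σ ψ)⁻¹ : ℂ) *
        outer ((covariant d).effect ψ) ((covariant d).effect ψ) p q)) (covariant d).ref :=
    fun p q => (integrable_covariant (continuous_covariant_frame_integrand hσ p q)).const_mul _
  simp_rw [e]
  rw [integral_finsetSum _ fun p _ => integrable_finsetSum _ fun q _ => hi p q, hsInner]
  refine Finset.sum_congr rfl fun p _ => ?_
  rw [integral_finsetSum _ fun q _ => hi p q]
  simp only [SuperOp.app, Matrix.of_apply, Finset.mul_sum]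
  refine Finset.sum_congr rfl fun q _ => ?_
  rw [integral_const_mul]
  simp only [Measurement.frame, Matrix.of_apply]; ring

theorem hsInner_frame_app_self {σ : Op d} (hσ : σ.PosDef) (A : Op d) :
    hsInner A (((covariant d).frame σ).app A) = (frameForm σ A : ℂ) := by
  rw [hsInner_frame_app hσ, frameForm, ← integral_complex_ofReal]
  refine integral_congr_ae (Eventually.of_forall fun ψ => ?_)
  simp only
  rw [Complex.ofReal_mul, Complex.ofReal_inv, Complex.star_def,
    ← Complex.normSq_eq_conj_mul_self, Complex.normSq_eq_norm_sq]

theorem continuous_frameForm_integrand {σ : Op d} (hσ : σ.PosDef) (A : Op d) :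
    Continuous fun ψ : UnitVec d => ((covariant d).prob σ ψ)⁻¹ * ‖expVal A ψ.1‖ ^ 2 :=
  (continuous_covariant_prob_inv hσ).mul ((continuous_expVal_unitVec A).norm.pow 2)

theorem frameForm_nonneg {σ : Op d} (hσ : σ.PosDef) (A : Op d) : 0 ≤ frameForm σ A :=
  integral_nonneg fun ψ => mul_nonneg (inv_nonneg.2 (covariant_prob_pos hσ ψ).le) (by positivity)

theorem expVal_smul_vec (A : Op d) (c : ℂ) (ψ : EuclideanSpace ℂ (Fin d)) :
    expVal A (c • ψ) = star c * c * expVal A ψ := by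
  have h : ((c • ψ : EuclideanSpace ℂ (Fin d)) : Fin d → ℂ) = c • (ψ : Fin d → ℂ) := rfl
  rw [expVal, h, star_smul, mulVec_smul, smul_dotProduct, dotProduct_smul, smul_eq_mul, smul_eq_mul,
    expVal]
  ring

theorem expVal_eq_inner (A : Op d) (ψ : EuclideanSpace ℂ (Fin d)) :
    expVal A ψ = inner ℂ ψ (Matrix.toEuclideanLin A ψ) := by
  rw [EuclideanSpace.inner_eq_star_dotProduct, expVal, dotProduct_comm]
  rfl

/-- An operator is determined by its expectation values. -/
theorem eq_zero_of_expVal {A : Op d} (h : ∀ ψ, expVal A ψ = 0) : A = 0 := by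
  have h1 : Matrix.toEuclideanLin A = 0 := by
    rw [← inner_map_self_eq_zero]
    intro x
    rw [← inner_conj_symm, ← expVal_eq_inner, h, map_zero]
  simpa using h1

theorem eq_zero_of_expVal_unitVec {A : Op d} (h : ∀ ψ : UnitVec d, expVal A ψ.1 = 0) : A = 0 := by
  refine eq_zero_of_expVal fun ψ => ?_
  by_cases hψ : ψ = 0
  · subst hψ; simp [expVal]
  · have hn : (‖ψ‖ : ℂ) ≠ 0 := by exact_mod_cast norm_ne_zero_iff.2 hψ
    have h2 := h ⟨(‖ψ‖ : ℂ)⁻¹ • ψ, by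
      rw [mem_sphere_zero_iff_norm, norm_smul, norm_inv, Complex.norm_real, norm_norm,
        inv_mul_cancel₀ (norm_ne_zero_iff.2 hψ)]⟩
    rw [expVal_smul_vec] at h2
    refine (mul_eq_zero.1 h2).resolve_left ?_
    simp [hψ]

theorem covariant_ref_isOpenPos (hd : d ≠ 0) : (covariant d).ref.IsOpenPosMeasure := by
  refine ⟨fun U hU hne => ?_⟩
  rw [covariant, Measure.smul_apply, smul_eq_mul]
  exact mul_ne_zero (by exact_mod_cast hd) (hU.measure_ne_zero _ hne)

/-- Expectation values in unit vectors determine an operator, so the continuous nonnegative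
integrand is positive somewhere, hence on an open set, which the measure charges. -/
theorem frameForm_pos (hd : d ≠ 0) {σ A : Op d} (hσ : σ.PosDef) (hA : A ≠ 0) :
    0 < frameForm σ A := by
  have := covariant_ref_isOpenPos hd
  obtain ⟨ψ, hψ⟩ : ∃ ψ : UnitVec d, expVal A ψ.1 ≠ 0 := by
    by_contra! h; exact hA (eq_zero_of_expVal_unitVec h)
  refine (continuous_frameForm_integrand hσ A).integral_pos_of_hasCompactSupport_nonneg_nonzero
    (HasCompactSupport.of_compactSpace _)
    (fun ψ => mul_nonneg (inv_nonneg.2 (covariant_prob_pos hσ ψ).le) (by positivity)) (x := ψ) ?_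
  exact mul_ne_zero (inv_ne_zero (covariant_prob_pos hσ ψ).ne')
    (pow_ne_zero 2 (norm_ne_zero_iff.2 hψ))

theorem star_dotProduct_mulVec (S : SuperOp d) (z w : Fin d × Fin d → ℂ) :
    star z ⬝ᵥ S *ᵥ w =
      hsInner (Matrix.of fun i j => z (i, j)) (S.app (Matrix.of fun i j => w (i, j))) := rfl

theorem covariant_frame_posDef (hd : d ≠ 0) {σ : Op d} (hσ : σ.PosDef) :
    ((covariant d).frame σ).PosDef := by
  refine PosDef.of_dotProduct_mulVec_pos Measurement.frame_isHermitian fun z hz => ?_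
  rw [star_dotProduct_mulVec, hsInner_frame_app_self hσ]
  have : (Matrix.of fun i j => z (i, j) : Op d) ≠ 0 := fun h => hz (by
    ext p; exact congrFun (congrFun h p.1) p.2)
  exact_mod_cast frameForm_pos hd hσ this

theorem continuous_covariant_blue {σ : Op d} (hσ : σ.PosDef) (i j : Fin d) :
    Continuous fun ψ => (covariant d).blue σ ψ i j := by
  have h : ∀ ψ, (covariant d).blue σ ψ i j = ((((covariant d).prob σ ψ)⁻¹ : ℝ) : ℂ) *
      ∑ q, ((covariant d).frame σ)⁻¹ (i, j) q * (covariant d).effect ψ q.1 q.2 := fun ψ => by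
    rw [Complex.ofReal_inv]; rfl
  simp_rw [h]
  refine (Complex.continuous_ofReal.comp (continuous_covariant_prob_inv hσ)).mul ?_
  exact continuous_finsetSum _ fun q _ =>
    continuous_const.mul (continuous_covariant_effect q.1 q.2)

theorem memLp_of_continuous {ν : Measure (UnitVec d)} [IsFiniteMeasure ν] {f : UnitVec d → ℂ}
    (hf : Continuous f) (p : ENNReal) : MemLp f p ν :=
  hf.memLp_of_hasCompactSupport (HasCompactSupport.of_compactSpace _)

/-- Square-integrability at a full-rank state does not depend on the state. -/
theorem memLp_ref_of_outcomeLaw {σ : Op d} (hσ : σ.PosDef) {f : UnitVec d → ℂ}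
    (hf : MemLp f 2 ((covariant d).outcomeLaw σ)) : MemLp f 2 (covariant d).ref := by
  -- On the compact sphere `1/p` is bounded, so the reference measure is dominated by a multiple of
  -- the outcome law.
  obtain ⟨C, hC⟩ : ∃ C : ℝ, ∀ ψ, ((covariant d).prob σ ψ)⁻¹ ≤ C := by
    obtain ⟨C, hC⟩ := (isCompact_range (continuous_covariant_prob_inv hσ)).bddAbove
    exact ⟨C, fun ψ => hC ⟨ψ, rfl⟩⟩
  refine hf.of_measure_le_smul (c := ENNReal.ofReal C) ENNReal.ofReal_ne_top ?_
  have hm : Measurable fun ψ => ENNReal.ofReal ((covariant d).prob σ ψ) :=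
    (continuous_covariant_prob σ).measurable.ennreal_ofReal
  rw [Measurement.outcomeLaw, ← withDensity_smul _ hm]
  conv_lhs => rw [← withDensity_one (μ := (covariant d).ref)]
  refine withDensity_mono (Eventually.of_forall fun ψ => ?_)
  have hp := covariant_prob_pos hσ ψ
  simp only [Pi.one_apply, Pi.smul_apply, smul_eq_mul]
  rw [← ENNReal.ofReal_mul ((inv_pos.2 hp).le.trans (hC ψ)), ← ENNReal.ofReal_one]
  refine ENNReal.ofReal_le_ofReal ?_
  calc (1 : ℝ) = ((covariant d).prob σ ψ)⁻¹ * (covariant d).prob σ ψ := (inv_mul_cancel₀ hp.ne').symm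
    _ ≤ _ := mul_le_mul_of_nonneg_right (hC ψ) hp.le

theorem isState_of_fullRank {ρ : Op d} (hρ : ρ ∈ fullRankStates d) : IsState ρ :=
  ⟨hρ.1.posSemidef, hρ.2⟩

/-- This guarantees that the integrals in `IsReconstruction` converge, so that square integrability
is the only analytic condition on competing families. -/
theorem covariant_integrable_outer {σ : Op d} (hσ : σ.PosDef) {Θ : UnitVec d → Op d}
    (hΘ : (covariant d).SquareIntegrable Θ σ) (p q : Fin d × Fin d) :
    Integrable (fun ψ => outer (Θ ψ) ((covariant d).effect ψ) p q) (covariant d).ref :=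
  integrable_mul_star (memLp_ref_of_outcomeLaw hσ (hΘ p.1 p.2))
    (memLp_of_continuous (continuous_covariant_effect q.1 q.2) 2)

theorem covariant_squareIntegrable_blue {ρ : Op d} (hρ : ρ ∈ fullRankStates d) :
    (covariant d).SquareIntegrable ((covariant d).blue ρ) ρ := fun i j => by
  have := Measurement.isProbabilityMeasure_outcomeLaw (covariant_isPOVM d) (isState_of_fullRank hρ)
  exact memLp_of_continuous (continuous_covariant_blue hρ.1 i j) 2

theorem covariant_isReconstruction_blue (hd : d ≠ 0) {ρ : Op d} (hρ : ρ ∈ fullRankStates d) :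
    (covariant d).IsReconstruction ((covariant d).blue ρ) :=
  Measurement.blue_isReconstruction (covariant_frame_posDef hd hρ.1).isUnit
    fun p q => integrable_covariant (continuous_covariant_frame_integrand hρ.1 p q)

theorem covariant_mseMatrix_blue (hd : d ≠ 0) {ρ : Op d} (hρ : ρ ∈ fullRankStates d) {N : ℕ}
    (hN : 1 ≤ N) :
    (covariant d).mseMatrix N ((covariant d).blue ρ) ρ = (covariant d).optMSEMatrix ρ :=
  Measurement.mseMatrix_blue (covariant_isPOVM d) (isState_of_fullRank hρ)
    (covariant_prob_pos hρ.1) (covariant_isReconstruction_blue hd hρ)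
    (covariant_squareIntegrable_blue hρ)
    (covariant_integrable_outer hρ.1 (covariant_squareIntegrable_blue hρ)) hN

theorem covariant_mseMatrix_optimal (hd : d ≠ 0) {ρ : Op d} (hρ : ρ ∈ fullRankStates d) {N : ℕ}
    (hN : 1 ≤ N) {Θ : UnitVec d → Op d} (hrec : (covariant d).IsReconstruction Θ)
    (hsq : (covariant d).SquareIntegrable Θ ρ) :
    ((covariant d).mseMatrix N Θ ρ - (covariant d).optMSEMatrix ρ).PosSemidef :=
  Measurement.mseMatrix_sub_posSemidef (covariant_isPOVM d) (isState_of_fullRank hρ)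
    (covariant_prob_pos hρ.1) (covariant_isReconstruction_blue hd hρ)
    (covariant_squareIntegrable_blue hρ)
    (covariant_integrable_outer hρ.1 (covariant_squareIntegrable_blue hρ)) hrec hsq
    (covariant_integrable_outer hρ.1 hsq) hN

theorem covariant_scaledMSE_blue (hd : d ≠ 0) {ρ : Op d} (hρ : ρ ∈ fullRankStates d) {N : ℕ}
    (hN : 1 ≤ N) :
    (covariant d).scaledMSE N ((covariant d).blue ρ) ρ =
      ((covariant d).optMSEMatrix ρ).trace.re := by
  have := Measurement.isProbabilityMeasure_outcomeLaw (covariant_isPOVM d) (isState_of_fullRank hρ)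
  rw [Measurement.scaledMSE_eq_trace hN (covariant_squareIntegrable_blue hρ),
    covariant_mseMatrix_blue hd hρ hN]

end Covariant

/-! ### Bounds on the inverse of the frame superoperator -/

section Bounds

variable {d : ℕ}

theorem hsInner_sub_left (A B C : Op d) : hsInner (A - B) C = hsInner A C - hsInner B C := by
  simp only [hsInner, Matrix.sub_apply, star_sub, sub_mul, Finset.sum_sub_distrib]

theorem hsInner_sub_right (A B C : Op d) : hsInner A (B - C) = hsInner A B - hsInner A C := by
  simp only [hsInner, Matrix.sub_apply, mul_sub, Finset.sum_sub_distrib]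

theorem SuperOp.app_sub (S : SuperOp d) (A B : Op d) : S.app (A - B) = S.app A - S.app B := by
  ext i j
  simp only [SuperOp.app, Matrix.of_apply, Matrix.sub_apply, mul_sub, Finset.sum_sub_distrib]

theorem SuperOp.app_add (S : SuperOp d) (A B : Op d) : S.app (A + B) = S.app A + S.app B := by
  ext i j
  simp only [SuperOp.app, Matrix.of_apply, Matrix.add_apply, mul_add, Finset.sum_add_distrib]

theorem SuperOp.app_mul (S T : SuperOp d) (A : Op d) : SuperOp.app (S * T) A = S.app (T.app A) := by
  ext i j
  simp only [SuperOp.app, Matrix.of_apply, Matrix.mul_apply, Finset.mul_sum, Finset.sum_mul]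
  rw [Finset.sum_comm]
  exact Finset.sum_congr rfl fun p _ => Finset.sum_congr rfl fun q _ => by ring

theorem SuperOp.app_one (A : Op d) : SuperOp.app (1 : SuperOp d) A = A := by
  ext i j
  simp [SuperOp.app, Matrix.one_apply]

theorem hsInner_app_comm {S : SuperOp d} (hS : S.IsHermitian) (A B : Op d) :
    hsInner A (S.app B) = hsInner (S.app A) B := by
  simp only [hsInner, SuperOp.app, Matrix.of_apply, Finset.mul_sum, star_sum, Finset.sum_mul]
  rw [Finset.sum_comm]
  refine Finset.sum_congr rfl fun p _ => Finset.sum_congr rfl fun q _ => ?_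
  rw [star_mul', show star (S (p.1, p.2) q) = S q p from hS.apply q p]
  ring

/-- The variational characterization of the inverse frame superoperator. -/
theorem two_mul_re_sub_frameForm_le (hd : d ≠ 0) {σ : Op d} (hσ : σ.PosDef) (A B : Op d) :
    2 * (hsInner A B).re - frameForm σ B ≤ (hsInner A (((covariant d).frame σ)⁻¹.app A)).re := by
  have hF := covariant_frame_posDef hd hσ
  set F := (covariant d).frame σ with hFdef
  set Z := F⁻¹.app A with hZ
  have hFZ : F.app Z = A := by
    rw [hZ, ← SuperOp.app_mul, Matrix.mul_nonsing_inv _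
      ((Matrix.isUnit_iff_isUnit_det _).1 hF.isUnit), SuperOp.app_one]
  -- Positivity of the form at `Z - B`, where `Z = 𝓕⁻¹ A`, is the claim once the square is expanded.
  have h0 := frameForm_nonneg hσ (Z - B)
  have h1 := hsInner_frame_app_self hσ (Z - B)
  have h2 := hsInner_frame_app_self hσ B
  rw [← hFdef] at h1 h2
  rw [SuperOp.app_sub, hFZ, hsInner_sub_right, hsInner_sub_left, hsInner_sub_left, h2,
    hsInner_app_comm hF.isHermitian, hFZ] at h1
  have h3 := congrArg Complex.re h1
  simp only [Complex.sub_re, Complex.ofReal_re] at h3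
  have h4 : (hsInner Z A).re = (hsInner A Z).re := by rw [← hsInner_conj]; simp
  have h5 : (hsInner B A).re = (hsInner A B).re := by rw [← hsInner_conj]; simp
  linarith

theorem frameForm_inv (hd : d ≠ 0) {σ : Op d} (hσ : σ.PosDef) (A : Op d) :
    frameForm σ (((covariant d).frame σ)⁻¹.app A) =
      (hsInner A (((covariant d).frame σ)⁻¹.app A)).re := by
  have hF := covariant_frame_posDef hd hσ
  have h := hsInner_frame_app_self hσ (((covariant d).frame σ)⁻¹.app A)
  rw [← SuperOp.app_mul, Matrix.mul_nonsing_inv _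
      ((Matrix.isUnit_iff_isUnit_det _).1 hF.isUnit), SuperOp.app_one] at h
  have h2 := congrArg Complex.re h
  rw [Complex.ofReal_re] at h2
  rw [← h2, ← hsInner_conj]
  simp

/-- Cauchy–Schwarz for the semi-inner product `⟨·|σ|·⟩` applied to the vectors `ψ` and `A ψ`. -/
theorem norm_expVal_mul_sq_le {σ : Op d} (hσ : σ.PosSemidef) (A : Op d)
    (ψ : EuclideanSpace ℂ (Fin d)) :
    ‖expVal (σ * A) ψ‖ ^ 2 ≤ (expVal σ ψ).re * (expVal (Aᴴ * σ * A) ψ).re := by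
  obtain ⟨C, rfl⟩ := exists_eq_conjTranspose_mul_self hσ
  have key : ∀ B D : Op d, expVal (Bᴴ * D) ψ =
      inner ℂ (Matrix.toEuclideanLin B ψ) (Matrix.toEuclideanLin D ψ) := fun B D => by
    rw [EuclideanSpace.inner_eq_star_dotProduct, expVal, ← Matrix.mulVec_mulVec,
      dotProduct_mulVec, ← star_mulVec]
    exact dotProduct_comm _ _
  rw [show Aᴴ * (Cᴴ * C) * A = (C * A)ᴴ * (C * A) by
    rw [Matrix.conjTranspose_mul]; simp only [Matrix.mul_assoc], Matrix.mul_assoc, key, key, key]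
  have h1 := norm_inner_le_norm (𝕜 := ℂ) (Matrix.toEuclideanLin C ψ)
    (Matrix.toEuclideanLin (C * A) ψ)
  have h2 : ∀ v : EuclideanSpace ℂ (Fin d), (inner ℂ v v : ℂ).re = ‖v‖ ^ 2 := fun v =>
    (norm_sq_eq_re_inner (𝕜 := ℂ) v).symm
  rw [h2, h2, ← mul_pow]
  exact pow_le_pow_left₀ (norm_nonneg _) h1 2

theorem integral_covariant_expVal (A : Op d) :
    ∫ ψ : UnitVec d, (expVal A ψ.1).re ∂(covariant d).ref = A.trace.re := by
  have h := Measurement.integral_hsInner (covariant_isPOVM d) A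
  rw [← h]
  simp_rw [show ∀ ψ, hsInner ((covariant d).effect ψ) A = expVal A ψ.1 from
    fun ψ => hsInner_ketbra_self A ψ.1]
  exact integral_re (integrable_covariant (continuous_expVal_unitVec A))

/-- Cauchy–Schwarz cancels the denominator `⟨ψ|σ|ψ⟩`; the remaining integral of an expectation value
is a trace because the measurement is a POVM. Used as a trial operator in the variational formula,
`σ * A` then bounds the inverse frame from below. -/
theorem frameForm_mul_le {σ : Op d} (hσ : σ.PosDef) (A : Op d) :
    frameForm σ (σ * A) ≤ (hsInner A (σ * A)).re := by
  rw [hsInner_eq_trace, ← Matrix.mul_assoc, ← integral_covariant_expVal, frameForm]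
  refine integral_mono (integrable_covariant (continuous_frameForm_integrand hσ _))
    (integrable_covariant (Complex.continuous_re.comp (continuous_expVal_unitVec _))) fun ψ => ?_
  have hp := covariant_prob_pos hσ ψ
  change ((covariant d).prob σ ψ)⁻¹ * _ ≤ _
  rw [inv_mul_le_iff₀ hp, covariant_prob]
  exact norm_expVal_mul_sq_le hσ.posSemidef A ψ.1

theorem expVal_conjTranspose (A : Op d) (ψ : EuclideanSpace ℂ (Fin d)) :
    expVal Aᴴ ψ = star (expVal A ψ) := by
  rw [expVal, expVal, star_dotProduct, star_mulVec, ← dotProduct_mulVec, conjTranspose_conjTranspose]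

theorem frameForm_conjTranspose (σ A : Op d) : frameForm σ Aᴴ = frameForm σ A := by
  simp only [frameForm, expVal_conjTranspose, norm_star]

theorem frameForm_mul_right_le {σ : Op d} (hσ : σ.PosDef) (A : Op d) :
    frameForm σ (A * σ) ≤ (hsInner A (A * σ)).re := by
  have h := frameForm_mul_le hσ Aᴴ
  rw [← frameForm_conjTranspose, Matrix.conjTranspose_mul, hσ.isHermitian.eq]
  refine h.trans (le_of_eq ?_)
  rw [hsInner_eq_trace, hsInner_eq_trace, Matrix.conjTranspose_conjTranspose, ← Matrix.mul_assoc,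
    Matrix.trace_mul_comm, ← Matrix.mul_assoc]

/-- The inverse frame superoperator dominates left multiplication by the state. -/
theorem re_hsInner_mul_le (hd : d ≠ 0) {σ : Op d} (hσ : σ.PosDef) (A : Op d) :
    (hsInner A (σ * A)).re ≤ (hsInner A (((covariant d).frame σ)⁻¹.app A)).re := by
  have h1 := two_mul_re_sub_frameForm_le hd hσ A (σ * A)
  have h2 := frameForm_mul_le hσ A
  linarith

/-- The inverse frame superoperator dominates right multiplication by the state. -/
theorem re_hsInner_mul_right_le (hd : d ≠ 0) {σ : Op d} (hσ : σ.PosDef) (A : Op d) :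
    (hsInner A (A * σ)).re ≤ (hsInner A (((covariant d).frame σ)⁻¹.app A)).re := by
  have h1 := two_mul_re_sub_frameForm_le hd hσ A (A * σ)
  have h2 := frameForm_mul_right_le hσ A
  linarith

theorem frameForm_anti {σ τ : Op d} (hσ : σ.PosDef) (hτ : τ.PosDef)
    (h : ∀ ψ, (covariant d).prob σ ψ ≤ (covariant d).prob τ ψ) (A : Op d) :
    frameForm τ A ≤ frameForm σ A := by
  refine integral_mono (integrable_covariant (continuous_frameForm_integrand hτ A))
    (integrable_covariant (continuous_frameForm_integrand hσ A)) fun ψ => ?_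
  exact mul_le_mul_of_nonneg_right (inv_anti₀ (covariant_prob_pos hσ ψ) (h ψ)) (by positivity)

/-- Larger probabilities give a smaller frame and so a larger inverse; the variational formula for
`τ` is tested on the optimizer for `σ`. -/
theorem re_hsInner_inv_mono (hd : d ≠ 0) {σ τ : Op d} (hσ : σ.PosDef) (hτ : τ.PosDef)
    (h : ∀ ψ, (covariant d).prob σ ψ ≤ (covariant d).prob τ ψ) (A : Op d) :
    (hsInner A (((covariant d).frame σ)⁻¹.app A)).re ≤
      (hsInner A (((covariant d).frame τ)⁻¹.app A)).re := by
  have h1 := frameForm_inv hd hσ A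
  have h2 := two_mul_re_sub_frameForm_le hd hτ A (((covariant d).frame σ)⁻¹.app A)
  have h3 := frameForm_anti hσ hτ h (((covariant d).frame σ)⁻¹.app A)
  linarith

/-- With `A = Cᴴ C` the entry is an inner product of two columns of `C`, and the trace bounds the
squared norm of each column. -/
theorem norm_apply_le_trace {n : Type*} [Fintype n] [DecidableEq n] {A : Matrix n n ℂ}
    (hA : A.PosSemidef) (p q : n) : ‖A p q‖ ≤ A.trace.re := by
  obtain ⟨C, rfl⟩ := exists_eq_conjTranspose_mul_self hA
  have htr : (Cᴴ * C).trace.re = ∑ j, ∑ i, ‖C i j‖ ^ 2 := by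
    rw [Matrix.trace, Complex.re_sum]
    refine Finset.sum_congr rfl fun j _ => ?_
    rw [Matrix.diag_apply, Matrix.mul_apply, Complex.re_sum]
    refine Finset.sum_congr rfl fun i _ => ?_
    rw [Matrix.conjTranspose_apply, Complex.star_def, ← Complex.normSq_eq_conj_mul_self,
      Complex.ofReal_re, Complex.normSq_eq_norm_sq]
  have hcol : ∀ j, ∑ i, ‖C i j‖ ^ 2 ≤ (Cᴴ * C).trace.re := fun j => by
    rw [htr]
    exact Finset.single_le_sum (f := fun j => ∑ i, ‖C i j‖ ^ 2)
      (fun j _ => Finset.sum_nonneg fun i _ => by positivity) (Finset.mem_univ j)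
  have h1 : ‖(Cᴴ * C) p q‖ ≤ ∑ i, (‖C i p‖ ^ 2 + ‖C i q‖ ^ 2) / 2 := by
    rw [Matrix.mul_apply]
    refine (norm_sum_le _ _).trans (Finset.sum_le_sum fun i _ => ?_)
    rw [norm_mul, Matrix.conjTranspose_apply, norm_star]
    nlinarith [sq_nonneg (‖C i p‖ - ‖C i q‖)]
  rw [← Finset.sum_div, Finset.sum_add_distrib] at h1
  linarith [hcol p, hcol q]

theorem posDef_one_op : (1 : Op d).PosDef := PosDef.one

theorem expVal_one (ψ : UnitVec d) : expVal (1 : Op d) ψ.1 = 1 := by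
  rw [expVal, Matrix.one_mulVec, dotProduct_comm]
  exact UnitVec.sum_mul_star ψ

theorem covariant_prob_le_one {ρ : Op d} (hρ : IsState ρ) (ψ : UnitVec d) :
    (covariant d).prob ρ ψ ≤ 1 := by
  have h : (0 : ℂ) ≤ ((1 - ketbra ψ.1 ψ.1) * ρ).trace := by
    refine trace_mul_nonneg ?_ hρ.1
    refine PosSemidef.of_dotProduct_mulVec_nonneg ?_ fun z => ?_
    · exact isHermitian_one.sub ((covariant_isPOVM d).posSemidef ψ).isHermitian
    · set w : EuclideanSpace ℂ (Fin d) := WithLp.toLp 2 z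
      have h1 : star z ⬝ᵥ (1 - ketbra ψ.1 ψ.1) *ᵥ z =
          (((‖w‖ ^ 2 - ‖inner ℂ ψ.1 w‖ ^ 2 : ℝ)) : ℂ) := by
        have e1 : star z ⬝ᵥ z = ((‖w‖ ^ 2 : ℝ) : ℂ) := by
          have := inner_self_eq_norm_sq_to_K (𝕜 := ℂ) w
          rw [EuclideanSpace.inner_eq_star_dotProduct, dotProduct_comm] at this
          rw [this]; norm_cast
        have e2 : ketbra ψ.1 ψ.1 = vecMulVec (ψ.1 : Fin d → ℂ) (star (ψ.1 : Fin d → ℂ)) := by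
          ext i j; rfl
        have e3 : star (ψ.1 : Fin d → ℂ) ⬝ᵥ z = inner ℂ ψ.1 w := by
          rw [EuclideanSpace.inner_eq_star_dotProduct, dotProduct_comm]
        have e4 : star z ⬝ᵥ (ψ.1 : Fin d → ℂ) = star (inner ℂ ψ.1 w) := by
          rw [← e3, star_dotProduct]
        rw [Matrix.sub_mulVec, Matrix.one_mulVec, dotProduct_sub, e1, e2,
          Matrix.vecMulVec_mulVec, dotProduct_smul, e3, e4, Complex.ofReal_sub]
        congr 1
        rw [MulOpposite.smul_eq_mul_unop, MulOpposite.unop_op, Complex.star_def,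
          ← Complex.normSq_eq_conj_mul_self, Complex.normSq_eq_norm_sq]
      rw [h1]
      have h2 := norm_inner_le_norm (𝕜 := ℂ) ψ.1 w
      rw [UnitVec.norm_val, one_mul] at h2
      have h3 := pow_le_pow_left₀ (norm_nonneg _) h2 2
      exact_mod_cast sub_nonneg.2 h3
  rw [Matrix.sub_mul, Matrix.one_mul, Matrix.trace_sub, hρ.2] at h
  have h2 := (Complex.le_def.1 h).1
  rw [Complex.sub_re, Complex.zero_re, Complex.one_re] at h2
  change (ketbra ψ.1 ψ.1 * ρ).trace.re ≤ 1
  linarith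

/-- A uniform bound for the entries of the inverse frame superoperator at full-rank states. -/
theorem norm_frame_inv_le (hd : d ≠ 0) {ρ : Op d} (hρ : ρ ∈ fullRankStates d)
    (p q : Fin d × Fin d) :
    ‖((covariant d).frame ρ)⁻¹ p q‖ ≤ (((covariant d).frame (1 : Op d))⁻¹).trace.re := by
  refine (norm_apply_le_trace (covariant_frame_posDef hd hρ.1).posSemidef.inv p q).trans ?_
  rw [Matrix.trace, Matrix.trace, Complex.re_sum, Complex.re_sum]
  refine Finset.sum_le_sum fun r _ => ?_
  -- No outcome is more likely at a state than at the identity, so the inverse frame at the identity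
  -- dominates; matrix units pick out the diagonal entries.
  have h := re_hsInner_inv_mono hd hρ.1 posDef_one_op (fun ψ => by
    rw [covariant_prob (1 : Op d), expVal_one, Complex.one_re]
    exact covariant_prob_le_one (isState_of_fullRank hρ) ψ) (Matrix.single r.1 r.2 1)
  have e : ∀ S : SuperOp d, hsInner (Matrix.single r.1 r.2 1) (S.app (Matrix.single r.1 r.2 1)) =
      S r r := fun S => by
    have h1 : (Matrix.single r.1 r.2 1 : Op d) = Matrix.of fun i j => (Pi.single r 1 :
        Fin d × Fin d → ℂ) (i, j) := by
      ext i j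
      simp [Matrix.single_apply, Pi.single_apply, Prod.ext_iff, eq_comm]
    rw [h1, ← star_dotProduct_mulVec]
    simp
  rw [e, e] at h
  exact h

end Bounds

/-! ### Logarithmic divergence of the frame superoperator at pure states -/

section Divergence

variable {d : ℕ}

/-- The homogeneous extension of the Fisher information density at the pure state `|e⟩⟨e|`. -/
def infoDensity (A : Op d) (e z : EuclideanSpace ℂ (Fin d)) : ENNReal :=
  ENNReal.ofReal (‖expVal A z‖ ^ 2 / ‖inner ℂ e z‖ ^ 2)

theorem measurable_infoDensity (A : Op d) (e : EuclideanSpace ℂ (Fin d)) :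
    Measurable (infoDensity A e) := by
  refine Measurable.ennreal_ofReal (Measurable.div ?_ ?_)
  · exact ((continuous_expVal A).norm.pow 2).measurable
  · have : Continuous fun z : EuclideanSpace ℂ (Fin d) => ‖inner ℂ e z‖ ^ 2 := by fun_prop
    exact this.measurable

/-- The numerator has degree four and the denominator degree two; where the denominator vanishes,
both sides are zero by the convention for division. -/
theorem infoDensity_smul (A : Op d) (e z : EuclideanSpace ℂ (Fin d)) {r : ℝ} (hr : 0 < r) :
    infoDensity A e (r • z) = infoDensity A e z * ENNReal.ofReal (r ^ 2) := by
  rw [infoDensity, infoDensity, ← ENNReal.ofReal_mul (by positivity)]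
  congr 1
  have h : (r • z : EuclideanSpace ℂ (Fin d)) = (r : ℂ) • z := by
    ext i; simp
  rw [h, expVal_smul_vec, inner_smul_right, norm_mul, norm_mul, norm_mul, norm_star,
    Complex.norm_real, Real.norm_of_nonneg hr.le]
  by_cases h0 : ‖inner ℂ e z‖ = 0
  · simp [h0]
  · field_simp

/-- Polar coordinates: homogeneity splits the ball integral into the sphere integral and a finite
radial factor. In the ball, linear scalings can then be used to detect divergence. -/
theorem lintegral_ball_infoDensity_lt_top {A : Op d} {e : EuclideanSpace ℂ (Fin d)}
    (h : ∫⁻ ψ : UnitVec d, infoDensity A e ψ.1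
      ∂(volume : Measure (EuclideanSpace ℂ (Fin d))).toSphere ≠ ⊤) {R : ℝ} (hR : 0 < R) :
    ∫⁻ z in Metric.ball 0 R, infoDensity A e z ≠ ⊤ := by
  by_cases hd : d = 0
  · subst hd
    have : ∀ z, infoDensity A e z = 0 := fun z => by simp [infoDensity, expVal]
    simp [this]
  have : Nonempty (Fin d) := ⟨⟨0, Nat.pos_of_ne_zero hd⟩⟩
  have : Nontrivial (EuclideanSpace ℂ (Fin d)) := inferInstance
  set g : EuclideanSpace ℂ (Fin d) → ENNReal := (Metric.ball (0 : EuclideanSpace ℂ (Fin d)) R).indicator (infoDensity A e) with hg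
  set n := Module.finrank ℝ (EuclideanSpace ℂ (Fin d)) - 1
  have mp := (volume : Measure (EuclideanSpace ℂ (Fin d))).measurePreserving_homeomorphUnitSphereProd
  set k : Set.Ioi (0 : ℝ) → ENNReal :=
    (Set.Iio (⟨R, Set.mem_Ioi.2 hR⟩ : Set.Ioi (0 : ℝ))).indicator
      (fun r => ENNReal.ofReal (r.1 ^ 2)) with hk
  have e1 : ∫⁻ z in Metric.ball 0 R, infoDensity A e z =
      ∫⁻ q, infoDensity A e q.1.1 * k q.2
        ∂((volume : Measure (EuclideanSpace ℂ (Fin d))).toSphere.prod (Measure.volumeIoiPow n)) := by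
    -- The origin is negligible, and its complement is the product of the sphere and the half-line.
    have h0 : ∫⁻ z, g z = ∫⁻ z in {0}ᶜ, g z := by rw [restrict_compl_singleton]
    rw [← lintegral_indicator Metric.isOpen_ball.measurableSet, ← hg, h0,
      ← lintegral_subtype_comap (measurableSet_singleton _).compl,
      ← mp.lintegral_comp_emb (Homeomorph.measurableEmbedding _)]
    refine lintegral_congr fun x => ?_
    obtain ⟨⟨ψ, r⟩, rfl⟩ := (homeomorphUnitSphereProd (EuclideanSpace ℂ (Fin d))).symm.surjective x
    rw [Homeomorph.apply_symm_apply]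
    have hx : (((homeomorphUnitSphereProd (EuclideanSpace ℂ (Fin d))).symm (ψ, r) : ({0}ᶜ : Set (EuclideanSpace ℂ (Fin d)))) : EuclideanSpace ℂ (Fin d)) = r.1 • ψ.1 := by
      simp
    rw [hx, hg, hk]
    dsimp only
    have hn : ‖r.1 • ψ.1‖ = r.1 := by
      rw [norm_smul, UnitVec.norm_val, mul_one, Real.norm_of_nonneg (le_of_lt r.2)]
    by_cases hlt : r.1 < R
    · rw [Set.indicator_of_mem (by rw [mem_ball_zero_iff, hn]; exact hlt),
        Set.indicator_of_mem (show r ∈ Set.Iio (⟨R, Set.mem_Ioi.2 hR⟩ : Set.Ioi (0 : ℝ)) from hlt),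
        infoDensity_smul A e ψ.1 r.2]
    · rw [Set.indicator_of_notMem (by rw [mem_ball_zero_iff, hn]; exact hlt),
        Set.indicator_of_notMem (show r ∉ Set.Iio (⟨R, Set.mem_Ioi.2 hR⟩ : Set.Ioi (0 : ℝ)) from hlt), mul_zero]
  have mk : Measurable k := by
    refine Measurable.indicator ?_ measurableSet_Iio
    exact (measurable_subtype_coe.pow_const 2).ennreal_ofReal
  rw [e1, lintegral_prod_mul (f := fun ψ : UnitVec d => infoDensity A e ψ.1) (g := k)
    ((measurable_infoDensity A e).comp measurable_subtype_coe).aemeasurable mk.aemeasurable]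
  refine ENNReal.mul_ne_top h ?_
  refine ne_top_of_le_ne_top (b := ENNReal.ofReal (R ^ 2) *
    Measure.volumeIoiPow n (Set.Iio (⟨R, Set.mem_Ioi.2 hR⟩ : Set.Ioi (0 : ℝ)))) ?_ ?_
  · rw [Measure.volumeIoiPow_apply_Iio]
    exact ENNReal.mul_ne_top ENNReal.ofReal_ne_top ENNReal.ofReal_ne_top
  · rw [hk, lintegral_indicator measurableSet_Iio, ← setLIntegral_const]
    refine setLIntegral_mono measurable_const fun r hr => ENNReal.ofReal_le_ofReal ?_
    exact pow_le_pow_left₀ (le_of_lt r.2) (le_of_lt hr) 2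

/-- Halving the component along the basis vector `b k`. -/
def halving (b : OrthonormalBasis (Fin d) ℂ (EuclideanSpace ℂ (Fin d))) (k : Fin d) :
    EuclideanSpace ℂ (Fin d) →ₗ[ℂ] EuclideanSpace ℂ (Fin d) :=
  Matrix.toLin b.toBasis b.toBasis (Matrix.diagonal fun j => if j = k then (2 : ℂ)⁻¹ else 1)

/-- Halving one complex coordinate halves two real ones. This factor `1/4` of volume is exactly
offset by the growth of `1/|z_k|²` by `4`, the source of the logarithmic divergence. -/
theorem det_halving (b : OrthonormalBasis (Fin d) ℂ (EuclideanSpace ℂ (Fin d))) (k : Fin d) :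
    LinearMap.det ((halving b k).restrictScalars ℝ) = 1 / 4 := by
  rw [LinearMap.det_restrictScalars, halving, LinearMap.det_toLin, Matrix.det_diagonal,
    Finset.prod_ite_eq' , if_pos (Finset.mem_univ k), Algebra.norm_complex_apply]
  norm_num [Complex.normSq]

theorem repr_halving (b : OrthonormalBasis (Fin d) ℂ (EuclideanSpace ℂ (Fin d))) (k j : Fin d)
    (z : EuclideanSpace ℂ (Fin d)) :
    b.repr (halving b k z) j = (if j = k then (2 : ℂ)⁻¹ else 1) * b.repr z j := by
  have h := Matrix.repr_toLin b.toBasis b.toBasis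
    (Matrix.diagonal fun j => if j = k then (2 : ℂ)⁻¹ else 1) z
  have h2 := congrFun h j
  rw [Matrix.mulVec_diagonal] at h2
  simpa [halving] using h2

/-- Dyadic shells around the hyperplane orthogonal to `b k`, near the vector `φ`. -/
def shell (b : OrthonormalBasis (Fin d) ℂ (EuclideanSpace ℂ (Fin d))) (k : Fin d)
    (φ : EuclideanSpace ℂ (Fin d)) (r : ℝ) (n : ℕ) : Set (EuclideanSpace ℂ (Fin d)) :=
  {z | r / 2 ^ (n + 1) < ‖b.repr z k‖ ∧ ‖b.repr z k‖ < r / 2 ^ n ∧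
    ∀ j, j ≠ k → ‖b.repr z j - b.repr φ j‖ < r}

variable {b : OrthonormalBasis (Fin d) ℂ (EuclideanSpace ℂ (Fin d))} {k : Fin d}
  {φ : EuclideanSpace ℂ (Fin d)} {r : ℝ}

theorem isOpen_shell (n : ℕ) : IsOpen (shell b k φ r n) := by
  have hc : ∀ j, Continuous fun z => b.repr z j := fun j =>
    (PiLp.continuous_apply 2 _ j).comp b.repr.continuous
  have : shell b k φ r n = {z | r / 2 ^ (n + 1) < ‖b.repr z k‖} ∩ ({z | ‖b.repr z k‖ < r / 2 ^ n} ∩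
      ⋂ j, ⋂ (_ : j ≠ k), {z | ‖b.repr z j - b.repr φ j‖ < r}) := by
    ext z; simp [shell]
  rw [this]
  refine (isOpen_lt continuous_const (hc k).norm).inter
    ((isOpen_lt (hc k).norm continuous_const).inter ?_)
  refine isOpen_iInter_of_finite fun j => isOpen_iInter_of_finite fun _ => ?_
  exact isOpen_lt ((hc j).sub continuous_const).norm continuous_const

theorem volume_shell_zero_ne_zero (hr : 0 < r) : volume (shell b k φ r 0) ≠ 0 := by
  -- The witness has component `3r/4` along `b k`, between the radii `r/2` and `r`, and agrees with
  -- `φ` in the other components.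
  refine (isOpen_shell 0).measure_ne_zero _ ⟨φ + ((3 * r / 4 : ℝ) - b.repr φ k : ℂ) • b k, ?_⟩
  have h : ∀ j, b.repr (φ + ((3 * r / 4 : ℝ) - b.repr φ k : ℂ) • b k) j =
      b.repr φ j + ((3 * r / 4 : ℝ) - b.repr φ k) * (if j = k then 1 else 0) := fun j => by
    simp [map_add, map_smul, OrthonormalBasis.repr_self]
  refine ⟨?_, ?_, fun j hj => ?_⟩
  · rw [h, if_pos rfl, mul_one, add_sub_cancel, Complex.norm_real, Real.norm_of_nonneg (by positivity)]
    norm_num; linarith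
  · rw [h, if_pos rfl, mul_one, add_sub_cancel, Complex.norm_real, Real.norm_of_nonneg (by positivity)]
    norm_num; linarith
  · rw [h, if_neg hj]; simpa using hr

/-- The preimage of each shell under `halving` is the preceding shell. -/
theorem volume_shell (n : ℕ) :
    volume (shell b k φ r 0) = ENNReal.ofReal (4 ^ n) * volume (shell b k φ r n) := by
  induction n with
  | zero => simp
  | succ n ih =>
    have h := Measure.addHaar_preimage_linearMap (volume : Measure (EuclideanSpace ℂ (Fin d)))
      (f := (halving b k).restrictScalars ℝ) (by rw [det_halving]; norm_num)
      (shell b k φ r (n + 1))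
    have hpre : ((halving b k).restrictScalars ℝ : EuclideanSpace ℂ (Fin d) →
        EuclideanSpace ℂ (Fin d)) ⁻¹' (shell b k φ r (n + 1)) = shell b k φ r n := by
      ext z
      simp only [shell, Set.mem_preimage, Set.mem_ofPred_eq, LinearMap.coe_restrictScalars,
        repr_halving, if_true, norm_mul, norm_inv, Complex.norm_ofNat]
      refine and_congr ?_ (and_congr ?_ (forall_congr' fun j => imp_congr_right fun hj => ?_))
      · rw [pow_succ 2 (n + 1), ← div_div]
        constructor <;> intro h <;> linarith
      · rw [pow_succ 2 n, ← div_div]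
        constructor <;> intro h <;> linarith
      · rw [if_neg hj, one_mul]
    rw [hpre, det_halving] at h
    rw [ih, h, ← mul_assoc, ← ENNReal.ofReal_mul (by positivity)]
    congr 2
    rw [pow_succ]
    norm_num

theorem disjoint_shell (hr : 0 < r) : Pairwise (Function.onFun Disjoint (shell b k φ r)) := by
  have key : ∀ m n, m < n → Disjoint (shell b k φ r m) (shell b k φ r n) := fun m n hmn => by
    rw [Set.disjoint_left]
    rintro z ⟨h1, -, -⟩ ⟨-, h2, -⟩
    have : r / 2 ^ n ≤ r / 2 ^ (m + 1) :=
      div_le_div_of_nonneg_left hr.le (by positivity) (pow_le_pow_right₀ (by norm_num) hmn)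
    linarith
  intro m n hmn
  rcases lt_or_gt_of_ne hmn with h | h
  · exact key m n h
  · exact (key n m h).symm

/-- Integrability of the information density forces the expectation values of `A` to vanish on
the hyperplane orthogonal to `b k`. -/
theorem expVal_eq_zero_of_lintegral_ne_top {A : Op d}
    (h : ∫⁻ ψ : UnitVec d, infoDensity A (b k) ψ.1
      ∂(volume : Measure (EuclideanSpace ℂ (Fin d))).toSphere ≠ ⊤)
    (hφ : inner ℂ (b k) φ = 0) : expVal A φ = 0 := by
  by_contra hne
  set c := ‖expVal A φ‖ / 2 with hc
  have hcpos : 0 < c := by have := norm_pos_iff.2 hne; positivity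
  obtain ⟨δ, hδ, hball⟩ : ∃ δ > 0, ∀ z, ‖z - φ‖ < δ → c < ‖expVal A z‖ := by
    have hU : IsOpen {z | c < ‖expVal A z‖} := isOpen_lt continuous_const (continuous_expVal A).norm
    obtain ⟨δ, hδ, hs⟩ := Metric.isOpen_iff.1 hU φ (by
      have := norm_pos_iff.2 hne
      simp only [Set.mem_ofPred_eq, hc]; linarith)
    exact ⟨δ, hδ, fun z hz => hs (by rwa [mem_ball_iff_norm])⟩
  -- Coordinatewise deviations of at most `r` give distance at most `d * r < δ`, so every shell lies
  -- where `|⟨A⟩| > c`.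
  set r := δ / (d + 1) with hr'
  have hr : 0 < r := by positivity
  have hφk : b.repr φ k = 0 := by rw [OrthonormalBasis.repr_apply_apply, hφ]
  have hsub : ∀ n, ∀ z ∈ shell b k φ r n, ‖z - φ‖ < δ := fun n z hz => by
    have hcoord : ∀ j, ‖b.repr (z - φ) j‖ ≤ r := fun j => by
      rw [map_sub, PiLp.sub_apply]
      by_cases hj : j = k
      · subst hj
        rw [hφk, sub_zero]
        exact hz.2.1.le.trans (div_le_self hr.le (one_le_pow₀ (by norm_num)))
      · exact (hz.2.2 j hj).le
    have h1 : ‖z - φ‖ ≤ d * r := by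
      rw [← b.repr.norm_map, EuclideanSpace.norm_eq]
      refine Real.sqrt_le_iff.2 ⟨by positivity, ?_⟩
      calc ∑ j, ‖b.repr (z - φ) j‖ ^ 2 ≤ ∑ _j : Fin d, r ^ 2 :=
            Finset.sum_le_sum fun j _ => pow_le_pow_left₀ (norm_nonneg _) (hcoord j) 2
        _ = d * r ^ 2 := by simp
        _ ≤ (d * r) ^ 2 := by
            have : (1 : ℝ) ≤ d := by exact_mod_cast k.pos
            nlinarith [sq_nonneg r]
    refine h1.trans_lt ?_
    rw [hr', ← mul_div_assoc, div_lt_iff₀ (by positivity)]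
    nlinarith
  have hfin := lintegral_ball_infoDensity_lt_top h (R := ‖φ‖ + δ) (by positivity)
  apply hfin
  rw [eq_top_iff]
  -- A positive lower bound common to all shells; summed over infinitely many disjoint shells it
  -- makes the integral infinite.
  have hκ : ENNReal.ofReal (c ^ 2 / r ^ 2) * volume (shell b k φ r 0) ≠ 0 :=
    mul_ne_zero (by rw [Ne, ENNReal.ofReal_eq_zero, not_le]; positivity)
      (volume_shell_zero_ne_zero hr)
  rw [← ENNReal.tsum_const_eq_top_of_ne_zero (α := ℕ) hκ]
  -- On the `n`-th shell the density exceeds `c² 4ⁿ / r²`, while the volume has shrunk by `4⁻ⁿ`.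
  have hshell : ∀ n, ENNReal.ofReal (c ^ 2 / r ^ 2) * volume (shell b k φ r 0) ≤
      ∫⁻ z in shell b k φ r n, infoDensity A (b k) z := fun n => by
    rw [volume_shell n, ← mul_assoc, ← ENNReal.ofReal_mul (by positivity), ← setLIntegral_const]
    refine setLIntegral_mono (measurable_infoDensity A (b k)) fun z hz => ?_
    refine ENNReal.ofReal_le_ofReal ?_
    have h1 := hball z (hsub n z hz)
    have h2 := hz.2.1
    have h3 : 0 < ‖b.repr z k‖ := lt_trans (by positivity) hz.1
    rw [← OrthonormalBasis.repr_apply_apply]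
    have h4 : c ^ 2 / r ^ 2 * 4 ^ n = c ^ 2 / (r / 2 ^ n) ^ 2 := by
      have h5 : ((2 : ℝ) ^ n) ^ 2 = 4 ^ n := by rw [← pow_mul, mul_comm n 2, pow_mul]; norm_num
      rw [div_pow r, h5]
      field_simp
    rw [h4]
    refine div_le_div₀ (by positivity) (pow_le_pow_left₀ hcpos.le h1.le 2) (by positivity)
      (pow_le_pow_left₀ h3.le h2.le 2)
  calc ∑' _ : ℕ, ENNReal.ofReal (c ^ 2 / r ^ 2) * volume (shell b k φ r 0)
      ≤ ∑' n, ∫⁻ z in shell b k φ r n, infoDensity A (b k) z := ENNReal.tsum_le_tsum hshell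
    _ = ∫⁻ z in ⋃ n, shell b k φ r n, infoDensity A (b k) z :=
        (lintegral_iUnion (fun n => (isOpen_shell n).measurableSet) (disjoint_shell hr) _).symm
    _ ≤ _ := by
        refine lintegral_mono_set ?_
        refine Set.iUnion_subset fun n z hz => ?_
        rw [mem_ball_zero_iff]
        have h1 := hsub n z hz
        have h2 := norm_le_norm_add_norm_sub' z φ
        linarith

end Divergence

/-! ### The frame superoperator near a pure state -/

section NearPure

variable {d : ℕ}

theorem ketbra_eq_vecMulVec (v w : EuclideanSpace ℂ (Fin d)) :
    ketbra v w = vecMulVec (v : Fin d → ℂ) (star (w : Fin d → ℂ)) := rfl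

theorem star_dotProduct_eq_inner (v w : EuclideanSpace ℂ (Fin d)) :
    star (v : Fin d → ℂ) ⬝ᵥ (w : Fin d → ℂ) = inner ℂ v w := by
  rw [EuclideanSpace.inner_eq_star_dotProduct, dotProduct_comm]

theorem ketbra_mulVec (v w : EuclideanSpace ℂ (Fin d)) (z : Fin d → ℂ) :
    ketbra v w *ᵥ z = (star (w : Fin d → ℂ) ⬝ᵥ z) • (v : Fin d → ℂ) := by
  rw [ketbra_eq_vecMulVec, vecMulVec_mulVec]
  ext i
  simp [mul_comm]

theorem ketbra_isHermitian (e : EuclideanSpace ℂ (Fin d)) : (ketbra e e).IsHermitian := by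
  ext i j; simp [ketbra, mul_comm]

theorem ketbra_posSemidef (e : EuclideanSpace ℂ (Fin d)) : (ketbra e e).PosSemidef :=
  Matrix.posSemidef_vecMulVec_self_star _

theorem trace_ketbra (v w : EuclideanSpace ℂ (Fin d)) : (ketbra v w).trace = inner ℂ w v := by
  rw [ketbra_eq_vecMulVec, Matrix.trace_vecMulVec, dotProduct_comm, star_dotProduct_eq_inner]

theorem ketbra_mul_ketbra (u v w x : EuclideanSpace ℂ (Fin d)) :
    ketbra u v * ketbra w x = (inner ℂ v w : ℂ) • ketbra u x := by
  rw [ketbra_eq_vecMulVec, ketbra_eq_vecMulVec, vecMulVec_mul_vecMulVec, star_dotProduct_eq_inner]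
  ext i j
  simp [ketbra, vecMulVec_apply]
  ring

theorem conjTranspose_ketbra (v w : EuclideanSpace ℂ (Fin d)) : (ketbra v w)ᴴ = ketbra w v := by
  ext i j; simp [ketbra, mul_comm]

theorem inner_self_eq_one {e : EuclideanSpace ℂ (Fin d)} (he : ‖e‖ = 1) : inner ℂ e e = (1 : ℂ) := by
  rw [inner_self_eq_norm_sq_to_K, he]; norm_num

theorem ketbra_mul_self {e : EuclideanSpace ℂ (Fin d)} (he : ‖e‖ = 1) :
    ketbra e e * ketbra e e = ketbra e e := by
  rw [ketbra_mul_ketbra, inner_self_eq_one he, one_smul]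

theorem expVal_add (A B : Op d) (ψ : EuclideanSpace ℂ (Fin d)) :
    expVal (A + B) ψ = expVal A ψ + expVal B ψ := by
  simp [expVal, Matrix.add_mulVec, dotProduct_add]

theorem expVal_sub (A B : Op d) (ψ : EuclideanSpace ℂ (Fin d)) :
    expVal (A - B) ψ = expVal A ψ - expVal B ψ := by
  simp [expVal, Matrix.sub_mulVec, dotProduct_sub]

theorem expVal_smul (c : ℂ) (A : Op d) (ψ : EuclideanSpace ℂ (Fin d)) :
    expVal (c • A) ψ = c * expVal A ψ := by
  simp [expVal, Matrix.smul_mulVec, dotProduct_smul]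

theorem expVal_ketbra_mul (e : EuclideanSpace ℂ (Fin d)) (A : Op d)
    (ψ : EuclideanSpace ℂ (Fin d)) :
    expVal (ketbra e e * A) ψ =
      star (inner ℂ e ψ) * (star (e : Fin d → ℂ) ⬝ᵥ A *ᵥ (ψ : Fin d → ℂ)) := by
  rw [expVal, ← Matrix.mulVec_mulVec, ketbra_mulVec, dotProduct_smul, smul_eq_mul, mul_comm,
    star_dotProduct_eq_inner]
  congr 1
  exact (inner_conj_symm _ _).symm

theorem mul_star_eq_normSq (z : ℂ) : z * star z = ((‖z‖ ^ 2 : ℝ) : ℂ) := by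
  rw [Complex.star_def, Complex.mul_conj, Complex.normSq_eq_norm_sq]

theorem expVal_ketbra (e ψ : EuclideanSpace ℂ (Fin d)) :
    expVal (ketbra e e) ψ = ((‖inner ℂ e ψ‖ ^ 2 : ℝ) : ℂ) := by
  have h := expVal_ketbra_mul e 1 ψ
  rw [mul_one, one_mulVec, star_dotProduct_eq_inner, mul_comm, mul_star_eq_normSq] at h
  exact h

theorem expVal_conj_ketbra (e : EuclideanSpace ℂ (Fin d)) (A : Op d)
    (ψ : EuclideanSpace ℂ (Fin d)) :
    expVal (Aᴴ * ketbra e e * A) ψ =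
      ((‖star (e : Fin d → ℂ) ⬝ᵥ A *ᵥ (ψ : Fin d → ℂ)‖ ^ 2 : ℝ) : ℂ) := by
  rw [expVal, Matrix.mul_assoc, ← Matrix.mulVec_mulVec, dotProduct_mulVec, ← star_mulVec,
    ← Matrix.mulVec_mulVec, ketbra_mulVec, dotProduct_smul, smul_eq_mul, ← mul_star_eq_normSq]
  congr 1
  rw [star_dotProduct, dotProduct_comm]

/-- The Cauchy--Schwarz inequality is sharp for rank-one projections. -/
theorem norm_expVal_ketbra_mul_sq (e : EuclideanSpace ℂ (Fin d)) (A : Op d)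
    (ψ : EuclideanSpace ℂ (Fin d)) :
    ‖expVal (ketbra e e * A) ψ‖ ^ 2 =
      ‖inner ℂ e ψ‖ ^ 2 * (expVal (Aᴴ * ketbra e e * A) ψ).re := by
  rw [expVal_ketbra_mul, expVal_conj_ketbra, Complex.ofReal_re, norm_mul, norm_star, mul_pow]

/-- The regularization `|e⟩⟨e| + ε` of a pure state. -/
def pureReg (e : EuclideanSpace ℂ (Fin d)) (ε : ℝ) : Op d := ketbra e e + (ε : ℂ) • 1

theorem pureReg_posDef (e : EuclideanSpace ℂ (Fin d)) {ε : ℝ} (hε : 0 < ε) :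
    (pureReg e ε).PosDef := by
  refine PosDef.posSemidef_add (ketbra_posSemidef e) ?_
  exact PosDef.one.smul (by exact_mod_cast hε)

theorem prob_pureReg (e : EuclideanSpace ℂ (Fin d)) (ε : ℝ) (ψ : UnitVec d) :
    (covariant d).prob (pureReg e ε) ψ = ‖inner ℂ e ψ.1‖ ^ 2 + ε := by
  rw [covariant_prob, pureReg, expVal_add, expVal_smul, expVal_one, expVal_ketbra, mul_one,
    Complex.add_re, Complex.ofReal_re, Complex.ofReal_re]

theorem tendsto_one_div_add_one : Tendsto (fun n : ℕ => (1 : ℝ) / (n + 1)) atTop (𝓝 0) :=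
  tendsto_one_div_add_atTop_nhds_zero_nat

/-- Fatou's lemma along `ε = 1/(n+1)`. The integrands converge off the hyperplane orthogonal to `e`,
which is negligible. -/
theorem lintegral_infoDensity_le {e : EuclideanSpace ℂ (Fin d)} (he : ‖e‖ = 1) {A : Op d} {K : ℝ}
    (hK : ∀ ε > 0, frameForm (pureReg e ε) A ≤ K) :
    ∫⁻ ψ : UnitVec d, infoDensity A e ψ.1 ∂(covariant d).ref ≤ ENNReal.ofReal K := by
  have he0 : e ≠ 0 := fun h => by rw [h, norm_zero] at he; exact zero_ne_one he
  set f : ℕ → UnitVec d → ENNReal := fun n ψ => ENNReal.ofReal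
    (((covariant d).prob (pureReg e (1 / (n + 1))) ψ)⁻¹ * ‖expVal A ψ.1‖ ^ 2) with hf
  have hpos : ∀ n : ℕ, (0 : ℝ) < 1 / (n + 1) := fun n => by positivity
  have hmeas : ∀ n, Measurable (f n) := fun n =>
    (continuous_frameForm_integrand (pureReg_posDef e (hpos n)) A).measurable.ennreal_ofReal
  have hlim : ∀ᵐ ψ ∂(covariant d).ref, infoDensity A e ψ.1 = liminf (fun n => f n ψ) atTop := by
    have h0 : ∀ᵐ ψ ∂(covariant d).ref, inner ℂ e ψ.1 ≠ 0 :=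
      Measure.ae_smul_measure (haarVec_inner_eq_zero he0) _
    filter_upwards [h0] with ψ hψ
    refine (Tendsto.liminf_eq ?_).symm
    refine (ENNReal.continuous_ofReal.tendsto _).comp ?_
    have hne : ‖inner ℂ e ψ.1‖ ^ 2 + 0 ≠ 0 := by
      rw [add_zero]; exact pow_ne_zero 2 (norm_ne_zero_iff.2 hψ)
    have := ((tendsto_const_nhds.add tendsto_one_div_add_one).inv₀ hne).mul_const
      (‖expVal A ψ.1‖ ^ 2)
    rw [add_zero] at this
    simp_rw [prob_pureReg]
    rw [div_eq_inv_mul]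
    exact this
  rw [lintegral_congr_ae hlim]
  refine (lintegral_liminf_le hmeas).trans ?_
  refine liminf_le_of_frequently_le' (Frequently.of_forall fun n => ?_)
  rw [hf, ← ofReal_integral_eq_lintegral_ofReal
    (integrable_covariant (continuous_frameForm_integrand (pureReg_posDef e (hpos n)) A))
    (Eventually.of_forall fun ψ => mul_nonneg
      (inv_nonneg.2 (covariant_prob_pos (pureReg_posDef e (hpos n)) ψ).le) (by positivity))]
  exact ENNReal.ofReal_le_ofReal (hK _ (hpos n))

theorem lintegral_toSphere_ne_top {A : Op d} {e : EuclideanSpace ℂ (Fin d)} (hd : d ≠ 0)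
    (h : ∫⁻ ψ : UnitVec d, infoDensity A e ψ.1 ∂(covariant d).ref ≠ ⊤) :
    ∫⁻ ψ : UnitVec d, infoDensity A e ψ.1
      ∂(volume : Measure (EuclideanSpace ℂ (Fin d))).toSphere ≠ ⊤ := by
  intro htop
  apply h
  change ∫⁻ ψ : UnitVec d, infoDensity A e ψ.1 ∂((d : ENNReal) • haarVec d) = ⊤
  rw [haarVec, lintegral_smul_measure, lintegral_smul_measure, htop]
  simp only [smul_eq_mul]
  rw [ENNReal.mul_top (ENNReal.inv_ne_zero.2 (measure_ne_top _ _)),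
    ENNReal.mul_top (by exact_mod_cast hd)]

theorem expVal_sandwich {Q A : Op d} (hQ : Q.IsHermitian) (ψ : EuclideanSpace ℂ (Fin d)) :
    expVal (Q * A * Q) ψ = expVal A (WithLp.toLp 2 (Q *ᵥ (ψ : Fin d → ℂ))) := by
  rw [expVal, expVal, Matrix.mul_assoc, ← Matrix.mulVec_mulVec, dotProduct_mulVec,
    ← Matrix.mulVec_mulVec]
  congr 1
  conv_lhs => rw [← hQ.eq]
  rw [← star_mulVec]

theorem complement_isHermitian (e : EuclideanSpace ℂ (Fin d)) :
    (1 - ketbra e e).IsHermitian := isHermitian_one.sub (ketbra_isHermitian e)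

/-- Boundedness of the regularized quadratic forms forces the block orthogonal to the pure state
to vanish. -/
theorem complement_mul_mul_complement_eq_zero (hd : d ≠ 0)
    {b : OrthonormalBasis (Fin d) ℂ (EuclideanSpace ℂ (Fin d))} {k : Fin d} {A : Op d} {K : ℝ}
    (hK : ∀ ε > 0, frameForm (pureReg (b k) ε) A ≤ K) :
    (1 - ketbra (b k) (b k)) * A * (1 - ketbra (b k) (b k)) = 0 := by
  have h1 := ne_top_of_le_ne_top ENNReal.ofReal_ne_top
    (lintegral_infoDensity_le (b.norm_eq_one k) hK)
  have h2 := lintegral_toSphere_ne_top hd h1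
  refine eq_zero_of_expVal fun ψ => ?_
  rw [expVal_sandwich (complement_isHermitian _)]
  refine expVal_eq_zero_of_lintegral_ne_top h2 ?_
  rw [← star_dotProduct_eq_inner]
  change star (b k : Fin d → ℂ) ⬝ᵥ ((1 - ketbra (b k) (b k)) *ᵥ (ψ : Fin d → ℂ)) = 0
  rw [Matrix.sub_mulVec, one_mulVec, ketbra_mulVec, dotProduct_sub, dotProduct_smul,
    star_dotProduct_eq_inner (b k) (b k), inner_self_eq_one (b.norm_eq_one k), smul_eq_mul, mul_one,
    sub_self]

end NearPure

/-! ### Phase averaging and the limiting quadratic form -/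

section PureLimit

variable {d : ℕ}

theorem inner_phaseRotation {e : EuclideanSpace ℂ (Fin d)} (he : ‖e‖ = 1) {c : ℂ} (hc : ‖c‖ = 1)
    (ψ : EuclideanSpace ℂ (Fin d)) :
    inner ℂ e (phaseRotation e he c hc ψ) = c * inner ℂ e ψ := by
  rw [phaseRotation_apply, inner_add_right, inner_smul_right, inner_self_eq_one he]
  ring

theorem complement_mulVec_phaseRotation {e : EuclideanSpace ℂ (Fin d)} (he : ‖e‖ = 1) {c : ℂ}
    (hc : ‖c‖ = 1) (ψ : EuclideanSpace ℂ (Fin d)) :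
    (1 - ketbra e e) *ᵥ (phaseRotation e he c hc ψ : Fin d → ℂ) =
      (1 - ketbra e e) *ᵥ (ψ : Fin d → ℂ) := by
  rw [Matrix.sub_mulVec, Matrix.sub_mulVec, one_mulVec, one_mulVec, ketbra_mulVec, ketbra_mulVec,
    star_dotProduct_eq_inner, star_dotProduct_eq_inner, inner_phaseRotation, phaseRotation_apply]
  ext i
  simp only [Pi.sub_apply, PiLp.add_apply, PiLp.smul_apply, Pi.smul_apply, smul_eq_mul]
  ring

/-- With `P = |e⟩⟨e|` and `Q = 1 - P`: when the `e` component of `ψ` acquires the phase `c`, the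
expectation of `P A P` is unchanged, that of `P A Q` gains `star c`, and that of `Q A P` gains `c`.
The three blocks thus carry different characters of the phase group. -/
theorem expVal_diag_phaseRotation {e : EuclideanSpace ℂ (Fin d)} (he : ‖e‖ = 1) {c : ℂ}
    (hc : ‖c‖ = 1) (A : Op d) (ψ : EuclideanSpace ℂ (Fin d)) :
    expVal (ketbra e e * (A * ketbra e e)) (phaseRotation e he c hc ψ) =
      expVal (ketbra e e * (A * ketbra e e)) ψ := by
  rw [expVal_ketbra_mul, expVal_ketbra_mul, ← Matrix.mulVec_mulVec, ← Matrix.mulVec_mulVec,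
    ketbra_mulVec, ketbra_mulVec, mulVec_smul, mulVec_smul, dotProduct_smul, dotProduct_smul,
    star_dotProduct_eq_inner e ψ, star_dotProduct_eq_inner e (phaseRotation e he c hc ψ),
    inner_phaseRotation, smul_eq_mul, smul_eq_mul, star_mul']
  have hc' : c * star c = 1 := by rw [mul_star_eq_normSq, hc]; norm_num
  linear_combination (star (inner ℂ e ψ) * inner ℂ e ψ *
    (star (e : Fin d → ℂ) ⬝ᵥ A *ᵥ (e : Fin d → ℂ))) * hc'

theorem expVal_offDiag_phaseRotation {e : EuclideanSpace ℂ (Fin d)} (he : ‖e‖ = 1) {c : ℂ}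
    (hc : ‖c‖ = 1) (A : Op d) (ψ : EuclideanSpace ℂ (Fin d)) :
    expVal (ketbra e e * (A * (1 - ketbra e e))) (phaseRotation e he c hc ψ) =
      star c * expVal (ketbra e e * (A * (1 - ketbra e e))) ψ := by
  rw [expVal_ketbra_mul, expVal_ketbra_mul, ← Matrix.mulVec_mulVec, ← Matrix.mulVec_mulVec,
    complement_mulVec_phaseRotation, inner_phaseRotation, star_mul']
  ring

/-- Orthogonality of characters on the fourth roots of unity: `1`, `star c` and `c` are already
distinct there, so four phases replace the average over the circle. -/
theorem sum_phases_norm_sq (a b c : ℂ) :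
    ‖a + b + c‖ ^ 2 + ‖a + star Complex.I * b + Complex.I * c‖ ^ 2 +
      ‖a + star (-1) * b + (-1) * c‖ ^ 2 + ‖a + star (-Complex.I) * b + (-Complex.I) * c‖ ^ 2 =
    4 * (‖a‖ ^ 2 + ‖b‖ ^ 2 + ‖c‖ ^ 2) := by
  simp only [← Complex.normSq_eq_norm_sq, Complex.normSq_apply]
  simp
  ring

theorem expVal_block_decomposition {e : EuclideanSpace ℂ (Fin d)} {A : Op d}
    (hA : (1 - ketbra e e) * A * (1 - ketbra e e) = 0) (ψ : EuclideanSpace ℂ (Fin d)) :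
    expVal A ψ = expVal (ketbra e e * (A * ketbra e e)) ψ +
      expVal (ketbra e e * (A * (1 - ketbra e e))) ψ +
      star (expVal (ketbra e e * (Aᴴ * (1 - ketbra e e))) ψ) := by
  rw [← expVal_conjTranspose, ← expVal_add, ← expVal_add]
  congr 1
  rw [Matrix.conjTranspose_mul, Matrix.conjTranspose_mul, Matrix.conjTranspose_conjTranspose,
    (complement_isHermitian e).eq, (ketbra_isHermitian e).eq]
  have h : A = ketbra e e * (A * ketbra e e) + ketbra e e * (A * (1 - ketbra e e)) +
    (1 - ketbra e e) * A * ketbra e e + (1 - ketbra e e) * A * (1 - ketbra e e) := by noncomm_ring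
  rw [hA, add_zero] at h
  exact h

/-- The operator whose expectation value is the phase average of the information density. -/
def blockGram (e : EuclideanSpace ℂ (Fin d)) (A : Op d) : Op d :=
  (A * ketbra e e)ᴴ * ketbra e e * (A * ketbra e e) +
    (A * (1 - ketbra e e))ᴴ * ketbra e e * (A * (1 - ketbra e e)) +
    (Aᴴ * (1 - ketbra e e))ᴴ * ketbra e e * (Aᴴ * (1 - ketbra e e))

/-- The four blocks of `A` are orthogonal in the Hilbert–Schmidt inner product, and the missing one
is zero by hypothesis. -/
theorem trace_blockGram {e : EuclideanSpace ℂ (Fin d)} (he : ‖e‖ = 1) {A : Op d}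
    (hA : (1 - ketbra e e) * A * (1 - ketbra e e) = 0) :
    (blockGram e A).trace = hsInner A A := by
  set P := ketbra e e
  set Q := 1 - P with hQ
  have hP : Pᴴ = P := (ketbra_isHermitian e).eq
  have hQh : Qᴴ = Q := (complement_isHermitian e).eq
  have hPP : P * P = P := ketbra_mul_self he
  have hQQ : Q * Q = Q := by rw [hQ, sub_mul, mul_sub, mul_sub, hPP]; simp
  have hPQ : P + Q = 1 := by rw [hQ]; abel
  have t1 : ((A * P)ᴴ * P * (A * P)).trace = (Aᴴ * P * A * P).trace := by
    rw [Matrix.conjTranspose_mul, hP,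
      show P * Aᴴ * P * (A * P) = P * (Aᴴ * P * A * P) by simp only [Matrix.mul_assoc],
      Matrix.trace_mul_comm, Matrix.mul_assoc, hPP]
  have t2 : ((A * Q)ᴴ * P * (A * Q)).trace = (Aᴴ * P * A * Q).trace := by
    rw [Matrix.conjTranspose_mul, hQh,
      show Q * Aᴴ * P * (A * Q) = Q * (Aᴴ * P * A * Q) by simp only [Matrix.mul_assoc],
      Matrix.trace_mul_comm, Matrix.mul_assoc, hQQ]
  have t3 : ((Aᴴ * Q)ᴴ * P * (Aᴴ * Q)).trace = (Aᴴ * Q * A * P).trace := by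
    rw [Matrix.conjTranspose_mul, Matrix.conjTranspose_conjTranspose, hQh,
      show Q * A * P * (Aᴴ * Q) = (Q * A * P) * (Aᴴ * Q) from rfl, Matrix.trace_mul_comm,
      show Aᴴ * Q * (Q * A * P) = Aᴴ * (Q * Q) * A * P by simp only [Matrix.mul_assoc], hQQ]
  have t4 : Aᴴ * A = Aᴴ * P * A * P + Aᴴ * P * A * Q + Aᴴ * Q * A * P := by
    have : Aᴴ * (Q * A * Q) = 0 := by rw [hA, mul_zero]
    calc Aᴴ * A = Aᴴ * (P + Q) * A * (P + Q) := by rw [hPQ, mul_one, mul_one]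
      _ = Aᴴ * P * A * P + Aᴴ * P * A * Q + Aᴴ * Q * A * P + Aᴴ * (Q * A * Q) := by noncomm_ring
      _ = _ := by rw [this, add_zero]
  rw [blockGram, Matrix.trace_add, Matrix.trace_add, t1, t2, t3, hsInner_eq_trace, t4,
    Matrix.trace_add, Matrix.trace_add]

/-- Measure and denominator are invariant under phase rotations, so the numerator may be averaged.
The cross terms cancel, and sharp Cauchy–Schwarz extracts a factor `|⟨e|ψ⟩|²` from each remaining
square, cancelling the singularity. -/
theorem frameForm_pureReg {e : EuclideanSpace ℂ (Fin d)} (he : ‖e‖ = 1) {A : Op d}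
    (hA : (1 - ketbra e e) * A * (1 - ketbra e e) = 0) {ε : ℝ} (hε : 0 < ε) :
    frameForm (pureReg e ε) A = ∫ ψ : UnitVec d, (‖inner ℂ e ψ.1‖ ^ 2 + ε)⁻¹ *
      (‖inner ℂ e ψ.1‖ ^ 2 * (expVal (blockGram e A) ψ.1).re) ∂(covariant d).ref := by
  have hτ := pureReg_posDef e hε
  have hinv : ∀ (c : ℂ) (hc : ‖c‖ = 1), frameForm (pureReg e ε) A =
      ∫ ψ : UnitVec d, (‖inner ℂ e ψ.1‖ ^ 2 + ε)⁻¹ *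
        ‖expVal A (phaseRotation e he c hc ψ.1)‖ ^ 2 ∂(covariant d).ref := fun c hc => by
    have hg := continuous_frameForm_integrand hτ A
    have h := integral_haarVec_map (phaseRotation e he c hc) hg
    rw [frameForm]
    change ∫ ψ, _ ∂((d : ENNReal) • haarVec d) = ∫ ψ, _ ∂((d : ENNReal) • haarVec d)
    rw [integral_smul_measure, integral_smul_measure, ← h]
    congr 1
    refine integral_congr_ae (Eventually.of_forall fun ψ => ?_)
    simp only [prob_pureReg]
    rw [UnitVec.map, inner_phaseRotation, norm_mul, hc, one_mul]
  have hI : ‖Complex.I‖ = 1 := Complex.norm_I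
  have h1 : ‖(-1 : ℂ)‖ = 1 := by simp
  have hnI : ‖-Complex.I‖ = 1 := by simp
  have hcont : ∀ (c : ℂ) (hc : ‖c‖ = 1), Continuous fun ψ : UnitVec d =>
      (‖inner ℂ e ψ.1‖ ^ 2 + ε)⁻¹ * ‖expVal A (phaseRotation e he c hc ψ.1)‖ ^ 2 := fun c hc => by
    refine Continuous.mul (Continuous.inv₀ (by fun_prop) fun ψ => by positivity) ?_
    exact (((continuous_expVal A).comp (phaseRotation e he c hc).continuous).comp
      continuous_subtype_val).norm.pow 2
  -- Each of the four copies is rotated by a different fourth root of unity.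
  have key : frameForm (pureReg e ε) A + frameForm (pureReg e ε) A + frameForm (pureReg e ε) A +
      frameForm (pureReg e ε) A = 4 * ∫ ψ : UnitVec d, (‖inner ℂ e ψ.1‖ ^ 2 + ε)⁻¹ *
      (‖inner ℂ e ψ.1‖ ^ 2 * (expVal (blockGram e A) ψ.1).re) ∂(covariant d).ref := by
    nth_rewrite 1 [hinv 1 norm_one]
    nth_rewrite 1 [hinv Complex.I hI]
    nth_rewrite 1 [hinv (-1) h1]
    nth_rewrite 1 [hinv (-Complex.I) hnI]
    have i1 := integrable_covariant (hcont 1 norm_one)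
    have i2 := integrable_covariant (hcont Complex.I hI)
    have i3 := integrable_covariant (hcont (-1) h1)
    have i4 := integrable_covariant (hcont (-Complex.I) hnI)
    rw [← integral_add i1 i2, ← integral_add ?_ i3, ← integral_add ?_ i4, ← integral_const_mul]
    rotate_left
    · exact (i1.add i2).add i3
    · exact i1.add i2
    refine integral_congr_ae (Eventually.of_forall fun ψ => ?_)
    simp only [expVal_block_decomposition hA, expVal_diag_phaseRotation,
      expVal_offDiag_phaseRotation, star_mul', star_star]
    have hs := sum_phases_norm_sq (expVal (ketbra e e * (A * ketbra e e)) ψ.1)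
      (expVal (ketbra e e * (A * (1 - ketbra e e))) ψ.1)
      (star (expVal (ketbra e e * (Aᴴ * (1 - ketbra e e))) ψ.1))
    rw [norm_star, norm_expVal_ketbra_mul_sq, norm_expVal_ketbra_mul_sq,
      norm_expVal_ketbra_mul_sq] at hs
    rw [← mul_add, ← mul_add, ← mul_add, star_one, one_mul, one_mul, hs, blockGram, expVal_add,
      expVal_add, Complex.add_re, Complex.add_re]
    ring
  linarith

/-- As `ε → 0` the factor `|⟨e|ψ⟩|² / (|⟨e|ψ⟩|² + ε)` is at most one and tends to one almost
everywhere, so by dominated convergence the forms tend to `tr (blockGram e A) = ‖A‖²`. -/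
theorem re_hsInner_self_le {e : EuclideanSpace ℂ (Fin d)} (he : ‖e‖ = 1) {A : Op d}
    (hA : (1 - ketbra e e) * A * (1 - ketbra e e) = 0) {K : ℝ}
    (hK : ∀ ε > 0, frameForm (pureReg e ε) A ≤ K) : (hsInner A A).re ≤ K := by
  have he0 : e ≠ 0 := fun h => by rw [h, norm_zero] at he; exact zero_ne_one he
  have hpos : ∀ n : ℕ, (0 : ℝ) < 1 / (n + 1) := fun n => by positivity
  rw [← trace_blockGram he hA, ← integral_covariant_expVal]
  refine le_of_tendsto' (f := fun n : ℕ => frameForm (pureReg e (1 / ((n : ℝ) + 1))) A)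
    (x := atTop) ?_ fun n => hK _ (hpos n)
  simp_rw [fun n : ℕ => frameForm_pureReg he hA (hpos n)]
  have hG : Continuous fun ψ : UnitVec d => (expVal (blockGram e A) ψ.1).re :=
    Complex.continuous_re.comp (continuous_expVal_unitVec _)
  refine tendsto_integral_of_dominated_convergence
    (fun ψ => ‖(expVal (blockGram e A) ψ.1).re‖) (fun n => ?_)
    (integrable_covariant hG.norm) (fun n => Eventually.of_forall fun ψ => ?_) ?_
  · refine Continuous.aestronglyMeasurable ?_
    refine Continuous.mul (Continuous.inv₀ (by fun_prop) fun ψ => ?_) (Continuous.mul (by fun_prop) hG)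
    have := hpos n
    positivity
  · have := hpos n
    rw [← mul_assoc, norm_mul]
    refine mul_le_of_le_one_left (norm_nonneg _) ?_
    rw [Real.norm_of_nonneg (by positivity), inv_mul_le_iff₀ (by positivity)]
    linarith
  · have h0 : ∀ᵐ ψ ∂(covariant d).ref, inner ℂ e ψ.1 ≠ 0 :=
      Measure.ae_smul_measure (haarVec_inner_eq_zero he0) _
    filter_upwards [h0] with ψ hψ
    have hne : ‖inner ℂ e ψ.1‖ ^ 2 ≠ 0 := pow_ne_zero 2 (norm_ne_zero_iff.2 hψ)
    have := ((tendsto_const_nhds (x := ‖inner ℂ e ψ.1‖ ^ 2)).add tendsto_one_div_add_one).inv₀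
      (by rwa [add_zero])
    have h2 := this.mul_const (‖inner ℂ e ψ.1‖ ^ 2 * (expVal (blockGram e A) ψ.1).re)
    rw [add_zero, ← mul_assoc, inv_mul_cancel₀ hne, one_mul] at h2
    exact h2

end PureLimit

/-! ### The limit of the inverse frame superoperator at a pure state -/

section FrameLimit

variable {d : ℕ}

theorem continuous_hsInner_app (A B : Op d) :
    Continuous fun S : SuperOp d => hsInner A (S.app B) := by
  unfold hsInner SuperOp.app
  simp only [Matrix.of_apply]
  fun_prop

theorem continuous_app (A : Op d) : Continuous fun S : SuperOp d => S.app A := by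
  refine continuous_matrix fun i j => ?_
  simp only [SuperOp.app, Matrix.of_apply]
  fun_prop

theorem continuous_hsInner_self (S : SuperOp d) :
    Continuous fun A : Op d => hsInner A (S.app A) := by
  unfold hsInner SuperOp.app
  simp only [Matrix.of_apply]
  fun_prop

theorem continuous_hsInner_right (A : Op d) : Continuous fun B : Op d => hsInner A B := by
  unfold hsInner
  fun_prop

theorem norm_expVal_le_mul_norm_sq (A : Op d) (v : EuclideanSpace ℂ (Fin d)) :
    ‖expVal A v‖ ≤ (∑ i, ∑ j, ‖A i j‖) * ‖v‖ ^ 2 := by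
  simp only [expVal, dotProduct, mulVec, Finset.mul_sum, Finset.sum_mul]
  refine (norm_sum_le _ _).trans (Finset.sum_le_sum fun i _ => ?_)
  refine (norm_sum_le _ _).trans (Finset.sum_le_sum fun j _ => ?_)
  rw [norm_mul, norm_mul, Pi.star_apply, norm_star]
  have h := mul_le_mul (PiLp.norm_apply_le v i) (PiLp.norm_apply_le v j) (norm_nonneg _)
    (norm_nonneg _)
  nlinarith [norm_nonneg (A i j)]

theorem norm_expVal_le (A : Op d) (ψ : UnitVec d) : ‖expVal A ψ.1‖ ≤ ∑ i, ∑ j, ‖A i j‖ := by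
  have h := norm_expVal_le_mul_norm_sq A ψ.1
  rwa [UnitVec.norm_val, one_pow, mul_one] at h

/-- The entries of an operator bound its expectation values uniformly in the unit vector. Together
with `frameForm_anti`, this compares the frame at a nearby full-rank state with the frame at `P +
ε`. -/
theorem eventually_prob_le_pureReg (e : EuclideanSpace ℂ (Fin d)) {ε : ℝ} (hε : 0 < ε) :
    ∀ᶠ ρ in 𝓝 (ketbra e e), ∀ ψ, (covariant d).prob ρ ψ ≤ (covariant d).prob (pureReg e ε) ψ := by
  have hc : Continuous fun ρ : Op d => ∑ i, ∑ j, ‖(ρ - ketbra e e) i j‖ := by fun_prop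
  have h0 : ∑ i, ∑ j, ‖(ketbra e e - ketbra e e) i j‖ < ε := by simpa using hε
  filter_upwards [(hc.tendsto (ketbra e e)).eventually (gt_mem_nhds h0)] with ρ hρ ψ
  have h1 := (Complex.re_le_norm _).trans ((norm_expVal_le (ρ - ketbra e e) ψ).trans hρ.le)
  rw [expVal_sub, Complex.sub_re, expVal_ketbra, Complex.ofReal_re] at h1
  rw [prob_pureReg, covariant_prob]
  linarith

theorem hsInner_self_eq (A : Op d) : hsInner A A = ((∑ q : Fin d × Fin d, ‖A q.1 q.2‖ ^ 2 : ℝ) : ℂ) := by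
  rw [hsInner, Complex.ofReal_sum]
  refine Finset.sum_congr rfl fun q _ => ?_
  rw [mul_comm, mul_star_eq_normSq]

theorem eq_zero_of_hsInner_self {A : Op d} (h : (hsInner A A).re ≤ 0) : A = 0 := by
  rw [hsInner_self_eq, Complex.ofReal_re] at h
  have h1 := (Finset.sum_eq_zero_iff_of_nonneg (s := Finset.univ)
    (f := fun q : Fin d × Fin d => ‖A q.1 q.2‖ ^ 2) fun q _ => by positivity).1
    (le_antisymm h (Finset.sum_nonneg fun q _ => by positivity))
  ext i j
  have := h1 (i, j) (Finset.mem_univ _)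
  simpa using this

theorem isHermitian_of_tendsto {n α : Type*} {l : Filter α} [l.NeBot]
    {f : α → Matrix n n ℂ} {M : Matrix n n ℂ} (h : Tendsto f l (𝓝 M))
    (hf : ∀ᶠ a in l, (f a).IsHermitian) : M.IsHermitian := by
  have h1 : Tendsto (fun a => (f a)ᴴ) l (𝓝 Mᴴ) :=
    (Continuous.matrix_conjTranspose continuous_id).continuousAt.tendsto.comp h
  exact tendsto_nhds_unique (h1.congr' (hf.mono fun a ha => ha)) h

/-- Every cluster value of the inverse frame superoperator at a pure state `P` is the map
`X ↦ X - (1 - P) X (1 - P)`. -/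
theorem app_of_tendsto_frame_inv (hd : d ≠ 0)
    (b : OrthonormalBasis (Fin d) ℂ (EuclideanSpace ℂ (Fin d))) (k : Fin d)
    {l : Filter (Op d)} [l.NeBot] (hl : l ≤ 𝓝[fullRankStates d] ketbra (b k) (b k))
    {M : SuperOp d} (hM : Tendsto (fun ρ => ((covariant d).frame ρ)⁻¹) l (𝓝 M)) (X : Op d) :
    M.app X = X - (1 - ketbra (b k) (b k)) * X * (1 - ketbra (b k) (b k)) := by
  set P := ketbra (b k) (b k) with hP
  have hPP : P * P = P := ketbra_mul_self (b.norm_eq_one k)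
  have hfull : ∀ᶠ ρ in l, ρ ∈ fullRankStates d := hl self_mem_nhdsWithin
  have hlP : Tendsto (fun ρ : Op d => ρ) l (𝓝 P) := hl.trans nhdsWithin_le_nhds
  have hherm : M.IsHermitian := isHermitian_of_tendsto hM
    (hfull.mono fun ρ hρ => (covariant_frame_posDef hd hρ.1).isHermitian.inv)
  have hform : ∀ X : Op d, Tendsto
      (fun ρ => (hsInner X (((covariant d).frame ρ)⁻¹.app X)).re) l
      (𝓝 (hsInner X (M.app X)).re) := fun X =>
    (Complex.continuous_re.comp (continuous_hsInner_app X X)).continuousAt.tendsto.comp hM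
  have hleft : ∀ X : Op d, (hsInner X (P * X)).re ≤ (hsInner X (M.app X)).re := fun X => by
    have hc : Continuous fun ρ : Op d => (hsInner X (ρ * X)).re :=
      Complex.continuous_re.comp ((continuous_hsInner_right X).comp (by fun_prop))
    exact le_of_tendsto_of_tendsto ((hc.tendsto P).comp hlP) (hform X)
      (hfull.mono fun ρ hρ => re_hsInner_mul_le hd hρ.1 X)
  have hright : ∀ X : Op d, (hsInner X (X * P)).re ≤ (hsInner X (M.app X)).re := fun X => by
    have hc : Continuous fun ρ : Op d => (hsInner X (X * ρ)).re :=
      Complex.continuous_re.comp ((continuous_hsInner_right X).comp (by fun_prop))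
    exact le_of_tendsto_of_tendsto ((hc.tendsto P).comp hlP) (hform X)
      (hfull.mono fun ρ hρ => re_hsInner_mul_right_le hd hρ.1 X)
  -- For `Z = 𝓕(ρ)⁻¹ X` the form at `ρ` equals `⟨⟨X|Z⟩⟩`; near `P` it dominates the form at `P + ε`,
  -- which is continuous in `Z` and passes to the limit.
  have hK : ∀ X : Op d, ∀ ε > 0, frameForm (pureReg (b k) ε) (M.app X) ≤
      (hsInner X (M.app X)).re := fun X ε hε => by
    have hreg := pureReg_posDef (b k) hε
    have hc : Continuous fun A : Op d => frameForm (pureReg (b k) ε) A := by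
      have := Complex.continuous_re.comp
        (continuous_hsInner_self ((covariant d).frame (pureReg (b k) ε)))
      refine this.congr fun A => ?_
      rw [Function.comp_apply, hsInner_frame_app_self hreg, Complex.ofReal_re]
    refine le_of_tendsto_of_tendsto
      ((hc.comp (continuous_app X)).continuousAt.tendsto.comp hM) (hform X) ?_
    filter_upwards [hfull, hlP.eventually (eventually_prob_le_pureReg (b k) hε)] with ρ hρ hle
    rw [← frameForm_inv hd hρ.1]
    exact frameForm_anti hρ.1 hreg hle _
  have hblock : ∀ X, (1 - P) * M.app X * (1 - P) = 0 := fun X =>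
    complement_mul_mul_complement_eq_zero hd (hK X)
  -- Only after the `Q`-block is known to vanish can `ε` be sent to zero inside the form.
  have hnorm : ∀ X, (hsInner (M.app X) (M.app X)).re ≤ (hsInner X (M.app X)).re := fun X =>
    re_hsInner_self_le (b.norm_eq_one k) (hblock X) (hK X)
  -- `‖M X - X‖² = ‖M X‖² - 2⟨⟨X|M X⟩⟩ + ‖X‖²` is at most zero under this hypothesis.
  have hfix : ∀ X, (hsInner X X).re ≤ (hsInner X (M.app X)).re → M.app X = X := fun X hX => by
    rw [← sub_eq_zero]
    apply eq_zero_of_hsInner_self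
    have h1 : (hsInner (M.app X) X).re = (hsInner X (M.app X)).re := by rw [← hsInner_conj]; simp
    rw [hsInner_sub_left, hsInner_sub_right, hsInner_sub_right]
    simp only [Complex.sub_re]
    linarith [hnorm X]
  -- With `Y = Q X Q`, self-adjointness gives `‖M Y‖² = ⟨⟨Y|M (M Y)⟩⟩`, which sees only the
  -- vanishing block of `M (M Y)`.
  have hkill : ∀ X, M.app ((1 - P) * X * (1 - P)) = 0 := fun X => by
    have hQ : (1 - P)ᴴ = 1 - P := complement_isHermitian (b k)
    apply eq_zero_of_hsInner_self
    rw [← hsInner_app_comm hherm, hsInner_eq_trace, Matrix.conjTranspose_mul,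
      Matrix.conjTranspose_mul, hQ, Matrix.mul_assoc, Matrix.trace_mul_comm, Matrix.mul_assoc,
      Matrix.mul_assoc, ← Matrix.mul_assoc (1 - P), hblock]
    simp
  -- On `P X` the lower bound by left multiplication already attains `‖P X‖²`; right multiplication
  -- does the same for `Q X P`.
  have h1 : M.app (P * X) = P * X := hfix _ (by
    have := hleft (P * X)
    rwa [← Matrix.mul_assoc, hPP] at this)
  have h2 : M.app ((1 - P) * X * P) = (1 - P) * X * P := hfix _ (by
    have := hright ((1 - P) * X * P)
    rwa [Matrix.mul_assoc ((1 - P) * X), hPP] at this)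
  have h3 : X = P * X + (1 - P) * X * P + (1 - P) * X * (1 - P) := by noncomm_ring
  conv_lhs => rw [h3, SuperOp.app_add, SuperOp.app_add, h1, h2, hkill]
  noncomm_ring

theorem SuperOp.ext_app {S T : SuperOp d} (h : ∀ X, S.app X = T.app X) : S = T := by
  ext p q
  have := congrFun (congrFun (h (Matrix.single q.1 q.2 1)) p.1) p.2
  simpa [SuperOp.app, Matrix.single_apply, ← Prod.ext_iff, Fintype.sum_prod_type, ite_and] using this

/-- The inverse frames stay in a compact set, so every ultrafilter has a limit, and all these limits
coincide. -/
theorem tendsto_frame_inv (hd : d ≠ 0)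
    (b : OrthonormalBasis (Fin d) ℂ (EuclideanSpace ℂ (Fin d))) (k : Fin d) {M : SuperOp d}
    (hM : ∀ X, M.app X = X - (1 - ketbra (b k) (b k)) * X * (1 - ketbra (b k) (b k))) :
    Tendsto (fun ρ => ((covariant d).frame ρ)⁻¹) (𝓝[fullRankStates d] ketbra (b k) (b k)) (𝓝 M) := by
  rw [tendsto_iff_ultrafilter]
  intro U hU
  set R := (((covariant d).frame (1 : Op d))⁻¹).trace.re
  have hcomp : IsCompact {S : SuperOp d | ∀ p q, S p q ∈ Metric.closedBall (0 : ℂ) R} := by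
    have : {S : SuperOp d | ∀ p q, S p q ∈ Metric.closedBall (0 : ℂ) R} =
        Set.univ.pi fun _ => Set.univ.pi fun _ => Metric.closedBall (0 : ℂ) R := by
      ext S
      exact ⟨fun h p _ q _ => h p q, fun h p q => h p trivial q trivial⟩
    rw [this]
    exact isCompact_univ_pi fun _ => isCompact_univ_pi fun _ => isCompact_closedBall 0 R
  have hmem : {S : SuperOp d | ∀ p q, S p q ∈ Metric.closedBall (0 : ℂ) R} ∈
      U.map (fun ρ => ((covariant d).frame ρ)⁻¹) := by
    rw [Ultrafilter.mem_map]
    filter_upwards [hU self_mem_nhdsWithin] with ρ hρ p q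
    rw [mem_closedBall_zero_iff]
    exact norm_frame_inv_le hd hρ p q
  obtain ⟨S, -, hS⟩ := isCompact_iff_ultrafilter_le_nhds.1 hcomp _ (le_principal_iff.2 hmem)
  have hS' : Tendsto (fun ρ => ((covariant d).frame ρ)⁻¹) U (𝓝 S) := hS
  have : S = M := SuperOp.ext_app fun X => by
    rw [hM, app_of_tendsto_frame_inv hd b k hU hS']
  rwa [← this]

end FrameLimit

/-! ### The limiting projector -/

section Projector

variable {d : ℕ}

theorem outer_app (A B X : Op d) : (outer A B).app X = hsInner B X • A := by
  ext i j
  simp only [SuperOp.app, outer, hsInner, Matrix.of_apply, Matrix.smul_apply, smul_eq_mul,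
    Finset.sum_mul]
  exact Finset.sum_congr rfl fun q _ => by ring

theorem SuperOp.add_app (S T : SuperOp d) (X : Op d) :
    SuperOp.app (S + T) X = S.app X + T.app X := by
  ext i j
  simp only [SuperOp.app, Matrix.of_apply, Matrix.add_apply, add_mul, Finset.sum_add_distrib]

theorem SuperOp.sum_app {ι : Type*} (s : Finset ι) (S : ι → SuperOp d) (X : Op d) :
    SuperOp.app (∑ j ∈ s, S j) X = ∑ j ∈ s, (S j).app X := by
  ext i j
  simp only [SuperOp.app, Matrix.of_apply, Matrix.sum_apply, Finset.sum_mul]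
  rw [Finset.sum_comm]

theorem outer_ketbra_app (u v : EuclideanSpace ℂ (Fin d)) (X : Op d) :
    (outer (ketbra u v) (ketbra u v)).app X = ketbra u u * X * ketbra v v := by
  rw [outer_app]
  ext i j
  simp only [hsInner, ketbra, Matrix.of_apply, Matrix.smul_apply, Matrix.mul_apply, smul_eq_mul,
    Finset.sum_mul, Fintype.sum_prod_type, star_mul', star_star]
  rw [Finset.sum_comm]
  exact Finset.sum_congr rfl fun p _ => Finset.sum_congr rfl fun q _ => by ring

theorem ofReal_sqrt_two_inv_sq :
    ((√2 : ℝ) : ℂ)⁻¹ * ((√2 : ℝ) : ℂ)⁻¹ = 1 / 2 := by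
  rw [← mul_inv, ← Complex.ofReal_mul, Real.mul_self_sqrt (by norm_num)]
  norm_num

/-- The pair `E⁺, E⁻` is a unitary transform of the pair of matrix units `|k⟩⟨j|, |j⟩⟨k|`, so both
give the same sum of projectors. -/
theorem outer_Eplus_add_outer_Eminus
    (e : OrthonormalBasis (Fin d) ℂ (EuclideanSpace ℂ (Fin d))) (k j : Fin d) :
    outer (Eplus e k j) (Eplus e k j) + outer (Eminus e k j) (Eminus e k j) =
      outer (ketbra (e k) (e j)) (ketbra (e k) (e j)) +
        outer (ketbra (e j) (e k)) (ketbra (e j) (e k)) := by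
  ext p q
  simp only [outer, Eplus, Eminus, Matrix.add_apply, Matrix.of_apply, Matrix.smul_apply,
    Matrix.sub_apply, smul_eq_mul, star_mul', star_add, star_sub, star_neg]
  rw [show star (((√2 : ℝ) : ℂ)⁻¹) = ((√2 : ℝ) : ℂ)⁻¹ by simp,
    show star Complex.I = -Complex.I from Complex.conj_I]
  generalize ketbra (e k) (e j) p.1 p.2 = a
  generalize ketbra (e j) (e k) p.1 p.2 = b
  generalize star (ketbra (e k) (e j) q.1 q.2) = a'
  generalize star (ketbra (e j) (e k) q.1 q.2) = b'
  have hs := ofReal_sqrt_two_inv_sq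
  generalize ((√2 : ℝ) : ℂ)⁻¹ = s at hs
  have hI := Complex.I_mul_I
  linear_combination ((a + b) * (a' + b') + (a - b) * (a' - b')) * hs
    - s * s * (a - b) * (a' - b') * hI

theorem sum_ketbra_basis (e : OrthonormalBasis (Fin d) ℂ (EuclideanSpace ℂ (Fin d))) :
    ∑ j, ketbra (e j) (e j) = 1 := by
  ext i l
  have h := e.sum_inner_mul_inner (EuclideanSpace.single i 1) (EuclideanSpace.single l 1)
  simp only [EuclideanSpace.inner_single_left, EuclideanSpace.inner_single_right, map_one,
    one_mul] at h
  rw [Matrix.sum_apply]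
  refine Eq.trans ?_ (h.trans ?_)
  · exact Finset.sum_congr rfl fun j _ => rfl
  · simp [Matrix.one_apply, eq_comm]

theorem sum_erase_ketbra_basis (e : OrthonormalBasis (Fin d) ℂ (EuclideanSpace ℂ (Fin d)))
    (k : Fin d) :
    ∑ j ∈ Finset.univ.erase k, ketbra (e j) (e j) = 1 - ketbra (e k) (e k) := by
  rw [← sum_ketbra_basis e, ← Finset.sum_erase_add _ _ (Finset.mem_univ k), add_sub_cancel_right]

/-- Summing over `j ≠ k` turns the projectors `|j⟩⟨j|` into `1 - |k⟩⟨k|`, so only the two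
off-diagonal blocks survive. -/
theorem pureLimit_app (e : OrthonormalBasis (Fin d) ℂ (EuclideanSpace ℂ (Fin d))) (k : Fin d)
    (X : Op d) :
    (pureLimit e k).app X = ketbra (e k) (e k) * X * (1 - ketbra (e k) (e k)) +
      (1 - ketbra (e k) (e k)) * X * ketbra (e k) (e k) := by
  rw [pureLimit, SuperOp.sum_app, ← sum_erase_ketbra_basis, Finset.mul_sum, Finset.sum_mul,
    Finset.sum_mul, ← Finset.sum_add_distrib]
  refine Finset.sum_congr rfl fun j _ => ?_
  rw [outer_Eplus_add_outer_Eminus, SuperOp.add_app, outer_ketbra_app, outer_ketbra_app]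

theorem outer_isHermitian (A : Op d) : (outer A A).IsHermitian := by
  ext p q
  simp only [Matrix.conjTranspose_apply, outer, Matrix.of_apply, star_mul', star_star]
  ring

theorem pureLimit_isStarProjection (e : OrthonormalBasis (Fin d) ℂ (EuclideanSpace ℂ (Fin d)))
    (k : Fin d) : IsStarProjection (pureLimit e k) := by
  refine ⟨SuperOp.ext_app fun X => ?_, ?_⟩
  · have hP : ketbra (e k) (e k) * ketbra (e k) (e k) = ketbra (e k) (e k) :=
      ketbra_mul_self (e.norm_eq_one k)
    rw [SuperOp.app_mul, pureLimit_app, pureLimit_app]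
    set P := ketbra (e k) (e k)
    have hQ : (1 - P) * (1 - P) = 1 - P := by
      rw [Matrix.mul_sub, Matrix.sub_mul, Matrix.one_mul, Matrix.mul_one, Matrix.sub_mul,
        Matrix.one_mul, hP, sub_self, sub_zero]
    have hPQ : P * (1 - P) = 0 := by rw [Matrix.mul_sub, Matrix.mul_one, hP, sub_self]
    have hQP : (1 - P) * P = 0 := by rw [Matrix.sub_mul, Matrix.one_mul, hP, sub_self]
    have h1 : P * (P * X * (1 - P) + (1 - P) * X * P) = P * X * (1 - P) := by
      rw [Matrix.mul_add, ← Matrix.mul_assoc, ← Matrix.mul_assoc, hP, ← Matrix.mul_assoc,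
        ← Matrix.mul_assoc, hPQ]
      simp
    have h2 : (1 - P) * (P * X * (1 - P) + (1 - P) * X * P) = (1 - P) * X * P := by
      rw [Matrix.mul_add, ← Matrix.mul_assoc, ← Matrix.mul_assoc, hQP, ← Matrix.mul_assoc,
        ← Matrix.mul_assoc, hQ]
      simp
    rw [h1, h2, Matrix.mul_assoc, hQ, Matrix.mul_assoc _ P P, hP]
  · rw [pureLimit]
    exact isSelfAdjoint_sum _ fun j _ =>
      ((outer_isHermitian _).add (outer_isHermitian _)).isSelfAdjoint

theorem trace_outer (A B : Op d) : (outer A B).trace = hsInner B A := by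
  simp only [Matrix.trace, Matrix.diag_apply, outer, Matrix.of_apply, hsInner]
  exact Finset.sum_congr rfl fun q _ => mul_comm _ _

theorem hsInner_ketbra_ketbra (u v w x : EuclideanSpace ℂ (Fin d)) :
    hsInner (ketbra u v) (ketbra w x) = inner ℂ u w * inner ℂ x v := by
  rw [hsInner_eq_trace, conjTranspose_ketbra, ketbra_mul_ketbra, Matrix.trace_smul, trace_ketbra,
    smul_eq_mul]

theorem trace_pureLimit (e : OrthonormalBasis (Fin d) ℂ (EuclideanSpace ℂ (Fin d)))
    (k : Fin d) : (pureLimit e k).trace = (2 * (d - 1) : ℕ) := by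
  have h1 : ∀ j, inner ℂ (e j) (e j) = (1 : ℂ) := fun j => inner_self_eq_one (e.norm_eq_one j)
  rw [pureLimit, Matrix.trace_sum]
  simp_rw [outer_Eplus_add_outer_Eminus, Matrix.trace_add, trace_outer, hsInner_ketbra_ketbra, h1]
  rw [Finset.sum_const, Finset.card_erase_of_mem (Finset.mem_univ k), Finset.card_univ,
    Fintype.card_fin]
  push_cast
  rw [nsmul_eq_mul]
  ring

theorem rank_eq_trace_of_isIdempotentElem {n : Type*} [Fintype n] [DecidableEq n]
    {A : Matrix n n ℂ} (hA : IsIdempotentElem A) : (A.rank : ℂ) = A.trace := by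
  have h1 : IsIdempotentElem (Matrix.toLin' A) := by
    rw [IsIdempotentElem, Module.End.mul_eq_comp, ← Matrix.toLin'_mul, hA.eq]
  rw [← Matrix.trace_toLin'_eq, (LinearMap.IsIdempotentElem.isProj_range _ h1).trace]
  rfl

theorem rank_pureLimit (e : OrthonormalBasis (Fin d) ℂ (EuclideanSpace ℂ (Fin d)))
    (k : Fin d) : (pureLimit e k).rank = 2 * (d - 1) := by
  have h := rank_eq_trace_of_isIdempotentElem (pureLimit_isStarProjection e k).isIdempotentElem
  rw [trace_pureLimit] at h
  exact_mod_cast h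

/-- The limit `X - Q X Q` of the inverse frame consists of three blocks; `P X P` is the action of
`|P⟩⟩⟨⟨P|`, which `𝓒` subtracts. -/
theorem tendsto_optMSEMatrix (hd : d ≠ 0)
    (e : OrthonormalBasis (Fin d) ℂ (EuclideanSpace ℂ (Fin d))) (k : Fin d) :
    Tendsto (covariant d).optMSEMatrix (𝓝[fullRankStates d] ketbra (e k) (e k))
      (𝓝 (pureLimit e k)) := by
  have hP : ketbra (e k) (e k) * ketbra (e k) (e k) = ketbra (e k) (e k) :=
    ketbra_mul_self (e.norm_eq_one k)
  have h1 := tendsto_frame_inv hd e k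
    (M := pureLimit e k + outer (ketbra (e k) (e k)) (ketbra (e k) (e k))) fun X => by
    rw [SuperOp.add_app, pureLimit_app, outer_ketbra_app]
    noncomm_ring
  have hc : Continuous fun ρ : Op d => outer ρ ρ := by
    refine continuous_matrix fun p q => ?_
    simp only [outer, Matrix.of_apply]
    fun_prop
  have h2 := h1.sub ((hc.tendsto (ketbra (e k) (e k))).mono_left
    (nhdsWithin_le_nhds (s := fullRankStates d)))
  rw [add_sub_cancel_right] at h2
  exact h2

theorem tendsto_scaledMSE_blue (hd : d ≠ 0)
    (e : OrthonormalBasis (Fin d) ℂ (EuclideanSpace ℂ (Fin d))) (k : Fin d) {N : ℕ}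
    (hN : 1 ≤ N) :
    Tendsto (fun ρ => (covariant d).scaledMSE N ((covariant d).blue ρ) ρ)
      (𝓝[fullRankStates d] ketbra (e k) (e k)) (𝓝 (2 * ((d : ℝ) - 1))) := by
  have hc : Continuous fun S : SuperOp d => S.trace.re := Complex.continuous_re.comp (by fun_prop)
  have h := (hc.tendsto (pureLimit e k)).comp (tendsto_optMSEMatrix hd e k)
  rw [trace_pureLimit, Complex.natCast_re, Nat.cast_mul, Nat.cast_sub (Nat.one_le_iff_ne_zero.2 hd),
    Nat.cast_ofNat, Nat.cast_one] at h
  refine h.congr' ?_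
  filter_upwards [self_mem_nhdsWithin] with ρ hρ
  exact (covariant_scaledMSE_blue hd hρ hN).symm

end Projector

/-! ### Measurements with finitely many outcomes -/

section Discrete

variable {d n : ℕ} {P Θ : Fin n → Op d}

/-- The matrix of the map from operators to outcome probabilities. -/
def analysisMatrix (P : Fin n → Op d) : Matrix (Fin n) (Fin d × Fin d) ℂ :=
  Matrix.of fun x q => star (P x q.1 q.2)

/-- The matrix of the map from outcome frequencies to estimates. -/
def synthesisMatrix (Θ : Fin n → Op d) : Matrix (Fin d × Fin d) (Fin n) ℂ :=
  Matrix.of fun p x => Θ x p.1 p.2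

theorem synthesisMatrix_injective :
    Function.Injective (synthesisMatrix : (Fin n → Op d) → Matrix (Fin d × Fin d) (Fin n) ℂ) := by
  intro Θ Θ' h
  ext x i j
  exact congrFun (congrFun h (i, j)) x

theorem discrete_isReconstruction_iff :
    (discrete P).IsReconstruction Θ ↔ synthesisMatrix Θ * analysisMatrix P = 1 := by
  rw [← Matrix.ext_iff]
  refine forall_congr' fun p => forall_congr' fun q => ?_
  change (∫ x, outer (Θ x) (P x) p q ∂Measure.count) = _ ↔ _
  rw [integral_count]
  rfl

theorem analysisMatrix_mul_synthesisMatrix (x y : Fin n) :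
    (analysisMatrix P * synthesisMatrix Θ) x y = hsInner (P x) (Θ y) := rfl

/-- With `d²` outcomes both matrices are square, so a one-sided inverse is two-sided; this yields
uniqueness and lets a reconstruction be verified by biorthogonality. -/
theorem mul_eq_one_comm_synthesis {P Θ : Fin (d ^ 2) → Op d} :
    synthesisMatrix Θ * analysisMatrix P = 1 ↔ analysisMatrix P * synthesisMatrix Θ = 1 :=
  Matrix.mul_eq_one_comm_of_card_eq _ _ _ (by simp [sq])

/-- The sum of the absolute entries bounds the expectation values of `H` in unit vectors. It allows
a state near the maximally mixed one to be built from any traceless Hermitian direction. -/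
theorem posSemidef_smul_one_add {H : Op d} (hH : H.IsHermitian) {c : ℝ}
    (hc : ∑ i, ∑ j, ‖H i j‖ ≤ c) : ((c : ℂ) • (1 : Op d) + H).PosSemidef := by
  have hherm : ((c : ℂ) • (1 : Op d) + H).IsHermitian := by
    refine IsHermitian.add ?_ hH
    rw [Matrix.IsHermitian, Matrix.conjTranspose_smul, Matrix.conjTranspose_one]
    simp
  refine PosSemidef.of_dotProduct_mulVec_nonneg hherm fun z => ?_
  set v : EuclideanSpace ℂ (Fin d) := WithLp.toLp 2 z
  have h1 : star z ⬝ᵥ ((c : ℂ) • (1 : Op d) + H) *ᵥ z = ((c * ‖v‖ ^ 2 : ℝ) : ℂ) + expVal H v := by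
    have e1 : star z ⬝ᵥ z = ((‖v‖ ^ 2 : ℝ) : ℂ) := by
      have := inner_self_eq_norm_sq_to_K (𝕜 := ℂ) v
      rw [EuclideanSpace.inner_eq_star_dotProduct, dotProduct_comm] at this
      rw [this]; norm_cast
    rw [Matrix.add_mulVec, Matrix.smul_mulVec, one_mulVec, dotProduct_add, dotProduct_smul, e1,
      expVal]
    push_cast
    rfl
  have him : star (expVal H v) = expVal H v := by
    rw [← expVal_conjTranspose, hH.eq]
  rw [h1, ← Complex.conj_eq_iff_re.1 him, ← Complex.ofReal_add, Complex.zero_le_real]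
  have h2 := norm_expVal_le_mul_norm_sq H v
  have h3 := (Complex.abs_re_le_norm (expVal H v))
  have h4 := neg_abs_le (expVal H v).re
  nlinarith [sq_nonneg ‖v‖]

theorem trace_eq_zero_of_hsInner (hP : (discrete P).IsPOVM) {X : Op d}
    (hX : ∀ x, hsInner (P x) X = 0) : X.trace = 0 := by
  rw [← Measurement.integral_hsInner hP X]
  exact integral_eq_zero_of_ae (Eventually.of_forall hX)

theorem hsInner_conjTranspose (A B : Op d) : hsInner Aᴴ Bᴴ = star (hsInner A B) := by
  rw [hsInner_conj, hsInner_eq_trace, hsInner_eq_trace, conjTranspose_conjTranspose,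
    Matrix.trace_mul_comm]

theorem hsInner_smul_right (c : ℂ) (A B : Op d) : hsInner A (c • B) = c * hsInner A B := by
  simp only [hsInner, Matrix.smul_apply, smul_eq_mul, Finset.mul_sum]
  exact Finset.sum_congr rfl fun q _ => by ring

theorem hsInner_smul_left (c : ℂ) (A B : Op d) : hsInner (c • A) B = star c * hsInner A B := by
  simp only [hsInner, Matrix.smul_apply, smul_eq_mul, Finset.mul_sum, star_mul']
  exact Finset.sum_congr rfl fun q _ => by ring

theorem hsInner_add_right (A B C : Op d) : hsInner A (B + C) = hsInner A B + hsInner A C := by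
  simp only [hsInner, Matrix.add_apply, mul_add, Finset.sum_add_distrib]

/-- Such an `H` is traceless because the effects sum to the identity. The maximally mixed state and
its perturbation along `H` are then states with equal statistics, hence equal. -/
theorem eq_zero_of_isInfoComplete_of_isHermitian (hd : d ≠ 0) (hP : (discrete P).IsPOVM)
    (hI : (discrete P).IsInfoComplete) {H : Op d} (hH : H.IsHermitian)
    (h0 : ∀ x, hsInner (P x) H = 0) : H = 0 := by
  have htr := trace_eq_zero_of_hsInner hP h0
  -- The summand `1` keeps `c` positive even if `H = 0`.
  set c : ℝ := 1 + ∑ i, ∑ j, ‖H i j‖ with hc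
  have hsum : 0 ≤ ∑ i, ∑ j, ‖H i j‖ := by positivity
  have hcpos : 0 < c := by positivity
  have hdc : (0 : ℝ) < (d * c)⁻¹ := by positivity
  have hne : ((d : ℂ) * c) ≠ 0 := by
    have : (c : ℂ) ≠ 0 := by exact_mod_cast hcpos.ne'
    exact mul_ne_zero (by exact_mod_cast hd) this
  have hdcC : (0 : ℂ) ≤ ((d : ℂ) * c)⁻¹ := by
    have := Complex.zero_le_real.2 hdc.le
    push_cast at this
    exact this
  have hst : ∀ K : Op d, K.IsHermitian → K.trace = 0 → ∑ i, ∑ j, ‖K i j‖ ≤ c →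
      IsState (((d : ℂ) * c)⁻¹ • ((c : ℂ) • (1 : Op d) + K)) := fun K hK hK0 hKc => by
    refine ⟨(posSemidef_smul_one_add hK hKc).smul hdcC, ?_⟩
    rw [Matrix.trace_smul, Matrix.trace_add, hK0, Matrix.trace_smul, Matrix.trace_one,
      Fintype.card_fin, add_zero, smul_eq_mul, smul_eq_mul, mul_comm (c : ℂ), inv_mul_cancel₀ hne]
  have h1 := hst H hH htr (by linarith)
  have h2 := hst 0 isHermitian_zero (by simp) (by simpa using hcpos.le)
  have h3 := hI _ _ h1 h2 (Eventually.of_forall fun x => by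
    have e1 := Measurement.prob_eq hP h1.1.isHermitian x
    have e2 := Measurement.prob_eq hP h2.1.isHermitian x
    have : hsInner ((discrete P).effect x) H = 0 := h0 x
    rw [hsInner_smul_right, hsInner_add_right, this] at e1
    rw [hsInner_smul_right, hsInner_add_right] at e2
    have e3 : hsInner ((discrete P).effect x) (0 : Op d) = 0 := by simp [hsInner]
    rw [e3, ← e1] at e2
    exact_mod_cast e2.symm)
  have h4 := smul_right_injective (Op d) (inv_ne_zero hne) h3
  simpa using h4

/-- Since the effects are Hermitian, both Hermitian components of `X` are also annihilated. -/
theorem eq_zero_of_isInfoComplete (hd : d ≠ 0) (hP : (discrete P).IsPOVM)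
    (hI : (discrete P).IsInfoComplete) {X : Op d} (h0 : ∀ x, hsInner (P x) X = 0) : X = 0 := by
  have hPH : ∀ x, (P x)ᴴ = P x := fun x => (hP.posSemidef x).isHermitian
  have h0' : ∀ x, hsInner (P x) Xᴴ = 0 := fun x => by
    rw [← hPH x, hsInner_conjTranspose, h0, star_zero]
  have h1 : X + Xᴴ = 0 := eq_zero_of_isInfoComplete_of_isHermitian hd hP hI
    (isHermitian_add_transpose_self X) fun x => by rw [hsInner_add_right, h0, h0', add_zero]
  have h2 : Complex.I • (X - Xᴴ) = 0 := eq_zero_of_isInfoComplete_of_isHermitian hd hP hI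
    (by
      rw [Matrix.IsHermitian, conjTranspose_smul, conjTranspose_sub, conjTranspose_conjTranspose,
        show star Complex.I = -Complex.I from Complex.conj_I, neg_smul, ← smul_neg, neg_sub])
    fun x => by rw [hsInner_smul_right, hsInner_sub_right, h0, h0', sub_self, mul_zero]
  have h3 : X - Xᴴ = 0 := (smul_eq_zero.1 h2).resolve_left Complex.I_ne_zero
  have h4 : (2 : ℂ) • X = 0 := by
    rw [two_smul]
    calc X + X = (X + Xᴴ) + (X - Xᴴ) := by abel
      _ = 0 := by rw [h1, h3, add_zero]
  exact (smul_eq_zero.1 h4).resolve_left two_ne_zero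

theorem exists_reconstruction {P : Fin (d ^ 2) → Op d} (hd : d ≠ 0) (hP : (discrete P).IsPOVM)
    (hI : (discrete P).IsInfoComplete) :
    ∃ Θ, (discrete P).IsReconstruction Θ := by
  have hinj : LinearMap.ker (Matrix.toLin' (analysisMatrix P)) = ⊥ := by
    rw [LinearMap.ker_eq_bot']
    intro z hz
    have h : (Matrix.of fun i j => z (i, j) : Op d) = 0 :=
      eq_zero_of_isInfoComplete hd hP hI fun x => congrFun hz x
    ext q
    exact congrFun (congrFun h q.1) q.2
  obtain ⟨g, hg⟩ := LinearMap.exists_leftInverse_of_injective _ hinj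
  refine ⟨fun x => Matrix.of fun i j => LinearMap.toMatrix' g (i, j) x, ?_⟩
  rw [discrete_isReconstruction_iff]
  have := congrArg LinearMap.toMatrix' hg
  rw [LinearMap.toMatrix'_comp, LinearMap.toMatrix'_toLin', LinearMap.toMatrix'_id] at this
  exact this

theorem reconstruction_unique {P Θ Θ' : Fin (d ^ 2) → Op d}
    (h : (discrete P).IsReconstruction Θ) (h' : (discrete P).IsReconstruction Θ') : Θ' = Θ := by
  rw [discrete_isReconstruction_iff] at h h'
  apply synthesisMatrix_injective
  rw [← Matrix.mul_one (synthesisMatrix Θ'), ← mul_eq_one_comm_synthesis.1 h, ← Matrix.mul_assoc,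
    h', Matrix.one_mul]

theorem ketbra_isState (ψ : UnitVec d) : IsState (ketbra ψ.1 ψ.1) :=
  ⟨ketbra_posSemidef _, by rw [trace_ketbra, inner_self_eq_one (UnitVec.norm_val ψ)]⟩

theorem scaledMSE_discrete (hP : (discrete P).IsPOVM) (hΘ : (discrete P).IsReconstruction Θ)
    {N : ℕ} (hN : 1 ≤ N) {ρ : Op d} (hρ : IsState ρ) :
    (discrete P).scaledMSE N Θ ρ =
      ∑ x, (discrete P).prob ρ x * (hsInner (Θ x) (Θ x)).re - (hsInner ρ ρ).re := by
  have := Measurement.isProbabilityMeasure_outcomeLaw hP hρ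
  have : IsFiniteMeasure (discrete P).ref := inferInstanceAs (IsFiniteMeasure Measure.count)
  have hsq : (discrete P).SquareIntegrable Θ ρ := fun i j => MemLp.of_discrete
  rw [Measurement.scaledMSE_eq_trace hN hsq, Matrix.trace, Complex.re_sum]
  simp_rw [Matrix.diag_apply, Measurement.mseMatrix_apply hN hsq
    (Measurement.integral_reconstruction hP hρ.1 hΘ fun _ _ => Integrable.of_finite),
    Complex.sub_re, Measurement.integral_outcomeLaw hP hρ.1, Finset.sum_sub_distrib]
  congr 1
  · have e : ∀ p : Fin d × Fin d, (∫ x, ((discrete P).prob ρ x : ℂ) *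
        (Θ x p.1 p.2 * star (Θ x p.1 p.2)) ∂(discrete P).ref).re =
        ∑ x, (discrete P).prob ρ x * ‖Θ x p.1 p.2‖ ^ 2 := fun p => by
      rw [show (discrete P).ref = Measure.count from rfl, integral_count, Complex.re_sum]
      refine Finset.sum_congr rfl fun x _ => ?_
      rw [mul_star_eq_normSq, ← Complex.ofReal_mul, Complex.ofReal_re]
    simp_rw [e]
    rw [Finset.sum_comm]
    refine Finset.sum_congr rfl fun x _ => ?_
    rw [hsInner_self_eq, Complex.ofReal_re, Finset.mul_sum]
  · rw [hsInner_self_eq, Complex.ofReal_re]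
    refine Finset.sum_congr rfl fun q _ => ?_
    rw [outer, Matrix.of_apply, mul_star_eq_normSq, Complex.ofReal_re]

theorem hsInner_ketbra_unitVec (ψ : UnitVec d) :
    (hsInner (ketbra ψ.1 ψ.1) (ketbra ψ.1 ψ.1)).re = 1 := by
  rw [hsInner_ketbra_ketbra, inner_self_eq_one (UnitVec.norm_val ψ), one_mul, Complex.one_re]

theorem discrete_prob_ketbra (ψ : UnitVec d) (x : Fin n) :
    (discrete P).prob (ketbra ψ.1 ψ.1) x = (expVal (P x) ψ.1).re := by
  rw [← covariant_prob]
  change (P x * ketbra ψ.1 ψ.1).trace.re = (ketbra ψ.1 ψ.1 * P x).trace.re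
  rw [Matrix.trace_mul_comm]

theorem integral_haarVec_expVal (hd : d ≠ 0) (A : Op d) :
    ∫ ψ : UnitVec d, (expVal A ψ.1).re ∂haarVec d = A.trace.re / d := by
  have h := integral_covariant_expVal A
  change ∫ ψ, _ ∂((d : ENNReal) • haarVec d) = _ at h
  rw [integral_smul_measure, ENNReal.toReal_natCast, smul_eq_mul] at h
  rw [← h, mul_div_cancel_left₀ _ (by exact_mod_cast hd)]

/-- Averaging a pure state gives `1/d`, so outcome `x` has mean probability `tr(Pₓ)/d`; the
subtracted purity is always one. -/
theorem integral_scaledMSE_discrete (hd : d ≠ 0) (hP : (discrete P).IsPOVM)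
    (hΘ : (discrete P).IsReconstruction Θ) {N : ℕ} (hN : 1 ≤ N) :
    ∫ ψ, (discrete P).scaledMSE N Θ (ketbra ψ.1 ψ.1) ∂haarVec d =
      (∑ x, (P x).trace.re * (hsInner (Θ x) (Θ x)).re) / d - 1 := by
  have := isProbabilityMeasure_haarVec hd
  simp_rw [fun ψ => scaledMSE_discrete hP hΘ hN (ketbra_isState ψ), hsInner_ketbra_unitVec,
    discrete_prob_ketbra]
  have hi : ∀ x, Integrable (fun ψ : UnitVec d => (expVal (P x) ψ.1).re *
      (hsInner (Θ x) (Θ x)).re) (haarVec d) := fun x =>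
    integrable_haarVec ((Complex.continuous_re.comp (continuous_expVal_unitVec _)).mul
      continuous_const)
  rw [integral_sub (integrable_finsetSum _ fun x _ => hi x) (integrable_const _),
    integral_finsetSum _ fun x _ => hi x, integral_const, probReal_univ, one_smul, Finset.sum_div]
  congr 1
  refine Finset.sum_congr rfl fun x _ => ?_
  rw [integral_mul_const, integral_haarVec_expVal hd]
  ring

/-- With `A = Cᴴ C`, Cauchy–Schwarz bounds each squared entry by the product of two squared column
norms. -/
theorem re_hsInner_self_le_trace_sq {A : Op d} (hA : A.PosSemidef) :
    (hsInner A A).re ≤ A.trace.re ^ 2 := by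
  obtain ⟨C, rfl⟩ := exists_eq_conjTranspose_mul_self hA
  have htr : (Cᴴ * C).trace.re = ∑ j, ∑ i, ‖C i j‖ ^ 2 := by
    rw [Matrix.trace, Complex.re_sum]
    refine Finset.sum_congr rfl fun j _ => ?_
    rw [Matrix.diag_apply, Matrix.mul_apply, Complex.re_sum]
    refine Finset.sum_congr rfl fun i _ => ?_
    rw [Matrix.conjTranspose_apply, mul_comm, mul_star_eq_normSq, Complex.ofReal_re]
  rw [hsInner_self_eq, Complex.ofReal_re, htr, sq, Finset.sum_mul_sum, Fintype.sum_prod_type]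
  refine Finset.sum_le_sum fun p _ => Finset.sum_le_sum fun q _ => ?_
  refine le_trans ?_ (Finset.sum_mul_sq_le_sq_mul_sq Finset.univ (fun i => ‖C i p‖) fun i => ‖C i q‖)
  refine pow_le_pow_left₀ (norm_nonneg _) ?_ 2
  rw [Matrix.mul_apply]
  refine (norm_sum_le _ _).trans_eq (Finset.sum_congr rfl fun i _ => ?_)
  rw [norm_mul, Matrix.conjTranspose_apply, norm_star]

theorem hsInner_one_left (A : Op d) : hsInner 1 A = A.trace := by
  rw [hsInner_eq_trace, conjTranspose_one, Matrix.one_mul]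

theorem hsInner_one_right (A : Op d) : hsInner A 1 = star A.trace := by
  rw [← hsInner_conj, hsInner_one_left]

/-- With `t = tr Q`, expand `‖t T - ((d+1) Q - t)‖² ≥ 0`, insert `‖Q‖² ≤ t²` and divide by `t`.
Equality needs `Q` of rank one and `T = (d+1) Q/t - 1`, or `Q = 0`. -/
theorem two_mul_re_hsInner_le {Q : Op d} (hQ : Q.PosSemidef) (T : Op d) :
    2 * ((d + 1) * (hsInner Q T).re - Q.trace.re * T.trace.re) ≤
      Q.trace.re * (hsInner T T).re + Q.trace.re * (d ^ 2 + d - 1) := by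
  set t := Q.trace.re with ht
  have ht0 : 0 ≤ t := (Complex.le_def.1 hQ.trace_nonneg).1
  have hQQ := re_hsInner_self_le_trace_sq hQ
  rcases ht0.eq_or_lt with h0 | hpos
  · have hQ0 : Q = 0 := eq_zero_of_hsInner_self (by rw [← ht, ← h0] at hQQ; simpa using hQQ)
    rw [← h0, hQ0]
    simp [hsInner]
  · have hQt : Q.trace = (t : ℂ) := (Complex.conj_eq_iff_re.1 (by
      rw [starRingEnd_apply, ← Matrix.trace_conjTranspose, hQ.isHermitian.eq])).symm
    have h1 : 0 ≤ (hsInner ((t : ℂ) • T - ((d + 1 : ℂ) • Q - (t : ℂ) • (1 : Op d)))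
        ((t : ℂ) • T - ((d + 1 : ℂ) • Q - (t : ℂ) • (1 : Op d)))).re := by
      rw [hsInner_self_eq, Complex.ofReal_re]
      positivity
    have hTQ : (hsInner T Q).re = (hsInner Q T).re := by rw [← hsInner_conj]; simp
    have hst : star (d + 1 : ℂ) = d + 1 := by simp
    have hstt : star (t : ℂ) = t := Complex.conj_ofReal t
    have key : (hsInner ((t : ℂ) • T - ((d + 1 : ℂ) • Q - (t : ℂ) • (1 : Op d)))
        ((t : ℂ) • T - ((d + 1 : ℂ) • Q - (t : ℂ) • (1 : Op d)))).re =
        t ^ 2 * (hsInner T T).re - 2 * t * ((d + 1) * (hsInner Q T).re - t * T.trace.re) +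
        ((d + 1) ^ 2 * (hsInner Q Q).re - 2 * (d + 1) * t ^ 2 + t ^ 2 * d) := by
      have hd1 : (d + 1 : ℂ) = ((d + 1 : ℝ) : ℂ) := by push_cast; rfl
      simp only [hsInner_sub_left, hsInner_sub_right, hsInner_smul_left, hsInner_smul_right, hst,
        hstt, hsInner_one_left, hsInner_one_right, hQt, Matrix.trace_sub, Matrix.trace_smul,
        Matrix.trace_one, Fintype.card_fin, smul_eq_mul]
      rw [hd1]
      simp only [Complex.sub_re, Complex.re_ofReal_mul, hTQ, Complex.natCast_re,
        Complex.ofReal_re, RCLike.star_def, Complex.conj_re]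
      ring
    rw [key] at h1
    have h2 : t * (2 * ((d + 1) * (hsInner Q T).re - t * T.trace.re)) ≤
        t * (t * (hsInner T T).re + t * (d ^ 2 + d - 1)) := by
      have : ((d : ℝ) + 1) ^ 2 * (hsInner Q Q).re ≤ (d + 1) ^ 2 * t ^ 2 :=
        mul_le_mul_of_nonneg_left hQQ (by positivity)
      nlinarith
    exact le_of_mul_le_mul_left h2 hpos

theorem sum_hsInner_reconstruction (hΘ : (discrete P).IsReconstruction Θ) :
    ∑ x, hsInner (P x) (Θ x) = (d : ℂ) ^ 2 := by
  rw [discrete_isReconstruction_iff] at hΘ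
  simp only [hsInner]
  rw [Finset.sum_comm]
  have : ∀ q : Fin d × Fin d, ∑ x, star (P x q.1 q.2) * Θ x q.1 q.2 = 1 := fun q => by
    have h := congrFun (congrFun hΘ q) q
    rw [Matrix.one_apply_eq] at h
    rw [← h]
    exact Finset.sum_congr rfl fun x _ => mul_comm _ _
  rw [Finset.sum_congr rfl fun q _ => this q]
  simp [sq]

/-- This is the identity superoperator sandwiched between `⟨⟨1|` and `|1⟩⟩`, with value `tr 1 = d`.
-/
theorem sum_trace_mul_trace_reconstruction (hΘ : (discrete P).IsReconstruction Θ) :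
    ∑ x, (Θ x).trace * star (P x).trace = (d : ℂ) := by
  rw [discrete_isReconstruction_iff] at hΘ
  simp only [Matrix.trace, star_sum, Finset.sum_mul_sum, Matrix.diag_apply]
  rw [Finset.sum_comm]
  have : ∀ i j : Fin d, ∑ x, Θ x i i * star (P x j j) = if i = j then 1 else 0 := fun i j => by
    have h := congrFun (congrFun hΘ (i, i)) (j, j)
    rw [Matrix.one_apply] at h
    simp only [Prod.mk.injEq, and_self] at h
    exact h
  rw [Finset.sum_congr rfl fun i _ => by
    rw [Finset.sum_comm, Finset.sum_congr rfl fun j _ => this i j]]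
  simp

/-- Summing the pointwise bound fixes its left side at `2((d+1)d² - d)` through the two contractions
of the reconstruction identity, and its constant term through `∑ tr Pₓ = d`. -/
theorem le_sum_trace_mul (hP : (discrete P).IsPOVM) (hΘ : (discrete P).IsReconstruction Θ) :
    (d : ℝ) * (d ^ 2 + d - 1) ≤ ∑ x, (P x).trace.re * (hsInner (Θ x) (Θ x)).re := by
  have h1 := Finset.sum_le_sum fun x (_ : x ∈ Finset.univ) =>
    two_mul_re_hsInner_le (hP.posSemidef x) (Θ x)
  have htr : ∑ x, (P x).trace.re = d := by
    have h := Measurement.integral_hsInner hP 1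
    change ∫ x, hsInner (P x) 1 ∂Measure.count = _ at h
    rw [integral_count] at h
    simp_rw [hsInner_one_right] at h
    have := congrArg Complex.re h
    rw [Complex.re_sum] at this
    simpa using this
  have hreal : ∀ x, star (P x).trace = ((P x).trace.re : ℂ) := fun x => by
    have : star (P x).trace = (P x).trace := by
      rw [← Matrix.trace_conjTranspose, show (P x)ᴴ = P x from (hP.posSemidef x).isHermitian]
    rw [this]
    exact (Complex.conj_eq_iff_re.1 this).symm
  have h2 : ∑ x, (hsInner (P x) (Θ x)).re = (d : ℝ) ^ 2 := by
    have := congrArg Complex.re (sum_hsInner_reconstruction hΘ)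
    rw [Complex.re_sum] at this
    rw [this]
    norm_cast
  have h3 : ∑ x, (P x).trace.re * (Θ x).trace.re = (d : ℝ) := by
    have := congrArg Complex.re (sum_trace_mul_trace_reconstruction hΘ)
    rw [Complex.re_sum] at this
    simp_rw [hreal, Complex.re_mul_ofReal] at this
    rw [Complex.natCast_re] at this
    rw [← this]
    exact Finset.sum_congr rfl fun x _ => mul_comm _ _
  have e1 : ∑ x, 2 * (((d : ℝ) + 1) * (hsInner ((discrete P).effect x) (Θ x)).re -
      ((discrete P).effect x).trace.re * (Θ x).trace.re) = 2 * ((d + 1) * d ^ 2 - d) := by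
    rw [← Finset.mul_sum, Finset.sum_sub_distrib, ← Finset.mul_sum]
    change 2 * ((d + 1) * ∑ x, (hsInner (P x) (Θ x)).re - ∑ x, (P x).trace.re * (Θ x).trace.re) = _
    rw [h2, h3]
  rw [e1, Finset.sum_add_distrib, ← Finset.sum_mul] at h1
  change _ ≤ ∑ x, (P x).trace.re * (hsInner (Θ x) (Θ x)).re +
    (∑ x, (P x).trace.re) * (d ^ 2 + d - 1) at h1
  rw [htr] at h1
  nlinarith

/-- The constant is `(d² + d - 1) - 1 = (d+2)(d-1)`. -/
theorem le_integral_scaledMSE_discrete (hd : d ≠ 0) (hP : (discrete P).IsPOVM)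
    (hΘ : (discrete P).IsReconstruction Θ) {N : ℕ} (hN : 1 ≤ N) :
    ((d : ℝ) + 2) / 2 * (2 * ((d : ℝ) - 1)) ≤
      ∫ ψ, (discrete P).scaledMSE N Θ (ketbra ψ.1 ψ.1) ∂haarVec d := by
  rw [integral_scaledMSE_discrete hd hP hΘ hN]
  have hd0 : (0 : ℝ) < d := by exact_mod_cast Nat.pos_of_ne_zero hd
  have h := (le_div_iff₀' hd0).2 (le_sum_trace_mul hP hΘ)
  linarith

end Discrete

/-! ### Symmetric informationally complete measurements -/

section SIC

variable {d : ℕ} {P : Fin (d ^ 2) → Op d} {ψ : Fin (d ^ 2) → UnitVec d}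

theorem hsInner_ketbra_self_self (u v : EuclideanSpace ℂ (Fin d)) :
    hsInner (ketbra u u) (ketbra v v) = ((‖inner ℂ u v‖ ^ 2 : ℝ) : ℂ) := by
  rw [hsInner_ketbra_ketbra, ← mul_star_eq_normSq, RCLike.star_def, inner_conj_symm]

theorem hsInner_sum_left {ι : Type*} (s : Finset ι) (A : ι → Op d) (B : Op d) :
    hsInner (∑ x ∈ s, A x) B = ∑ x ∈ s, hsInner (A x) B := by
  simp only [hsInner, Matrix.sum_apply, star_sum, Finset.sum_mul]
  rw [Finset.sum_comm]

theorem hsInner_sum_right {ι : Type*} (s : Finset ι) (A : ι → Op d) (B : Op d) :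
    hsInner B (∑ x ∈ s, A x) = ∑ x ∈ s, hsInner B (A x) := by
  simp only [hsInner, Matrix.sum_apply, Finset.mul_sum]
  rw [Finset.sum_comm]

/-- The overlaps add up to `d³`, so the squared distance of the sum from `d • 1` is `d³ - 2d³ + d³ =
0`. -/
theorem sum_ketbra_sic (hd : d ≠ 0)
    (h : ∀ ξ ζ, ‖inner ℂ (ψ ξ).1 (ψ ζ).1‖ ^ 2 = ((d : ℝ) * (if ξ = ζ then 1 else 0) + 1) / (d + 1)) :
    ∑ ξ, ketbra (ψ ξ).1 (ψ ξ).1 = (d : ℂ) • 1 := by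
  rw [← sub_eq_zero]
  apply eq_zero_of_hsInner_self
  have hd1 : (d : ℝ) + 1 ≠ 0 := by positivity
  have h1 : hsInner (∑ ξ, ketbra (ψ ξ).1 (ψ ξ).1) (∑ ξ, ketbra (ψ ξ).1 (ψ ξ).1) =
      ((d ^ 3 : ℝ) : ℂ) := by
    simp_rw [hsInner_sum_left, hsInner_sum_right, hsInner_ketbra_self_self, h]
    simp_rw [← Complex.ofReal_sum]
    congr 1
    simp_rw [← Finset.sum_div, Finset.sum_add_distrib, ← Finset.mul_sum]
    simp
    field_simp
    ring
  have htr : (∑ ξ, ketbra (ψ ξ).1 (ψ ξ).1).trace = ((d ^ 2 : ℝ) : ℂ) := by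
    simp_rw [Matrix.trace_sum, trace_ketbra, inner_self_eq_one (UnitVec.norm_val (ψ _))]
    simp
  have hdd : (d : ℂ) = ((d : ℝ) : ℂ) := by simp
  have hst : star (((d : ℝ)) : ℂ) = ((d : ℝ) : ℂ) := Complex.conj_ofReal _
  simp only [hsInner_sub_left, hsInner_sub_right, hsInner_smul_left, hsInner_smul_right, h1,
    hsInner_one_left, hsInner_one_right, htr, Matrix.trace_sub, Matrix.trace_smul,
    Matrix.trace_one, Fintype.card_fin, smul_eq_mul, hdd, hst, ← Complex.ofReal_mul,
    ← Complex.ofReal_sub]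
  ring_nf
  simp

theorem sic_isPOVM (hd : d ≠ 0) (hP : ∀ ξ, P ξ = (d : ℂ)⁻¹ • ketbra (ψ ξ).1 (ψ ξ).1)
    (h : ∀ ξ ζ, ‖inner ℂ (ψ ξ).1 (ψ ζ).1‖ ^ 2 = ((d : ℝ) * (if ξ = ζ then 1 else 0) + 1) / (d + 1)) :
    (discrete P).IsPOVM := by
  have : IsFiniteMeasure (discrete P).ref := inferInstanceAs (IsFiniteMeasure Measure.count)
  have hd0 : (d : ℂ) ≠ 0 := by exact_mod_cast hd
  refine ⟨fun ξ => ?_, fun i j => Integrable.of_finite, fun i j => ?_⟩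
  · change (P ξ).PosSemidef
    rw [hP]
    refine (ketbra_posSemidef _).smul ?_
    simp
  · change ∫ x, P x i j ∂Measure.count = _
    rw [integral_count]
    have h1 : ∑ ξ, P ξ = 1 := by
      simp_rw [hP]
      rw [← Finset.smul_sum, sum_ketbra_sic hd h, smul_smul, inv_mul_cancel₀ hd0, one_smul]
    rw [← h1, Matrix.sum_apply]

/-- Since the matrices are square, it suffices that these operators be dual to the effects: their
inner products are `((d+1)|⟨ψ_ξ|ψ_ζ⟩|² - 1)/d`. -/
theorem sic_isReconstruction (hd : d ≠ 0) (hP : ∀ ξ, P ξ = (d : ℂ)⁻¹ • ketbra (ψ ξ).1 (ψ ξ).1)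
    (h : ∀ ξ ζ, ‖inner ℂ (ψ ξ).1 (ψ ζ).1‖ ^ 2 = ((d : ℝ) * (if ξ = ζ then 1 else 0) + 1) / (d + 1)) :
    (discrete P).IsReconstruction fun ξ => ((d : ℂ) + 1) • ketbra (ψ ξ).1 (ψ ξ).1 - 1 := by
  rw [discrete_isReconstruction_iff, mul_eq_one_comm_synthesis]
  have hd0 : (d : ℂ) ≠ 0 := by exact_mod_cast hd
  have hd1 : (d : ℂ) + 1 ≠ 0 := by exact_mod_cast d.succ_ne_zero
  ext ξ ζ
  rw [analysisMatrix_mul_synthesisMatrix, hP, hsInner_smul_left, hsInner_sub_right,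
    hsInner_smul_right, hsInner_ketbra_self_self, h, hsInner_one_right, trace_ketbra,
    inner_self_eq_one (UnitVec.norm_val (ψ ξ)), Matrix.one_apply]
  have hst : star ((d : ℂ)⁻¹) = (d : ℂ)⁻¹ := by simp
  rw [hst, star_one]
  split_ifs
  · push_cast
    field_simp
    ring
  · push_cast
    field_simp
    ring

/-- The state is the mean of the reconstruction operators, hence a function of the outcome
probabilities. -/
theorem isInfoComplete_of_isReconstruction {n : ℕ} {P Θ : Fin n → Op d}
    (hP : (discrete P).IsPOVM) (hΘ : (discrete P).IsReconstruction Θ) :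
    (discrete P).IsInfoComplete := by
  have : IsFiniteMeasure (discrete P).ref := inferInstanceAs (IsFiniteMeasure Measure.count)
  intro ρ σ hρ hσ hae
  have hall : ∀ x, (discrete P).prob ρ x = (discrete P).prob σ x := by
    have := Measure.ae_count_iff.1 hae
    exact this
  ext i j
  rw [← Measurement.integral_reconstruction hP hρ.1 hΘ (fun _ _ => Integrable.of_finite) i j,
    ← Measurement.integral_reconstruction hP hσ.1 hΘ (fun _ _ => Integrable.of_finite) i j,
    Measurement.integral_outcomeLaw hP hρ.1, Measurement.integral_outcomeLaw hP hσ.1]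
  simp_rw [hall]

/-- All reconstruction operators have the same squared norm `d² + d - 1`, so the probabilities only
contribute their sum and the error is the same at every pure state. -/
theorem sic_scaledMSE (hd : d ≠ 0) (hP : ∀ ξ, P ξ = (d : ℂ)⁻¹ • ketbra (ψ ξ).1 (ψ ξ).1)
    (h : ∀ ξ ζ, ‖inner ℂ (ψ ξ).1 (ψ ζ).1‖ ^ 2 = ((d : ℝ) * (if ξ = ζ then 1 else 0) + 1) / (d + 1))
    {Θ : Fin (d ^ 2) → Op d} (hΘ : (discrete P).IsReconstruction Θ) {N : ℕ} (hN : 1 ≤ N)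
    (φ : UnitVec d) :
    (discrete P).scaledMSE N Θ (ketbra φ.1 φ.1) =
      ((d : ℝ) + 2) / 2 * (2 * ((d : ℝ) - 1)) := by
  have hpovm := sic_isPOVM hd hP h
  rw [scaledMSE_discrete hpovm hΘ hN (ketbra_isState φ), hsInner_ketbra_unitVec,
    reconstruction_unique (sic_isReconstruction hd hP h) hΘ]
  have h1 : ∀ ξ, (hsInner (((d : ℂ) + 1) • ketbra (ψ ξ).1 (ψ ξ).1 - 1)
      (((d : ℂ) + 1) • ketbra (ψ ξ).1 (ψ ξ).1 - 1)).re = (d : ℝ) ^ 2 + d - 1 := fun ξ => by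
    have hst : star ((d : ℂ) + 1) = d + 1 := by simp
    have hself : hsInner (ketbra (ψ ξ).1 (ψ ξ).1) (ketbra (ψ ξ).1 (ψ ξ).1) = 1 := by
      rw [hsInner_ketbra_ketbra, inner_self_eq_one (UnitVec.norm_val (ψ ξ)), one_mul]
    simp only [hsInner_sub_left, hsInner_sub_right, hsInner_smul_left, hsInner_smul_right, hst,
      hself, hsInner_one_left, hsInner_one_right, Matrix.trace_sub, Matrix.trace_smul,
      Matrix.trace_one, Fintype.card_fin, smul_eq_mul, trace_ketbra,
      inner_self_eq_one (UnitVec.norm_val (ψ ξ)), star_sub, mul_one, star_natCast]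
    have : ((d : ℂ) + 1) * (d + 1) - (d + 1) - ((d + 1) - d) = (((d : ℝ) ^ 2 + d - 1 : ℝ) : ℂ) := by
      push_cast
      ring
    rw [mul_sub, mul_one, this, Complex.ofReal_re]
  simp_rw [h1]
  have h2 : ∑ ξ, (discrete P).prob (ketbra φ.1 φ.1) ξ = 1 := by
    have h3 := Measurement.integral_hsInner hpovm (ketbra φ.1 φ.1)
    rw [show (discrete P).ref = Measure.count from rfl, integral_count, (ketbra_isState φ).2,
      Finset.sum_congr rfl fun x _ =>
        (Measurement.prob_eq hpovm (ketbra_isState φ).1.isHermitian x).symm] at h3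
    exact_mod_cast h3
  rw [← Finset.sum_mul, h2]
  ring

end SIC

/-! ### Asymptotics of a ratio of Gamma values -/

section GammaRatio

/-- Midpoint log-convexity of the Gamma function. -/
theorem Gamma_midpoint_sq_le {s t : ℝ} (hs : 0 < s) (ht : 0 < t) :
    Real.Gamma ((s + t) / 2) ^ 2 ≤ Real.Gamma s * Real.Gamma t := by
  have h := Real.Gamma_mul_add_mul_le_rpow_Gamma_mul_rpow_Gamma hs ht (a := 1 / 2) (b := 1 / 2)
    (by norm_num) (by norm_num) (by norm_num)
  have hs' := (Real.Gamma_pos_of_pos hs).le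
  have ht' := (Real.Gamma_pos_of_pos ht).le
  have h0 : 0 ≤ Real.Gamma ((s + t) / 2) := (Real.Gamma_pos_of_pos (by positivity)).le
  rw [← Real.sqrt_eq_rpow, ← Real.sqrt_eq_rpow, ← Real.sqrt_mul hs',
    show 1 / 2 * s + 1 / 2 * t = (s + t) / 2 by ring] at h
  exact (Real.le_sqrt h0 (mul_nonneg hs' ht')).1 h

/-- Log-convexity between `x` and `x + 1`, with midpoint `x + 1/2`. -/
theorem Gamma_ratio_sq_le {x : ℝ} (hx : 0 < x) :
    (Real.Gamma (x + 1 / 2) / Real.Gamma x) ^ 2 ≤ x := by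
  have h := Gamma_midpoint_sq_le hx (t := x + 1) (by positivity)
  have hpos := Real.Gamma_pos_of_pos hx
  rw [Real.Gamma_add_one hx.ne', show (x + (x + 1)) / 2 = x + 1 / 2 by ring] at h
  rw [div_pow, div_le_iff₀ (by positivity)]
  linarith

/-- Log-convexity between `x - 1/2` and `x + 1/2`, with midpoint `x`, and the functional equation at
the lower endpoint. -/
theorem le_Gamma_ratio_sq {x : ℝ} (hx : 1 / 2 < x) :
    x - 1 / 2 ≤ (Real.Gamma (x + 1 / 2) / Real.Gamma x) ^ 2 := by
  have hx0 : 0 < x := by linarith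
  have h := Gamma_midpoint_sq_le (s := x - 1 / 2) (t := x + 1 / 2) (by linarith) (by linarith)
  have hpos := Real.Gamma_pos_of_pos hx0
  have e := Real.Gamma_add_one (s := x - 1 / 2) (by linarith)
  rw [show x - 1 / 2 + 1 = x + 1 / 2 by ring] at e
  rw [show (x - 1 / 2 + (x + 1 / 2)) / 2 = x by ring] at h
  rw [div_pow, le_div_iff₀ (by positivity), sq (Real.Gamma (x + 1 / 2))]
  nth_rewrite 1 [e]
  nlinarith

theorem Gamma_ratio_isEquivalent :
    Asymptotics.IsEquivalent atTop
      (fun d : ℕ => Real.Gamma ((d : ℝ) - 1 / 2) / Real.Gamma ((d : ℝ) - 1))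
      (fun d : ℕ => √((d : ℝ) - 1)) := by
  have hev : ∀ᶠ d : ℕ in atTop, (1 : ℝ) ≤ (d : ℝ) - 1 := by
    filter_upwards [eventually_ge_atTop 2] with d hd
    have : (2 : ℝ) ≤ d := by exact_mod_cast hd
    linarith
  rw [Asymptotics.isEquivalent_iff_tendsto_one (hev.mono fun d hd =>
    (Real.sqrt_pos.2 (by linarith)).ne')]
  have hx : Tendsto (fun d : ℕ => (d : ℝ) - 1) atTop atTop :=
    tendsto_atTop_add_const_right _ _ tendsto_natCast_atTop_atTop
  have hlow : Tendsto (fun d : ℕ => √(1 - 1 / 2 * ((d : ℝ) - 1)⁻¹)) atTop (𝓝 1) := by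
    have h := ((tendsto_inv_atTop_zero.comp hx).const_mul (1 / 2 : ℝ)).const_sub 1
    have h2 := (Real.continuous_sqrt.tendsto _).comp h
    simpa [Function.comp_def] using h2
  refine tendsto_of_tendsto_of_tendsto_of_le_of_le' hlow tendsto_const_nhds ?_ ?_
  · filter_upwards [hev] with d hd
    have h := le_Gamma_ratio_sq (x := (d : ℝ) - 1) (by linarith)
    rw [show (d : ℝ) - 1 + 1 / 2 = d - 1 / 2 by ring] at h
    have hG : 0 ≤ Real.Gamma ((d : ℝ) - 1 / 2) / Real.Gamma ((d : ℝ) - 1) :=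
      div_nonneg (Real.Gamma_pos_of_pos (by linarith)).le (Real.Gamma_pos_of_pos (by linarith)).le
    have h0 : (0 : ℝ) < d - 1 := by linarith
    rw [Pi.div_apply, le_div_iff₀ (Real.sqrt_pos.2 h0), ← Real.sqrt_mul' _ h0.le,
      Real.sqrt_le_left hG]
    refine le_trans (le_of_eq ?_) h
    field_simp
  · filter_upwards [hev] with d hd
    have h := Gamma_ratio_sq_le (x := (d : ℝ) - 1) (by linarith)
    rw [show (d : ℝ) - 1 + 1 / 2 = d - 1 / 2 by ring] at h
    have h0 : (0 : ℝ) < d - 1 := by linarith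
    rw [Pi.div_apply, div_le_one (Real.sqrt_pos.2 h0)]
    exact Real.le_sqrt_of_sq_le h

end GammaRatio

/-! ### The trace norm -/

section TraceNorm

variable {d : ℕ}

open scoped MatrixOrder Matrix.Norms.L2Operator in
-- Continuity of the trace norm comes from the functional calculus, which avoids following
-- individual eigenvalues.
theorem continuous_sqrt_gram : Continuous fun A : Op d => cfc Real.sqrt (Aᴴ * A) := by
  have h : Continuous fun A : Op d => CFC.sqrt (Aᴴ * A) := by
    refine CFC.continuousOn_sqrt.comp_continuous (by fun_prop) fun A => ?_
    exact star_mul_self_nonneg A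
  refine h.congr fun A => ?_
  have h0 : 0 ≤ Aᴴ * A := star_mul_self_nonneg A
  rw [CFC.sqrt_eq_real_sqrt _ h0, cfcₙ_eq_cfc]

theorem trace_cfc {A : Op d} (hA : A.IsHermitian) (f : ℝ → ℝ) :
    (cfc f A).trace = ((∑ i, f (hA.eigenvalues i) : ℝ) : ℂ) := by
  rw [hA.cfc_eq, IsHermitian.cfc, Unitary.conjStarAlgAut_apply, Matrix.trace_mul_cycle,
    Unitary.coe_star_mul_self, Matrix.one_mul, Matrix.trace_diagonal, Complex.ofReal_sum]
  rfl

theorem trNorm_eq_trace (A : Op d) : trNorm A = (1 / 2) * (cfc Real.sqrt (Aᴴ * A)).trace.re := by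
  rw [trace_cfc (isHermitian_conjTranspose_mul_self A), Complex.ofReal_re, trNorm]

theorem continuous_trNorm : Continuous (trNorm : Op d → ℝ) := by
  have h : Continuous fun A : Op d => (1 / 2) * (cfc Real.sqrt (Aᴴ * A)).trace.re :=
    continuous_const.mul (Complex.continuous_re.comp (continuous_sqrt_gram.matrix_trace))
  exact h.congr fun A => (trNorm_eq_trace A).symm

theorem continuous_hsNorm : Continuous (hsNorm : Op d → ℝ) :=
  Real.continuous_sqrt.comp (Complex.continuous_re.comp (by fun_prop))

theorem hsNorm_nonneg (A : Op d) : 0 ≤ hsNorm A := Real.sqrt_nonneg _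

theorem trNorm_nonneg (A : Op d) : 0 ≤ trNorm A :=
  mul_nonneg (by norm_num) (Finset.sum_nonneg fun i _ => Real.sqrt_nonneg _)

theorem sum_eigenvalues_gram (A : Op d) :
    ∑ i, (isHermitian_conjTranspose_mul_self A).eigenvalues i = hsNorm A ^ 2 := by
  have h := (isHermitian_conjTranspose_mul_self A).trace_eq_sum_eigenvalues
  have h2 := congrArg Complex.re h
  rw [Complex.re_sum] at h2
  rw [hsNorm, Real.sq_sqrt, h2]
  · rfl
  · exact (Complex.le_def.1 (posSemidef_conjTranspose_mul_self A).trace_nonneg).1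

theorem eigenvalues_gram_nonneg (A : Op d) (i : Fin d) :
    0 ≤ (isHermitian_conjTranspose_mul_self A).eigenvalues i :=
  (posSemidef_conjTranspose_mul_self A).eigenvalues_nonneg i

theorem trNorm_le (A : Op d) : trNorm A ≤ √d / 2 * hsNorm A := by
  have h := Finset.sum_mul_sq_le_sq_mul_sq Finset.univ (fun _ : Fin d => (1 : ℝ))
    fun i => √((isHermitian_conjTranspose_mul_self A).eigenvalues i)
  simp only [one_mul, one_pow, Finset.sum_const, Finset.card_univ, Fintype.card_fin, nsmul_eq_mul,
    mul_one, Real.sq_sqrt (eigenvalues_gram_nonneg A _), sum_eigenvalues_gram] at h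
  have h2 := Real.le_sqrt_of_sq_le h
  rw [Real.sqrt_mul (Nat.cast_nonneg d), Real.sqrt_sq (hsNorm_nonneg A)] at h2
  rw [trNorm]
  linarith

/-- The trace norm when all nonzero singular values coincide. -/
theorem trNorm_of_gram_sq {A : Op d} {c : ℝ} (hc : 0 ≤ c)
    (h : (Aᴴ * A) * (Aᴴ * A) = ((c ^ 2 : ℝ) : ℂ) • (Aᴴ * A)) :
    c * trNorm A = hsNorm A ^ 2 / 2 := by
  have hA := isHermitian_conjTranspose_mul_self A
  -- On an eigenvector the hypothesis reads `λ² = c² λ`, so every singular value `√λ` is `0` or `c`.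
  have hl : ∀ i, c * √(hA.eigenvalues i) = hA.eigenvalues i := fun i => by
    have h1 := hA.mulVec_eigenvectorBasis i
    have h2 := congrArg (fun B => B *ᵥ (hA.eigenvectorBasis i : Fin d → ℂ)) h
    simp only at h2
    rw [← Matrix.mulVec_mulVec, h1, Matrix.mulVec_smul, h1, Matrix.smul_mulVec, h1] at h2
    have hne : (hA.eigenvectorBasis i : Fin d → ℂ) ≠ 0 := fun h0 => by
      have h3 := hA.eigenvectorBasis.orthonormal.ne_zero i
      exact h3 (by ext j; exact congrFun h0 j)
    have h4 : (((hA.eigenvalues i * hA.eigenvalues i - c ^ 2 * hA.eigenvalues i : ℝ)) : ℂ) •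
        (hA.eigenvectorBasis i : Fin d → ℂ) = 0 := by
      ext j
      have h5 := congrFun h2 j
      simp only [Pi.smul_apply, Complex.real_smul, smul_eq_mul] at h5
      simp only [Pi.smul_apply, smul_eq_mul, Pi.zero_apply]
      push_cast at h5 ⊢
      linear_combination h5
    have h6 := (smul_eq_zero.1 h4).resolve_right hne
    have h7 : hA.eigenvalues i * hA.eigenvalues i = c ^ 2 * hA.eigenvalues i :=
      sub_eq_zero.1 (by exact_mod_cast h6)
    have h8 := congrArg Real.sqrt h7
    rw [Real.sqrt_mul_self (eigenvalues_gram_nonneg A i), Real.sqrt_mul (by positivity),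
      Real.sqrt_sq hc] at h8
    exact h8.symm
  rw [trNorm, ← mul_assoc, mul_comm c, mul_assoc, Finset.mul_sum,
    Finset.sum_congr rfl fun i _ => hl i, sum_eigenvalues_gram]
  ring

end TraceNorm

/-! ### Weak convergence and expectations of functions of linear growth -/

section WeakConvergence

variable {E : Type*} [MeasurableSpace E] [TopologicalSpace E] [OpensMeasurableSpace E]

theorem integrable_of_lintegral_sq_le {ν : Measure E} [IsProbabilityMeasure ν] {f : E → ℝ}
    (hf : Continuous f) {K : ℝ} (hK : ∫⁻ x, ENNReal.ofReal (f x ^ 2) ∂ν ≤ ENNReal.ofReal K) :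
    Integrable (fun x => f x ^ 2) ν ∧ Integrable f ν := by
  have h2 : Integrable (fun x => f x ^ 2) ν := by
    refine ⟨(hf.pow 2).measurable.aestronglyMeasurable, ?_⟩
    rw [hasFiniteIntegral_iff_ofReal (Eventually.of_forall fun x => sq_nonneg _)]
    exact hK.trans_lt ENNReal.ofReal_lt_top
  refine ⟨h2, ?_⟩
  have : MemLp f 2 ν := (memLp_two_iff_integrable_sq hf.measurable.aestronglyMeasurable).2 h2
  exact this.integrable (by norm_num)

/-- Where `f` exceeds `R`, the truncation error is at most `f²/R`, so a second-moment bound controls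
it uniformly. -/
theorem abs_integral_sub_integral_min_le {ν : Measure E} [IsProbabilityMeasure ν] {f : E → ℝ}
    (hf : Continuous f) {K : ℝ} (hK0 : 0 ≤ K)
    (hK : ∫⁻ x, ENNReal.ofReal (f x ^ 2) ∂ν ≤ ENNReal.ofReal K) {R : ℝ} (hR : 0 < R) :
    |∫ x, f x ∂ν - ∫ x, min (f x) R ∂ν| ≤ K / R := by
  obtain ⟨h2, h1⟩ := integrable_of_lintegral_sq_le hf hK
  have hmin : Integrable (fun x => min (f x) R) ν := h1.inf (integrable_const R)
  have hKr : ∫ x, f x ^ 2 ∂ν ≤ K := by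
    rw [integral_eq_lintegral_of_nonneg_ae (Eventually.of_forall fun x => sq_nonneg _) h2.1]
    exact ENNReal.toReal_le_of_le_ofReal hK0 hK
  rw [← integral_sub h1 hmin, abs_of_nonneg (integral_nonneg fun x => sub_nonneg.2 (min_le_left _ _))]
  calc ∫ x, (f x - min (f x) R) ∂ν ≤ ∫ x, f x ^ 2 / R ∂ν := by
        refine integral_mono (h1.sub hmin) (h2.div_const R) fun x => ?_
        change f x - min (f x) R ≤ f x ^ 2 / R
        rw [le_div_iff₀ hR]
        rcases le_total (f x) R with h | h
        · rw [min_eq_left h, sub_self, zero_mul]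
          positivity
        · rw [min_eq_right h]
          nlinarith
    _ = (∫ x, f x ^ 2 ∂ν) / R := integral_div _ _
    _ ≤ K / R := div_le_div_of_nonneg_right hKr hR.le

/-- Fatou's lemma for weak convergence, from the portmanteau inequality on open sets. -/
theorem lintegral_le_of_tendsto [HasOuterApproxClosed E] {μs : ℕ → ProbabilityMeasure E}
    {μ : ProbabilityMeasure E} (h : Tendsto μs atTop (𝓝 μ)) {f : E → ℝ} (hf : Continuous f)
    (hf0 : ∀ x, 0 ≤ f x) {K : ENNReal} (hK : ∀ n, ∫⁻ x, ENNReal.ofReal (f x) ∂(μs n : Measure E) ≤ K) :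
    ∫⁻ x, ENNReal.ofReal (f x) ∂(μ : Measure E) ≤ K := by
  refine (lintegral_le_liminf_lintegral_of_forall_isOpen_measure_le_liminf_measure
    (μs := fun n => (μs n : Measure E)) hf hf0
    fun G hG => ProbabilityMeasure.le_liminf_measure_open_of_tendsto h hG).trans ?_
  exact (liminf_le_liminf (Eventually.of_forall hK)).trans_eq (liminf_const K)

/-- Bounded second moments give uniform integrability: truncated functions converge by weak
convergence, and the tails are uniformly small. -/
theorem tendsto_integral_of_lintegral_sq_le [HasOuterApproxClosed E]
    {μs : ℕ → ProbabilityMeasure E} {μ : ProbabilityMeasure E} (h : Tendsto μs atTop (𝓝 μ))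
    {f : E → ℝ} (hf : Continuous f) (hf0 : ∀ x, 0 ≤ f x) {K : ℝ}
    (hK : ∀ n, ∫⁻ x, ENNReal.ofReal (f x ^ 2) ∂(μs n : Measure E) ≤ ENNReal.ofReal K) :
    Tendsto (fun n => ∫ x, f x ∂(μs n : Measure E)) atTop (𝓝 (∫ x, f x ∂(μ : Measure E))) := by
  wlog hK0 : 0 ≤ K generalizing K
  · exact this (K := |K|) (fun n => (hK n).trans (ENNReal.ofReal_le_ofReal (le_abs_self K)))
      (abs_nonneg K)
  have hKμ : ∫⁻ x, ENNReal.ofReal (f x ^ 2) ∂(μ : Measure E) ≤ ENNReal.ofReal K :=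
    lintegral_le_of_tendsto h (hf.pow 2) (fun x => sq_nonneg _) hK
  rw [Metric.tendsto_atTop]
  intro ε hε
  -- This level makes each of the two tail errors less than `ε/3`.
  set R : ℝ := 3 * (K + 1) / ε with hRdef
  have hR : 0 < R := by positivity
  have hKR : K / R < ε / 3 := by
    rw [hRdef, div_div_eq_mul_div, div_lt_iff₀ (by positivity)]
    nlinarith
  let g : BoundedContinuousFunction E ℝ := BoundedContinuousFunction.ofNormedAddCommGroup
    (fun x => min (f x) R) (hf.min continuous_const) R fun x => by
      rw [Real.norm_of_nonneg (le_min (hf0 x) hR.le)]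
      exact min_le_right _ _
  have hg := ProbabilityMeasure.tendsto_iff_forall_integral_tendsto.1 h g
  obtain ⟨n₀, hn₀⟩ := Metric.tendsto_atTop.1 hg (ε / 3) (by positivity)
  refine ⟨n₀, fun n hn => ?_⟩
  have h1 := abs_integral_sub_integral_min_le hf hK0 (hK n) hR
  have h2 := abs_integral_sub_integral_min_le hf hK0 hKμ hR
  have h3 : |∫ x, min (f x) R ∂(μs n : Measure E) - ∫ x, min (f x) R ∂(μ : Measure E)| < ε / 3 :=
    hn₀ n hn
  rw [Real.dist_eq]
  rw [abs_lt] at h3 ⊢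
  rw [abs_le] at h1 h2
  constructor <;> linarith [h1.1, h1.2, h2.1, h2.2, h3.1, h3.2]

end WeakConvergence

/-! ### The central limit theorem in several variables -/

section CentralLimit

open ProbabilityTheory

variable {Ω : Type*} [MeasurableSpace Ω] {ν : Measure Ω}

/-- A positive variance is rescaled to one. Variance zero must be allowed, since a Hermitian error
has no component along anti-Hermitian directions; there the variable vanishes almost everywhere. -/
theorem tendsto_charFun_pow [IsProbabilityMeasure ν] {X : Ω → ℝ} (hX : MemLp X 2 ν) (h0 : ∫ ω, X ω ∂ν = 0) :
    Tendsto (fun n : ℕ => charFun (ν.map X) (√n)⁻¹ ^ n) atTop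
      (𝓝 (Complex.exp (-((∫ ω, X ω ^ 2 ∂ν : ℝ) : ℂ) / 2))) := by
  have hXm : AEMeasurable X ν := hX.1.aemeasurable
  set v := ∫ ω, X ω ^ 2 ∂ν with hv
  have hv0 : 0 ≤ v := integral_nonneg fun ω => sq_nonneg _
  rcases hv0.eq_or_lt with hz | hpos
  · have hae : X =ᵐ[ν] fun _ => 0 := by
      have h1 := (integral_eq_zero_iff_of_nonneg (fun ω => sq_nonneg (X ω)) hX.integrable_sq).1
        hz.symm
      filter_upwards [h1] with ω hω
      simpa using hω
    have : ∀ n : ℕ, charFun (ν.map X) (√n)⁻¹ ^ n = 1 := fun n => by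
      rw [Measure.map_congr hae, Measure.map_const]
      simp
    simp_rw [this, ← hz]
    simp
  · have hs : 0 < √v := Real.sqrt_pos.2 hpos
    have hY : AEMeasurable (fun ω => (√v)⁻¹ * X ω) ν := hXm.const_mul _
    have h := tendsto_charFun_inv_sqrt_mul_pow hY
      (by rw [integral_const_mul, h0, mul_zero])
      (by
        simp only [Pi.pow_apply, mul_pow]
        rw [integral_const_mul, ← hv, inv_pow, Real.sq_sqrt hv0, inv_mul_cancel₀ hpos.ne']) (√v)
    rw [← Complex.ofReal_pow, Real.sq_sqrt hv0] at h
    refine h.congr fun n => ?_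
    rw [charFun_map_mul_comp hXm]
    congr 2
    field_simp

variable {ι : Type*} [Fintype ι]

/-- Independence factorizes the characteristic function; each factor depends only on the projection
onto `t`, which reduces the vector case to one dimension. -/
theorem charFun_map_sum [IsProbabilityMeasure ν] {N : ℕ} {Y : Ω → EuclideanSpace ℝ ι} (hY : Measurable Y)
    (t : EuclideanSpace ℝ ι) :
    charFun ((Measure.pi fun _ : Fin N => ν).map fun ω => (√N)⁻¹ • ∑ k, Y (ω k)) t =
      charFun (ν.map fun ω => inner ℝ (Y ω) t) (√N)⁻¹ ^ N := by
  have hm : Measurable fun ω : Fin N → Ω => (√N)⁻¹ • ∑ k, Y (ω k) := by fun_prop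
  rw [charFun_apply, integral_map hm.aemeasurable (by fun_prop), charFun_apply_real,
    integral_map (by fun_prop) (by fun_prop)]
  have := integral_fintype_prod_eq_pow (ι := Fin N) (μ := ν) fun ω =>
    Complex.exp ((((√N)⁻¹ : ℝ) : ℂ) * ((inner ℝ (Y ω) t : ℝ) : ℂ) * Complex.I)
  rw [Fintype.card_fin] at this
  rw [← this]
  refine integral_congr_ae (Eventually.of_forall fun ω => ?_)
  simp only
  rw [← Complex.exp_sum, inner_smul_left, sum_inner, ← Finset.sum_mul, ← Finset.mul_sum]
  simp

/-- The matrix of second moments of a random vector. -/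
def momentMatrix (ν : Measure Ω) (Y : Ω → EuclideanSpace ℝ ι) : Matrix ι ι ℝ :=
  Matrix.of fun a b => ∫ ω, Y ω a * Y ω b ∂ν

theorem dotProduct_momentMatrix {Y : Ω → EuclideanSpace ℝ ι} (hY : ∀ a, MemLp (fun ω => Y ω a) 2 ν)
    (t : EuclideanSpace ℝ ι) :
    (t : ι → ℝ) ⬝ᵥ momentMatrix ν Y *ᵥ (t : ι → ℝ) = ∫ ω, inner ℝ (Y ω) t ^ 2 ∂ν := by
  have hint : ∀ a b, Integrable (fun ω => Y ω a * Y ω b) ν := fun a b =>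
    (hY a).integrable_mul (hY b)
  have e : ∀ ω, inner ℝ (Y ω) t ^ 2 = ∑ a, ∑ b, t a * t b * (Y ω a * Y ω b) := fun ω => by
    rw [PiLp.inner_apply, sq, Finset.sum_mul_sum]
    refine Finset.sum_congr rfl fun a _ => Finset.sum_congr rfl fun b _ => ?_
    simp only [RCLike.inner_apply, conj_trivial]
    ring
  simp_rw [e]
  rw [integral_finsetSum _ fun a _ => integrable_finsetSum _ fun b _ => (hint a b).const_mul _]
  simp only [dotProduct, mulVec, Finset.mul_sum]
  refine Finset.sum_congr rfl fun a _ => ?_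
  rw [integral_finsetSum _ fun b _ => (hint a b).const_mul _]
  refine Finset.sum_congr rfl fun b _ => ?_
  rw [integral_const_mul, momentMatrix, Matrix.of_apply]
  ring

theorem momentMatrix_posSemidef {Y : Ω → EuclideanSpace ℝ ι}
    (hY : ∀ a, MemLp (fun ω => Y ω a) 2 ν) : (momentMatrix ν Y).PosSemidef := by
  refine PosSemidef.of_dotProduct_mulVec_nonneg ?_ fun t => ?_
  · ext a b
    simp [momentMatrix, mul_comm]
  · have := dotProduct_momentMatrix hY (WithLp.toLp 2 t)
    rw [star_trivial, this]
    exact integral_nonneg fun ω => sq_nonneg _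

variable [DecidableEq ι]

theorem charFun_gaussian_momentMatrix {Y : Ω → EuclideanSpace ℝ ι}
    (hY : ∀ a, MemLp (fun ω => Y ω a) 2 ν) (t : EuclideanSpace ℝ ι) :
    charFun (multivariateGaussian 0 (momentMatrix ν Y)) t =
      Complex.exp (-((∫ ω, inner ℝ (Y ω) t ^ 2 ∂ν : ℝ) : ℂ) / 2) := by
  rw [charFun_multivariateGaussian (momentMatrix_posSemidef hY), dotProduct_momentMatrix hY]
  simp [neg_div]

/-- The central limit theorem for independent identically distributed random vectors. -/
theorem tendsto_charFun_map_sum [IsProbabilityMeasure ν] {Y : Ω → EuclideanSpace ℝ ι} (hYm : Measurable Y)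
    (hY : ∀ a, MemLp (fun ω => Y ω a) 2 ν) (h0 : ∀ a, ∫ ω, Y ω a ∂ν = 0)
    (t : EuclideanSpace ℝ ι) :
    Tendsto (fun N : ℕ => charFun
      ((Measure.pi fun _ : Fin N => ν).map fun ω => (√N)⁻¹ • ∑ k, Y (ω k)) t) atTop
      (𝓝 (charFun (multivariateGaussian 0 (momentMatrix ν Y)) t)) := by
  have e : ∀ ω, inner ℝ (Y ω) t = ∑ a, t a * Y ω a := fun ω => by
    rw [PiLp.inner_apply]
    simp
  have hL : MemLp (fun ω => inner ℝ (Y ω) t) 2 ν := by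
    simp_rw [e]
    exact memLp_finsetSum _ fun a _ => (hY a).const_mul _
  rw [charFun_gaussian_momentMatrix hY]
  simp_rw [charFun_map_sum hYm]
  refine tendsto_charFun_pow hL ?_
  simp_rw [e]
  rw [integral_finsetSum _ fun a _ => ((hY a).const_mul _).integrable (by norm_num)]
  simp [integral_const_mul, h0]

end CentralLimit

/-! ### Real coordinates for operators -/

section Coordinates

variable {d : ℕ}

/-- The space of real and imaginary parts of the entries of an operator. -/
abbrev CoordSpace (d : ℕ) := EuclideanSpace ℝ ((Fin d × Fin d) ⊕ (Fin d × Fin d))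

/-- The real and imaginary parts of the entries of an operator. -/
def toCoord (A : Op d) : CoordSpace d :=
  WithLp.toLp 2 (Sum.elim (fun p => (A p.1 p.2).re) fun p => (A p.1 p.2).im)

/-- The operator with given real and imaginary parts of the entries. -/
def ofCoord (x : CoordSpace d) : Op d :=
  Matrix.of fun i j => ⟨x (Sum.inl (i, j)), x (Sum.inr (i, j))⟩

theorem ofCoord_toCoord (A : Op d) : ofCoord (toCoord A) = A := rfl

theorem continuous_toCoord : Continuous (toCoord : Op d → CoordSpace d) := by
  refine (PiLp.continuous_toLp 2 _).comp (continuous_pi fun a => ?_)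
  rcases a with p | p
  · exact Complex.continuous_re.comp (continuous_id.matrix_elem p.1 p.2)
  · exact Complex.continuous_im.comp (continuous_id.matrix_elem p.1 p.2)

theorem continuous_ofCoord : Continuous (ofCoord : CoordSpace d → Op d) := by
  refine continuous_matrix fun i j => ?_
  have : (fun x : CoordSpace d => ofCoord x i j) = fun x =>
      (x (Sum.inl (i, j)) : ℂ) + (x (Sum.inr (i, j)) : ℂ) * Complex.I := by
    ext x
    exact Complex.mk_eq_add_mul_I _ _
  rw [this]
  fun_prop

theorem hsNorm_ofCoord (x : CoordSpace d) : hsNorm (ofCoord x) = ‖x‖ := by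
  have h : hsNorm (ofCoord x) ^ 2 = ‖x‖ ^ 2 := by
    rw [hsNorm_sq, EuclideanSpace.real_norm_sq_eq, Fintype.sum_sum_type, ← Finset.sum_add_distrib]
    refine Finset.sum_congr rfl fun p _ => ?_
    rw [← Complex.normSq_eq_norm_sq, Complex.normSq_apply, ofCoord, Matrix.of_apply]
    ring
  exact (sq_eq_sq₀ (hsNorm_nonneg _) (norm_nonneg x)).1 h

theorem inner_toCoord (A : Op d) (t : CoordSpace d) :
    inner ℝ (toCoord A) t = (hsInner (ofCoord t) A).re := by
  rw [PiLp.inner_apply, Fintype.sum_sum_type, hsInner, Complex.re_sum, ← Finset.sum_add_distrib]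
  refine Finset.sum_congr rfl fun p _ => ?_
  simp only [toCoord, ofCoord, Matrix.of_apply, Sum.elim_inl, Sum.elim_inr, RCLike.inner_apply,
    conj_trivial, RCLike.star_def, Complex.mul_re, Complex.conj_re, Complex.conj_im]
  ring

theorem toCoord_deviation {N : ℕ} {X : Type} (Θ : X → Op d) (ρ : Op d) (ω : Fin N → X) :
    toCoord (deviation N Θ ρ ω) = (√N)⁻¹ • ∑ k, toCoord (Θ (ω k) - ρ) := by
  rcases N.eq_zero_or_pos with rfl | hN
  · ext a
    rcases a with p | p <;> simp [toCoord, deviation]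
  · have h : ∀ p : Fin d × Fin d, deviation N Θ ρ ω p.1 p.2 =
        (((√N)⁻¹ : ℝ) : ℂ) * ∑ k, (Θ (ω k) - ρ) p.1 p.2 := fun p => by
      rw [deviation_apply hN, Complex.ofReal_inv]
      rfl
    ext a
    rcases a with p | p
    · simp only [toCoord, h, Sum.elim_inl, Complex.re_ofReal_mul, Complex.re_sum, PiLp.smul_apply,
        WithLp.ofLp_sum, Finset.sum_apply, smul_eq_mul]
    · simp only [toCoord, h, Sum.elim_inr, Complex.im_ofReal_mul, Complex.im_sum, PiLp.smul_apply,
        WithLp.ofLp_sum, Finset.sum_apply, smul_eq_mul]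

/-- The Hermitian part of an operator. -/
def hermPart (A : Op d) : Op d := (1 / 2 : ℂ) • (A + Aᴴ)

theorem hsInner_add_left (A B C : Op d) : hsInner (A + B) C = hsInner A C + hsInner B C := by
  simp only [hsInner, Matrix.add_apply, star_add, add_mul, Finset.sum_add_distrib]

/-- A Hermitian error only sees the Hermitian part of a test operator. This converts real
covariances in coordinates into the complex form of `𝓒(ρ)`. -/
theorem hsInner_hermPart (A : Op d) {B : Op d} (hB : B.IsHermitian) :
    hsInner (hermPart A) B = ((hsInner A B).re : ℂ) := by
  have h : hsInner Aᴴ B = star (hsInner A B) := by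
    rw [← hsInner_conjTranspose, hB.eq]
  rw [hermPart, hsInner_smul_left, hsInner_add_left, h, Complex.re_eq_add_conj]
  simp only [RCLike.star_def, map_div₀, map_one, map_ofNat]
  ring

theorem sq_re_hsInner (A : Op d) {B : Op d} (hB : B.IsHermitian) :
    (((hsInner A B).re ^ 2 : ℝ) : ℂ) = hsInner (hermPart A) B * star (hsInner (hermPart A) B) := by
  rw [hsInner_hermPart A hB, RCLike.star_def, Complex.conj_ofReal, Complex.ofReal_pow, sq]

end Coordinates

/-! ### The large-sample limit at full-rank states -/

section LargeSample

open ProbabilityTheory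

variable {d : ℕ} {ρ : Op d}

/-- The effects are Hermitian, so the frame commutes with taking adjoints; in matrix units this is a
swap of indices. -/
theorem covariant_frame_star (σ : Op d) (p q : Fin d × Fin d) :
    star ((covariant d).frame σ p q) = (covariant d).frame σ p.swap q.swap := by
  rw [Measurement.frame, Matrix.of_apply, Matrix.of_apply]
  refine Eq.trans (integral_conj (f := fun x => (((covariant d).prob σ x)⁻¹ : ℂ) *
    outer ((covariant d).effect x) ((covariant d).effect x) p q)).symm ?_
  refine integral_congr_ae (Eventually.of_forall fun x => ?_)
  have h := ((covariant_isPOVM d).posSemidef x).isHermitian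
  simp only [outer, Matrix.of_apply, map_mul, map_inv₀, Complex.conj_ofReal, Prod.fst_swap,
    Prod.snd_swap]
  rw [← h.apply p.2 p.1, ← h.apply q.2 q.1]
  simp

theorem SuperOp.app_conjTranspose {S : SuperOp d} (hS : ∀ p q, star (S p q) = S p.swap q.swap)
    (A : Op d) : S.app Aᴴ = (S.app A)ᴴ := by
  ext i j
  rw [Matrix.conjTranspose_apply]
  simp only [SuperOp.app, Matrix.of_apply, star_sum, star_mul', hS, Matrix.conjTranspose_apply]
  exact (Equiv.sum_comp (Equiv.prodComm (Fin d) (Fin d))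
    (fun q => S (i, j) q * star (A q.2 q.1))).symm

theorem covariant_frame_inv_conjTranspose (hd : d ≠ 0) {σ : Op d} (hσ : σ.PosDef) (A : Op d) :
    SuperOp.app ((covariant d).frame σ)⁻¹ Aᴴ = (SuperOp.app ((covariant d).frame σ)⁻¹ A)ᴴ := by
  have hu := (Matrix.isUnit_iff_isUnit_det _).1 (covariant_frame_posDef hd hσ).isUnit
  set F := (covariant d).frame σ
  have h1 : F.app (F⁻¹.app A)ᴴ = Aᴴ := by
    rw [SuperOp.app_conjTranspose (covariant_frame_star σ), ← SuperOp.app_mul,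
      Matrix.mul_nonsing_inv _ hu, SuperOp.app_one]
  rw [← h1, ← SuperOp.app_mul, Matrix.nonsing_inv_mul _ hu, SuperOp.app_one]

theorem covariant_blue_isHermitian (hd : d ≠ 0) {σ : Op d} (hσ : σ.PosDef) (ψ : UnitVec d) :
    ((covariant d).blue σ ψ).IsHermitian := by
  have h : ((covariant d).effect ψ)ᴴ = (covariant d).effect ψ :=
    ((covariant_isPOVM d).posSemidef ψ).isHermitian
  rw [Matrix.IsHermitian, Measurement.blue, Matrix.conjTranspose_smul,
    ← covariant_frame_inv_conjTranspose hd hσ, h]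
  simp

/-- The single-outcome error of the optimal reconstruction, in real coordinates. -/
def blueError (ρ : Op d) (ψ : UnitVec d) : CoordSpace d := toCoord ((covariant d).blue ρ ψ - ρ)

theorem continuous_blueError (hρ : ρ ∈ fullRankStates d) : Continuous (blueError ρ) :=
  continuous_toCoord.comp ((continuous_matrix fun i j =>
    continuous_covariant_blue hρ.1 i j).sub continuous_const)

theorem memLp_blueError (hρ : ρ ∈ fullRankStates d) (a : (Fin d × Fin d) ⊕ (Fin d × Fin d)) :
    MemLp (fun ψ => blueError ρ ψ a) 2 ((covariant d).outcomeLaw ρ) := by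
  have := Measurement.isProbabilityMeasure_outcomeLaw (covariant_isPOVM d) (isState_of_fullRank hρ)
  have hc : Continuous fun ψ => blueError ρ ψ a :=
    (PiLp.continuous_apply 2 _ a).comp (continuous_blueError hρ)
  exact hc.memLp_of_hasCompactSupport (HasCompactSupport.of_compactSpace _)

theorem covariant_integral_blue (hd : d ≠ 0) (hρ : ρ ∈ fullRankStates d) (i j : Fin d) :
    ∫ ψ, (covariant d).blue ρ ψ i j ∂(covariant d).outcomeLaw ρ = ρ i j :=
  Measurement.integral_reconstruction (covariant_isPOVM d) hρ.1.posSemidef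
    (covariant_isReconstruction_blue hd hρ)
    (covariant_integrable_outer hρ.1 (covariant_squareIntegrable_blue hρ)) i j

theorem integral_blueError (hd : d ≠ 0) (hρ : ρ ∈ fullRankStates d)
    (a : (Fin d × Fin d) ⊕ (Fin d × Fin d)) :
    ∫ ψ, blueError ρ ψ a ∂(covariant d).outcomeLaw ρ = 0 := by
  have := Measurement.isProbabilityMeasure_outcomeLaw (covariant_isPOVM d) (isState_of_fullRank hρ)
  have hi : ∀ p : Fin d × Fin d, Integrable (fun ψ => ((covariant d).blue ρ ψ - ρ) p.1 p.2)
      ((covariant d).outcomeLaw ρ) := fun p =>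
    ((covariant_squareIntegrable_blue hρ p.1 p.2).integrable (by norm_num)).sub (integrable_const _)
  have h0 : ∀ p : Fin d × Fin d, ∫ ψ, ((covariant d).blue ρ ψ - ρ) p.1 p.2
      ∂(covariant d).outcomeLaw ρ = 0 := fun p => by
    simp only [Matrix.sub_apply]
    rw [integral_sub ((covariant_squareIntegrable_blue hρ p.1 p.2).integrable (by norm_num))
      (integrable_const _), covariant_integral_blue hd hρ, integral_const, probReal_univ, one_smul,
      sub_self]
  rcases a with p | p
  · refine (integral_re (hi p)).trans ?_
    rw [h0]
    rfl
  · refine (integral_im (hi p)).trans ?_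
    rw [h0]
    rfl

theorem integral_blue_mul_star (hd : d ≠ 0) (hρ : ρ ∈ fullRankStates d) (p q : Fin d × Fin d) :
    ∫ ψ, ((covariant d).blue ρ ψ p.1 p.2 - ρ p.1 p.2) *
      star ((covariant d).blue ρ ψ q.1 q.2 - ρ q.1 q.2) ∂(covariant d).outcomeLaw ρ =
      (covariant d).optMSEMatrix ρ p q := by
  have := Measurement.isProbabilityMeasure_outcomeLaw (covariant_isPOVM d) (isState_of_fullRank hρ)
  rw [integral_centered_mul_star (covariant_squareIntegrable_blue hρ) (covariant_integral_blue hd hρ),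
    Measurement.integral_mul_star_blue (covariant_isPOVM d) hρ.1.posSemidef
      (covariant_prob_pos hρ.1) (covariant_isReconstruction_blue hd hρ)
      (covariant_integrable_outer hρ.1 (covariant_squareIntegrable_blue hρ))]
  rfl

theorem integral_inner_blueError_sq (hd : d ≠ 0) (hρ : ρ ∈ fullRankStates d) (t : CoordSpace d) :
    ((∫ ψ, inner ℝ (blueError ρ ψ) t ^ 2 ∂(covariant d).outcomeLaw ρ : ℝ) : ℂ) =
      hsInner (hermPart (ofCoord t))
        (((covariant d).optMSEMatrix ρ).app (hermPart (ofCoord t))) := by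
  have := Measurement.isProbabilityMeasure_outcomeLaw (covariant_isPOVM d) (isState_of_fullRank hρ)
  set H := hermPart (ofCoord t)
  have hL : ∀ p : Fin d × Fin d, MemLp (fun ψ => (covariant d).blue ρ ψ p.1 p.2 - ρ p.1 p.2) 2
      ((covariant d).outcomeLaw ρ) := fun p =>
    (covariant_squareIntegrable_blue hρ p.1 p.2).sub (memLp_const _)
  rw [← integral_complex_ofReal]
  have e : ∀ ψ, ((inner ℝ (blueError ρ ψ) t ^ 2 : ℝ) : ℂ) = ∑ p : Fin d × Fin d, ∑ q : Fin d × Fin d,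
      star (H p.1 p.2) * (((covariant d).blue ρ ψ p.1 p.2 - ρ p.1 p.2) *
        star ((covariant d).blue ρ ψ q.1 q.2 - ρ q.1 q.2)) * H q.1 q.2 := fun ψ => by
    rw [blueError, inner_toCoord, sq_re_hsInner _
      ((covariant_blue_isHermitian hd hρ.1 ψ).sub hρ.1.isHermitian)]
    simp only [hsInner, star_sum, star_mul', star_star, Finset.sum_mul_sum]
    refine Finset.sum_congr rfl fun p _ => Finset.sum_congr rfl fun q _ => ?_
    simp only [Matrix.sub_apply]
    ring
  simp_rw [e]
  have hi : ∀ p q : Fin d × Fin d, Integrable (fun ψ => star (H p.1 p.2) *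
      (((covariant d).blue ρ ψ p.1 p.2 - ρ p.1 p.2) *
        star ((covariant d).blue ρ ψ q.1 q.2 - ρ q.1 q.2)) * H q.1 q.2)
      ((covariant d).outcomeLaw ρ) := fun p q =>
    ((integrable_mul_star (hL p) (hL q)).const_mul _).mul_const _
  rw [integral_finsetSum _ fun p _ => integrable_finsetSum _ fun q _ => hi p q]
  simp only [hsInner, SuperOp.app, Matrix.of_apply, Finset.mul_sum]
  refine Finset.sum_congr rfl fun p _ => ?_
  rw [integral_finsetSum _ fun q _ => hi p q]
  refine Finset.sum_congr rfl fun q _ => ?_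
  rw [integral_mul_const, integral_const_mul, integral_blue_mul_star hd hρ, mul_assoc]

/-- The Gaussian law of the scaled deviation in the large-sample limit. -/
def limitLaw (ρ : Op d) : ProbabilityMeasure (CoordSpace d) :=
  ⟨multivariateGaussian 0 (momentMatrix ((covariant d).outcomeLaw ρ) (blueError ρ)), inferInstance⟩

/-- The state enters only through `𝓒(ρ)`, and continuously, so convergence of `𝓒` implies weak
convergence of the Gaussian laws. -/
theorem charFun_limitLaw (hd : d ≠ 0) (hρ : ρ ∈ fullRankStates d) (t : CoordSpace d) :
    charFun (limitLaw ρ : Measure (CoordSpace d)) t =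
      Complex.exp (-hsInner (hermPart (ofCoord t))
        (((covariant d).optMSEMatrix ρ).app (hermPart (ofCoord t))) / 2) := by
  rw [← integral_inner_blueError_sq hd hρ]
  exact charFun_gaussian_momentMatrix (memLp_blueError hρ) t

theorem measurable_toCoord_deviation (hρ : ρ ∈ fullRankStates d) (N : ℕ) :
    Measurable fun ω : Fin N → UnitVec d => toCoord (deviation N ((covariant d).blue ρ) ρ ω) := by
  have : (fun ω : Fin N → UnitVec d => toCoord (deviation N ((covariant d).blue ρ) ρ ω)) =
      fun ω => (√N)⁻¹ • ∑ k, blueError ρ (ω k) := funext fun ω => toCoord_deviation _ ρ ω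
  rw [this]
  have hm : Measurable (blueError ρ) := (continuous_blueError hρ).measurable
  fun_prop

/-- The law of the scaled deviation in real coordinates. -/
def deviationLaw (hρ : ρ ∈ fullRankStates d) (N : ℕ) : ProbabilityMeasure (CoordSpace d) :=
  ⟨((covariant d).sampleLaw N ρ).map fun ω => toCoord (deviation N ((covariant d).blue ρ) ρ ω), by
    have := Measurement.isProbabilityMeasure_outcomeLaw (covariant_isPOVM d)
      (isState_of_fullRank hρ)
    have : IsProbabilityMeasure ((covariant d).sampleLaw N ρ) := by
      rw [Measurement.sampleLaw_eq]
      infer_instance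
    exact Measure.isProbabilityMeasure_map (measurable_toCoord_deviation hρ N).aemeasurable⟩

theorem tendsto_deviationLaw (hd : d ≠ 0) (hρ : ρ ∈ fullRankStates d) :
    Tendsto (deviationLaw hρ) atTop (𝓝 (limitLaw ρ)) := by
  have := Measurement.isProbabilityMeasure_outcomeLaw (covariant_isPOVM d) (isState_of_fullRank hρ)
  refine ProbabilityMeasure.tendsto_of_tendsto_charFun fun t => ?_
  have h := tendsto_charFun_map_sum (continuous_blueError hρ).measurable (memLp_blueError hρ)
    (integral_blueError hd hρ) t
  refine h.congr fun N => ?_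
  have e : (fun ω : Fin N → UnitVec d => (√N)⁻¹ • ∑ k, blueError ρ (ω k)) =
      fun ω => toCoord (deviation N ((covariant d).blue ρ) ρ ω) :=
    funext fun ω => (toCoord_deviation _ ρ ω).symm
  rw [e]
  rfl

/-- The second moment does not depend on `N`, which supplies the uniform integrability needed beyond
weak convergence. -/
theorem lintegral_deviationLaw (hd : d ≠ 0) (hρ : ρ ∈ fullRankStates d) {N : ℕ} (hN : 1 ≤ N) :
    ∫⁻ x, ENNReal.ofReal (‖x‖ ^ 2) ∂(deviationLaw hρ N : Measure (CoordSpace d)) =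
      ENNReal.ofReal ((covariant d).optMSEMatrix ρ).trace.re := by
  have := Measurement.isProbabilityMeasure_outcomeLaw (covariant_isPOVM d) (isState_of_fullRank hρ)
  change ∫⁻ x, ENNReal.ofReal (‖x‖ ^ 2) ∂(((covariant d).sampleLaw N ρ).map _) = _
  rw [lintegral_map (by fun_prop) (measurable_toCoord_deviation hρ N),
    ← covariant_scaledMSE_blue hd hρ hN, Measurement.scaledMSE,
    ofReal_integral_eq_lintegral_ofReal
      (Measurement.integrable_hsNorm_sq_deviation hN (covariant_squareIntegrable_blue hρ))
      (Eventually.of_forall fun ω => sq_nonneg _)]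
  refine lintegral_congr fun ω => ?_
  rw [← hsNorm_ofCoord, ofCoord_toCoord]

theorem lintegral_limitLaw_le (hd : d ≠ 0) (hρ : ρ ∈ fullRankStates d) :
    ∫⁻ x, ENNReal.ofReal (‖x‖ ^ 2) ∂(limitLaw ρ : Measure (CoordSpace d)) ≤
      ENNReal.ofReal ((covariant d).optMSEMatrix ρ).trace.re :=
  lintegral_le_of_tendsto ((tendsto_add_atTop_iff_nat 1).2 (tendsto_deviationLaw hd hρ))
    (by fun_prop) (fun x => sq_nonneg _) fun N => (lintegral_deviationLaw hd hρ (by omega)).le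

theorem lintegral_sq_comp_ofCoord_le {f : Op d → ℝ} {c : ℝ} (hf0 : ∀ A, 0 ≤ f A)
    (hfc : ∀ A, f A ≤ c * hsNorm A) {μ : Measure (CoordSpace d)} {K : ℝ}
    (hK : ∫⁻ x, ENNReal.ofReal (‖x‖ ^ 2) ∂μ ≤ ENNReal.ofReal K) :
    ∫⁻ x, ENNReal.ofReal (f (ofCoord x) ^ 2) ∂μ ≤ ENNReal.ofReal (c ^ 2 * K) := by
  calc ∫⁻ x, ENNReal.ofReal (f (ofCoord x) ^ 2) ∂μ
      ≤ ∫⁻ x, ENNReal.ofReal (c ^ 2) * ENNReal.ofReal (‖x‖ ^ 2) ∂μ := by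
        refine lintegral_mono fun x => ?_
        rw [← ENNReal.ofReal_mul (sq_nonneg c), ← mul_pow, ← hsNorm_ofCoord]
        exact ENNReal.ofReal_le_ofReal (pow_le_pow_left₀ (hf0 _) (hfc _) 2)
    _ = ENNReal.ofReal (c ^ 2) * ∫⁻ x, ENNReal.ofReal (‖x‖ ^ 2) ∂μ :=
        lintegral_const_mul _ (by fun_prop)
    _ ≤ ENNReal.ofReal (c ^ 2 * K) := by
        rw [ENNReal.ofReal_mul (sq_nonneg c)]
        exact mul_le_mul_right hK _

theorem tendsto_mean_deviation (hd : d ≠ 0) (hρ : ρ ∈ fullRankStates d) {f : Op d → ℝ} {c : ℝ}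
    (hf : Continuous f) (hf0 : ∀ A, 0 ≤ f A) (hfc : ∀ A, f A ≤ c * hsNorm A) :
    Tendsto (fun N : ℕ => ∫ ω, f (deviation N ((covariant d).blue ρ) ρ ω)
      ∂(covariant d).sampleLaw N ρ) atTop
      (𝓝 (∫ x, f (ofCoord x) ∂(limitLaw ρ : Measure (CoordSpace d)))) := by
  -- The empty sample is dropped, since the second-moment formula requires `N ≥ 1`.
  rw [← tendsto_add_atTop_iff_nat 1]
  have h := tendsto_integral_of_lintegral_sq_le
    ((tendsto_add_atTop_iff_nat 1).2 (tendsto_deviationLaw hd hρ)) (hf.comp continuous_ofCoord)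
    (fun x => hf0 _) fun N => lintegral_sq_comp_ofCoord_le hf0 hfc
      (lintegral_deviationLaw hd hρ (Nat.le_add_left 1 N)).le
  refine h.congr fun N => ?_
  change ∫ x, (f ∘ ofCoord) x ∂(((covariant d).sampleLaw (N + 1) ρ).map _) = _
  rw [integral_map (measurable_toCoord_deviation hρ (N + 1)).aemeasurable
    (hf.comp continuous_ofCoord).measurable.aestronglyMeasurable]
  rfl

end LargeSample

/-! ### The mean length of a standard Gaussian vector -/

section GaussianLength

open ProbabilityTheory Module

variable (V : Type*) [NormedAddCommGroup V] [InnerProductSpace ℝ V]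

/-- The density of the standard Gaussian measure. -/
def stdGaussianDensity (x : V) : ℝ :=
  (2 * Real.pi) ^ (-(finrank ℝ V : ℝ) / 2) * Real.exp (-‖x‖ ^ 2 / 2)

theorem stdGaussianDensity_nonneg (x : V) : 0 ≤ stdGaussianDensity V x := by
  unfold stdGaussianDensity
  positivity

theorem continuous_stdGaussianDensity : Continuous (stdGaussianDensity V) := by
  unfold stdGaussianDensity
  fun_prop

variable [FiniteDimensional ℝ V] [MeasurableSpace V] [BorelSpace V]

theorem integral_stdGaussianDensity_mul_exp (t : V) :
    ∫ x, (stdGaussianDensity V x : ℂ) * Complex.exp (inner ℝ x t * Complex.I) =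
      Complex.exp (-‖t‖ ^ 2 / 2) := by
  have h := GaussianFourier.integral_cexp_neg_mul_sq_norm_add (V := V) (b := (1 / 2 : ℂ))
    (by norm_num) Complex.I t
  have e : ∀ x : V, (stdGaussianDensity V x : ℂ) * Complex.exp (inner ℝ x t * Complex.I) =
      (((2 * Real.pi) ^ (-(finrank ℝ V : ℝ) / 2) : ℝ) : ℂ) *
        Complex.exp (-(1 / 2) * ‖x‖ ^ 2 + Complex.I * inner ℝ t x) := fun x => by
    rw [stdGaussianDensity, Complex.ofReal_mul, mul_assoc, Complex.ofReal_exp, ← Complex.exp_add,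
      real_inner_comm]
    congr 2
    push_cast
    ring
  simp_rw [e]
  rw [integral_const_mul, h]
  have hpi : (0 : ℝ) ≤ 2 * Real.pi := by positivity
  rw [show (Real.pi : ℂ) / (1 / 2) = ((2 * Real.pi : ℝ) : ℂ) by push_cast; ring,
    show ((finrank ℝ V : ℂ) / 2) = (((finrank ℝ V : ℝ) / 2 : ℝ) : ℂ) by push_cast; ring,
    ← Complex.ofReal_cpow hpi, ← mul_assoc, ← Complex.ofReal_mul,
    ← Real.rpow_add (by positivity), neg_div, neg_add_cancel, Real.rpow_zero, Complex.ofReal_one,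
    one_mul, Complex.I_sq]
  congr 1
  ring

theorem integral_stdGaussianDensity : ∫ x, stdGaussianDensity V x = 1 := by
  have h := integral_stdGaussianDensity_mul_exp V 0
  simp only [inner_zero_right, Complex.ofReal_zero, zero_mul, Complex.exp_zero, mul_one, norm_zero]
    at h
  rw [integral_complex_ofReal] at h
  simpa using h

theorem integrable_stdGaussianDensity : Integrable (stdGaussianDensity V) := by
  -- A non-integrable function would have integral zero by convention, but the integral is already
  -- known to be one.
  by_contra h
  have := integral_stdGaussianDensity V
  rw [integral_undef h] at this
  exact zero_ne_one this

/-- Both measures have the same characteristic function; the density is needed for integration in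
polar coordinates. -/
theorem stdGaussian_eq_withDensity :
    stdGaussian V = volume.withDensity fun x => ENNReal.ofReal (stdGaussianDensity V x) := by
  have hfin : IsFiniteMeasure
      (volume.withDensity fun x => ENNReal.ofReal (stdGaussianDensity V x)) :=
    isFiniteMeasure_withDensity_ofReal (integrable_stdGaussianDensity V).2
  refine Measure.ext_of_charFun (funext fun t => ?_)
  rw [charFun_stdGaussian, charFun_apply, integral_withDensity_eq_integral_toReal_smul
    (continuous_stdGaussianDensity V).measurable.ennreal_ofReal (by simp),
    ← integral_stdGaussianDensity_mul_exp V t]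
  refine integral_congr_ae (Eventually.of_forall fun x => ?_)
  simp only
  rw [ENNReal.toReal_ofReal (stdGaussianDensity_nonneg V x), Complex.real_smul]

theorem integral_pow_mul_exp_neg_sq (q : ℕ) :
    ∫ y in Set.Ioi (0 : ℝ), y ^ q * Real.exp (-y ^ 2 / 2) =
      (1 / 2 : ℝ) ^ (-((q : ℝ) + 1) / 2) * (1 / 2) * Real.Gamma (((q : ℝ) + 1) / 2) := by
  have h := integral_rpow_mul_exp_neg_mul_rpow (p := 2) (q := (q : ℝ)) (b := 1 / 2) (by norm_num)
    (by linarith [Nat.cast_nonneg (α := ℝ) q]) (by norm_num)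
  rw [← h]
  refine setIntegral_congr_fun measurableSet_Ioi fun y _ => ?_
  simp only [Real.rpow_natCast, Real.rpow_two]
  congr 2
  ring

/-- In polar coordinates the mean length and the total mass differ by one power of the radius.
Comparing them cancels the volume of the ball and the normalization, leaving a quotient of Gamma
integrals. -/
theorem integral_norm_stdGaussian {n : ℕ} (hn : finrank ℝ V = n) (hn0 : n ≠ 0) :
    ∫ x, ‖x‖ ∂stdGaussian V =
      √2 * (Real.Gamma (((n : ℝ) + 1) / 2) / Real.Gamma ((n : ℝ) / 2)) := by
  have : Nontrivial V := Module.nontrivial_of_finrank_pos (R := ℝ) (by omega)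
  obtain ⟨m, rfl⟩ := Nat.exists_eq_succ_of_ne_zero hn0
  set c : ℝ := (2 * Real.pi) ^ (-(finrank ℝ V : ℝ) / 2)
  set v : ℝ := (volume : Measure V).real (Metric.ball 0 1)
  have h1 : ∫ x, ‖x‖ ∂stdGaussian V = c * (((m + 1 : ℕ) : ℝ) * (v *
      ∫ y in Set.Ioi (0 : ℝ), y ^ (m + 1) * Real.exp (-y ^ 2 / 2))) := by
    rw [stdGaussian_eq_withDensity, integral_withDensity_eq_integral_toReal_smul
      (continuous_stdGaussianDensity V).measurable.ennreal_ofReal (by simp)]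
    have h2 := integral_fun_norm_addHaar (volume : Measure V)
      fun y => y * Real.exp (-y ^ 2 / 2)
    rw [hn] at h2
    have e : ∀ x : V, (ENNReal.ofReal (stdGaussianDensity V x)).toReal • ‖x‖ =
        c * (‖x‖ * Real.exp (-‖x‖ ^ 2 / 2)) := fun x => by
      rw [ENNReal.toReal_ofReal (stdGaussianDensity_nonneg V x), stdGaussianDensity, smul_eq_mul]
      ring
    simp_rw [e]
    have e2 : ∫ y in Set.Ioi (0 : ℝ), y ^ (m.succ - 1) • (y * Real.exp (-y ^ 2 / 2)) =
        ∫ y in Set.Ioi (0 : ℝ), y ^ (m + 1) * Real.exp (-y ^ 2 / 2) :=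
      setIntegral_congr_fun measurableSet_Ioi fun y _ => by
        simp only [Nat.succ_eq_add_one, Nat.add_sub_cancel, smul_eq_mul, pow_succ]
        ring
    rw [integral_const_mul, h2, nsmul_eq_mul, smul_eq_mul, e2]
  have h0 : 1 = c * (((m + 1 : ℕ) : ℝ) * (v *
      ∫ y in Set.Ioi (0 : ℝ), y ^ m * Real.exp (-y ^ 2 / 2))) := by
    rw [← integral_stdGaussianDensity V]
    have h2 := integral_fun_norm_addHaar (volume : Measure V) fun y => Real.exp (-y ^ 2 / 2)
    rw [hn] at h2
    simp only [stdGaussianDensity]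
    rw [integral_const_mul, h2, nsmul_eq_mul, smul_eq_mul]
    rfl
  have hG : Real.Gamma (((m : ℝ) + 1) / 2) ≠ 0 := (Real.Gamma_pos_of_pos (by positivity)).ne'
  have hs : (1 / 2 : ℝ) ^ (-(((m + 1 : ℕ) : ℝ) + 1) / 2) =
      √2 * (1 / 2 : ℝ) ^ (-((m : ℝ) + 1) / 2) := by
    rw [Real.sqrt_eq_rpow, show (2 : ℝ) ^ (1 / 2 : ℝ) = (1 / 2 : ℝ) ^ (-(1 / 2) : ℝ) by
      rw [one_div, Real.inv_rpow (by norm_num), Real.rpow_neg (by norm_num), inv_inv],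
      ← Real.rpow_add (by norm_num)]
    congr 1
    push_cast
    ring
  have key : ∫ y in Set.Ioi (0 : ℝ), y ^ (m + 1) * Real.exp (-y ^ 2 / 2) =
      √2 * (Real.Gamma ((((m + 1 : ℕ) : ℝ) + 1) / 2) / Real.Gamma (((m + 1 : ℕ) : ℝ) / 2)) *
        ∫ y in Set.Ioi (0 : ℝ), y ^ m * Real.exp (-y ^ 2 / 2) := by
    rw [integral_pow_mul_exp_neg_sq, integral_pow_mul_exp_neg_sq, hs]
    push_cast
    field_simp
  rw [h1, key]
  linear_combination (-(√2 * (Real.Gamma ((((m + 1 : ℕ) : ℝ) + 1) / 2) /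
    Real.Gamma (((m + 1 : ℕ) : ℝ) / 2)))) * h0

end GaussianLength

/-! ### Mean errors in the limit of a pure state -/

section PureMeanErrors

open ProbabilityTheory

variable {d : ℕ} (e : OrthonormalBasis (Fin d) ℂ (EuclideanSpace ℂ (Fin d))) (k : Fin d)

/-- The indices of the directions that survive in the limit of a pure state. -/
abbrev TangentIndex (k : Fin d) := {j : Fin d // j ≠ k} ⊕ {j : Fin d // j ≠ k}

/-- The orthonormal operators that span the tangent space at a pure state. -/
def tangentBasis : TangentIndex k → Op d :=
  Sum.elim (fun j => Eplus e k j.1) fun j => Eminus e k j.1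

/-- The tangent operator with given real coordinates. -/
def tangentOp (g : EuclideanSpace ℝ (TangentIndex k)) : Op d :=
  ∑ a, (g a : ℂ) • tangentBasis e k a

theorem continuous_tangentOp : Continuous (tangentOp e k) := by
  unfold tangentOp
  fun_prop

theorem ketbra_smul_left (c : ℂ) (u v : EuclideanSpace ℂ (Fin d)) :
    ketbra (c • u) v = c • ketbra u v := by
  ext i j
  simp [ketbra, mul_assoc]

theorem ketbra_smul_right (c : ℂ) (u v : EuclideanSpace ℂ (Fin d)) :
    ketbra u (c • v) = star c • ketbra u v := by
  ext i j
  simp [ketbra, mul_left_comm]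

theorem ketbra_sum_left {ι : Type*} (s : Finset ι) (u : ι → EuclideanSpace ℂ (Fin d))
    (v : EuclideanSpace ℂ (Fin d)) : ketbra (∑ x ∈ s, u x) v = ∑ x ∈ s, ketbra (u x) v := by
  ext i j
  simp [ketbra, Matrix.sum_apply, Finset.sum_mul]

theorem ketbra_sum_right {ι : Type*} (s : Finset ι) (u : ι → EuclideanSpace ℂ (Fin d))
    (v : EuclideanSpace ℂ (Fin d)) : ketbra v (∑ x ∈ s, u x) = ∑ x ∈ s, ketbra v (u x) := by
  ext i j
  simp [ketbra, Matrix.sum_apply, Finset.mul_sum]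

theorem Eplus_isHermitian (j : Fin d) : (Eplus e k j).IsHermitian := by
  rw [Matrix.IsHermitian, Eplus, conjTranspose_smul, conjTranspose_add, conjTranspose_ketbra,
    conjTranspose_ketbra, add_comm]
  simp

theorem Eminus_isHermitian (j : Fin d) : (Eminus e k j).IsHermitian := by
  have h : star (-Complex.I * ((√2 : ℝ) : ℂ)⁻¹) = -(-Complex.I * ((√2 : ℝ) : ℂ)⁻¹) := by simp
  rw [Matrix.IsHermitian, Eminus, conjTranspose_smul, conjTranspose_sub, conjTranspose_ketbra,
    conjTranspose_ketbra, h, neg_smul, ← smul_neg, neg_sub]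

theorem tangentBasis_isHermitian (a : TangentIndex k) : (tangentBasis e k a).IsHermitian := by
  rcases a with j | j
  · exact Eplus_isHermitian e k j
  · exact Eminus_isHermitian e k j

theorem pureLimit_eq_sum :
    pureLimit e k = ∑ a, outer (tangentBasis e k a) (tangentBasis e k a) := by
  rw [pureLimit, Fintype.sum_sum_type, ← Finset.sum_add_distrib]
  refine Finset.sum_subtype (p := fun j => j ≠ k) _ (fun j => by simp) fun j =>
    outer (Eplus e k j) (Eplus e k j) + outer (Eminus e k j) (Eminus e k j)

/-- The vector `w` with `tangentOp g = |k⟩⟨w| + |w⟩⟨k|`. -/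
def tangentVec (g : EuclideanSpace ℝ (TangentIndex k)) : EuclideanSpace ℂ (Fin d) :=
  ∑ j : {j : Fin d // j ≠ k},
    (((√2 : ℝ) : ℂ)⁻¹ * (g (Sum.inl j) + g (Sum.inr j) * Complex.I)) • e j.1

theorem tangentOp_eq (g : EuclideanSpace ℝ (TangentIndex k)) :
    tangentOp e k g = ketbra (e k) (tangentVec e k g) + ketbra (tangentVec e k g) (e k) := by
  rw [tangentOp, Fintype.sum_sum_type, tangentVec, ketbra_sum_left, ketbra_sum_right,
    ← Finset.sum_add_distrib, ← Finset.sum_add_distrib]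
  refine Finset.sum_congr rfl fun j _ => ?_
  simp only [tangentBasis, Sum.elim_inl, Sum.elim_inr, Eplus, Eminus, ketbra_smul_left,
    ketbra_smul_right]
  ext i l
  have h : star (((√2 : ℝ) : ℂ)⁻¹ * ((g (Sum.inl j) : ℂ) + g (Sum.inr j) * Complex.I)) =
      ((√2 : ℝ) : ℂ)⁻¹ * ((g (Sum.inl j) : ℂ) - g (Sum.inr j) * Complex.I) := by
    simp [sub_eq_add_neg]
  simp only [Matrix.add_apply, Matrix.smul_apply, Matrix.sub_apply, smul_eq_mul, h]
  ring

theorem inner_tangentVec (g : EuclideanSpace ℝ (TangentIndex k)) :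
    inner ℂ (e k) (tangentVec e k g) = 0 := by
  rw [tangentVec, inner_sum]
  refine Finset.sum_eq_zero fun j _ => ?_
  rw [inner_smul_right, e.inner_eq_zero j.2.symm, mul_zero]

theorem norm_tangentVec_sq (g : EuclideanSpace ℝ (TangentIndex k)) :
    ‖tangentVec e k g‖ ^ 2 = ‖g‖ ^ 2 / 2 := by
  have ho : Orthonormal ℂ fun j : {j : Fin d // j ≠ k} => e j.1 :=
    e.orthonormal.comp _ Subtype.val_injective
  have h := ho.inner_sum
    (fun j => ((√2 : ℝ) : ℂ)⁻¹ * (g (Sum.inl j) + g (Sum.inr j) * Complex.I))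
    (fun j => ((√2 : ℝ) : ℂ)⁻¹ * (g (Sum.inl j) + g (Sum.inr j) * Complex.I)) Finset.univ
  have h2 : ((‖tangentVec e k g‖ ^ 2 : ℝ) : ℂ) = ((‖g‖ ^ 2 / 2 : ℝ) : ℂ) := by
    have h3 := inner_self_eq_norm_sq_to_K (𝕜 := ℂ) (tangentVec e k g)
    rw [Complex.ofReal_pow]
    refine h3.symm.trans (h.trans ?_)
    rw [EuclideanSpace.real_norm_sq_eq, Fintype.sum_sum_type, ← Finset.sum_add_distrib,
      Finset.sum_div, Complex.ofReal_sum]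
    refine Finset.sum_congr rfl fun j _ => ?_
    have hs := ofReal_sqrt_two_inv_sq
    have hI := Complex.I_mul_I
    simp only [map_mul, map_add, map_inv₀, Complex.conj_ofReal, Complex.conj_I]
    push_cast
    generalize ((√2 : ℝ) : ℂ)⁻¹ = s at hs ⊢
    linear_combination ((g (Sum.inl j) : ℂ) ^ 2 + (g (Sum.inr j) : ℂ) ^ 2) * hs -
      s * s * (g (Sum.inr j) : ℂ) ^ 2 * hI
  exact_mod_cast h2

/-- Because `w = tangentVec e k g` is orthogonal to `e k`, the cross terms vanish; for `w ≠ 0` the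
Gram operator is `‖w‖²` times the projector onto the span of `e k` and `w`. -/
theorem gram_tangentOp (g : EuclideanSpace ℝ (TangentIndex k)) :
    (tangentOp e k g)ᴴ * tangentOp e k g =
      ((‖tangentVec e k g‖ ^ 2 : ℝ) : ℂ) • ketbra (e k) (e k) +
        ketbra (tangentVec e k g) (tangentVec e k g) := by
  have h0 := inner_tangentVec e k g
  have h0' : inner ℂ (tangentVec e k g) (e k) = 0 := by rw [← inner_conj_symm, h0, map_zero]
  have h1 : inner ℂ (e k) (e k) = (1 : ℂ) := inner_self_eq_one (e.norm_eq_one k)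
  have hw : inner ℂ (tangentVec e k g) (tangentVec e k g) =
      ((‖tangentVec e k g‖ ^ 2 : ℝ) : ℂ) := by
    rw [inner_self_eq_norm_sq_to_K, Complex.ofReal_pow]
    rfl
  rw [tangentOp_eq, conjTranspose_add, conjTranspose_ketbra, conjTranspose_ketbra, Matrix.mul_add,
    Matrix.add_mul, Matrix.add_mul]
  simp only [ketbra_mul_ketbra, h0, h0', h1, hw, zero_smul, one_smul, add_zero, zero_add]
  rw [add_comm]

theorem hsNorm_tangentOp (g : EuclideanSpace ℝ (TangentIndex k)) :
    hsNorm (tangentOp e k g) = ‖g‖ := by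
  rw [hsNorm, gram_tangentOp, Matrix.trace_add, Matrix.trace_smul, trace_ketbra, trace_ketbra,
    inner_self_eq_one (e.norm_eq_one k), inner_self_eq_norm_sq_to_K, smul_eq_mul, mul_one]
  have : (((‖tangentVec e k g‖ ^ 2 : ℝ) : ℂ) + ((‖tangentVec e k g‖ : ℝ) : ℂ) ^ 2).re = ‖g‖ ^ 2 := by
    rw [← Complex.ofReal_pow, ← Complex.ofReal_add, Complex.ofReal_re, norm_tangentVec_sq]
    ring
  exact (congrArg Real.sqrt this).trans (Real.sqrt_sq (norm_nonneg g))

/-- All nonzero singular values equal `‖w‖ = ‖g‖/√2`, so the trace norm follows from the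
Hilbert–Schmidt norm. -/
theorem trNorm_tangentOp (g : EuclideanSpace ℝ (TangentIndex k)) :
    trNorm (tangentOp e k g) = (√2)⁻¹ * ‖g‖ := by
  have h2 : (0 : ℝ) < √2 := by positivity
  have hc : ‖tangentVec e k g‖ = (√2)⁻¹ * ‖g‖ := by
    rw [← Real.sqrt_sq (norm_nonneg (tangentVec e k g)), norm_tangentVec_sq,
      Real.sqrt_div (sq_nonneg _), Real.sqrt_sq (norm_nonneg g)]
    ring
  have h0 := inner_tangentVec e k g
  have h0' : inner ℂ (tangentVec e k g) (e k) = 0 := by rw [← inner_conj_symm, h0, map_zero]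
  have hw : inner ℂ (tangentVec e k g) (tangentVec e k g) =
      ((‖tangentVec e k g‖ ^ 2 : ℝ) : ℂ) := by
    rw [inner_self_eq_norm_sq_to_K, Complex.ofReal_pow]
    rfl
  have h := trNorm_of_gram_sq (A := tangentOp e k g) (norm_nonneg (tangentVec e k g)) (by
    rw [gram_tangentOp, Matrix.mul_add, Matrix.add_mul, Matrix.add_mul]
    simp only [Matrix.smul_mul, Matrix.mul_smul, ketbra_mul_ketbra, h0, h0', hw,
      inner_self_eq_one (e.norm_eq_one k), zero_smul, one_smul, add_zero, zero_add, smul_zero,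
      smul_add])
  rw [hc, hsNorm_tangentOp] at h
  -- The relation between the norms carries the factor `‖w‖`, which cannot be cancelled at `g = 0`.
  rcases eq_or_ne ‖g‖ 0 with hg | hg
  · have h3 := trNorm_le (tangentOp e k g)
    rw [hsNorm_tangentOp, hg, mul_zero] at h3
    rw [hg, mul_zero]
    exact le_antisymm h3 (trNorm_nonneg _)
  · have h4 : (√2)⁻¹ * ‖g‖ ≠ 0 := mul_ne_zero (inv_ne_zero h2.ne') hg
    apply mul_left_cancel₀ h4
    rw [h]
    have h5 : (√2)⁻¹ * (√2)⁻¹ = (1 / 2 : ℝ) := by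
      rw [← mul_inv, Real.mul_self_sqrt (by norm_num)]
      norm_num
    linear_combination -‖g‖ ^ 2 * h5

/-- The limit of the Gaussian error laws at a pure state. -/
def pureLaw : ProbabilityMeasure (CoordSpace d) :=
  ⟨(stdGaussian (EuclideanSpace ℝ (TangentIndex k))).map (toCoord ∘ tangentOp e k),
    Measure.isProbabilityMeasure_map
      (continuous_toCoord.comp (continuous_tangentOp e k)).measurable.aemeasurable⟩

theorem re_hsInner_pureLimit (T : Op d) :
    hsInner (hermPart T) ((pureLimit e k).app (hermPart T)) =
      ((∑ a, (hsInner T (tangentBasis e k a)).re ^ 2 : ℝ) : ℂ) := by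
  rw [pureLimit_eq_sum, SuperOp.sum_app, hsInner_sum_right, Complex.ofReal_sum]
  refine Finset.sum_congr rfl fun a _ => ?_
  rw [outer_app, hsInner_smul_right, sq_re_hsInner T (tangentBasis_isHermitian e k a), hsInner_conj]
  ring

/-- The pairing with `t` is linear in the standard Gaussian vector, with coefficients the components
of `t` along the tangent basis; the sum of their squares is the form of the limiting projector. -/
theorem charFun_pureLaw (t : CoordSpace d) :
    charFun (pureLaw e k : Measure (CoordSpace d)) t =
      Complex.exp (-hsInner (hermPart (ofCoord t))
        ((pureLimit e k).app (hermPart (ofCoord t))) / 2) := by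
  set s : EuclideanSpace ℝ (TangentIndex k) :=
    WithLp.toLp 2 fun a => (hsInner (ofCoord t) (tangentBasis e k a)).re with hs
  have hsn : ‖s‖ ^ 2 = ∑ a, (hsInner (ofCoord t) (tangentBasis e k a)).re ^ 2 := by
    rw [EuclideanSpace.real_norm_sq_eq]
  rw [re_hsInner_pureLimit, ← hsn, Complex.ofReal_pow, ← charFun_stdGaussian]
  change charFun ((stdGaussian (EuclideanSpace ℝ (TangentIndex k))).map _) t = _
  rw [charFun_apply, integral_map
    (continuous_toCoord.comp (continuous_tangentOp e k)).measurable.aemeasurable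
    (by fun_prop), charFun_apply]
  refine integral_congr_ae (Eventually.of_forall fun g => ?_)
  have : inner ℝ (toCoord (tangentOp e k g)) t = inner ℝ g s := by
    rw [inner_toCoord, tangentOp, hsInner_sum_right, Complex.re_sum, PiLp.inner_apply]
    refine Finset.sum_congr rfl fun a _ => ?_
    rw [hsInner_smul_right, Complex.re_ofReal_mul]
    simp [hs, mul_comm]
  simp only [Function.comp_apply]
  rw [this]

/-- Convergence of `𝓒(ρ)` serves twice: it gives weak convergence through characteristic functions,
and its trace bounds the second moments. -/
theorem tendsto_mean_pureLaw (hd : d ≠ 0) {f : Op d → ℝ} {c : ℝ} (hf : Continuous f)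
    (hf0 : ∀ A, 0 ≤ f A) (hfc : ∀ A, f A ≤ c * hsNorm A) :
    Tendsto (fun ρ => ∫ x, f (ofCoord x) ∂(limitLaw ρ : Measure (CoordSpace d)))
      (𝓝[fullRankStates d] ketbra (e k) (e k))
      (𝓝 (∫ g, f (tangentOp e k g) ∂stdGaussian (EuclideanSpace ℝ (TangentIndex k)))) := by
  have hlim : ∫ g, f (tangentOp e k g) ∂stdGaussian (EuclideanSpace ℝ (TangentIndex k)) =
      ∫ x, (f ∘ ofCoord) x ∂(pureLaw e k : Measure (CoordSpace d)) := by
    change _ = ∫ x, (f ∘ ofCoord) x ∂((stdGaussian _).map _)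
    rw [integral_map (continuous_toCoord.comp (continuous_tangentOp e k)).measurable.aemeasurable
      (hf.comp continuous_ofCoord).measurable.aestronglyMeasurable]
    rfl
  rw [hlim]
  have : Tendsto (fun ρ => ((covariant d).optMSEMatrix ρ).trace.re)
      (𝓝[fullRankStates d] ketbra (e k) (e k)) (𝓝 (pureLimit e k).trace.re) := by
    have hc : Continuous fun S : SuperOp d => S.trace.re := Complex.continuous_re.comp (by fun_prop)
    exact (hc.tendsto _).comp (tendsto_optMSEMatrix hd e k)
  have hbound := this.eventually (gt_mem_nhds (lt_add_one (pureLimit e k).trace.re))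
  have : FirstCountableTopology (Op d) :=
    inferInstanceAs (FirstCountableTopology (Fin d → Fin d → ℂ))
  -- The operator space is first countable, so sequences suffice; shifting by `n₀` puts every term
  -- among full-rank states with bounded trace of `𝓒`.
  refine tendsto_of_seq_tendsto fun u hu => ?_
  obtain ⟨n₀, hn₀⟩ := eventually_atTop.1
    ((hu.eventually hbound).and (hu.eventually self_mem_nhdsWithin))
  rw [← tendsto_add_atTop_iff_nat n₀]
  have hu' : Tendsto (fun n => u (n + n₀)) atTop (𝓝[fullRankStates d] ketbra (e k) (e k)) :=
    (tendsto_add_atTop_iff_nat n₀).2 hu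
  have hmem : ∀ n, u (n + n₀) ∈ fullRankStates d := fun n => (hn₀ _ (Nat.le_add_left _ _)).2
  have hweak : Tendsto (fun n => limitLaw (u (n + n₀))) atTop (𝓝 (pureLaw e k)) := by
    refine ProbabilityMeasure.tendsto_of_tendsto_charFun fun t => ?_
    simp_rw [fun n => charFun_limitLaw hd (hmem n) t, charFun_pureLaw]
    have hc : Continuous fun S : SuperOp d => Complex.exp (-hsInner (hermPart (ofCoord t))
        (S.app (hermPart (ofCoord t))) / 2) :=
      Complex.continuous_exp.comp (((continuous_hsInner_app _ _).neg).div_const _)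
    exact (hc.tendsto _).comp ((tendsto_optMSEMatrix hd e k).comp hu')
  exact tendsto_integral_of_lintegral_sq_le hweak (hf.comp continuous_ofCoord) (fun x => hf0 _)
    fun n => lintegral_sq_comp_ofCoord_le hf0 hfc ((lintegral_limitLaw_le hd (hmem n)).trans
      (ENNReal.ofReal_le_ofReal (hn₀ _ (Nat.le_add_left _ _)).1.le))

theorem integral_norm_tangent (hd : 2 ≤ d) :
    ∫ g, ‖g‖ ∂stdGaussian (EuclideanSpace ℝ (TangentIndex k)) =
      √2 * (Real.Gamma ((d : ℝ) - 1 / 2) / Real.Gamma ((d : ℝ) - 1)) := by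
  have hcard : Module.finrank ℝ (EuclideanSpace ℝ (TangentIndex k)) = 2 * (d - 1) := by
    rw [finrank_euclideanSpace, Fintype.card_sum, Fintype.card_subtype_compl,
      Fintype.card_subtype_eq, Fintype.card_fin]
    ring
  rw [integral_norm_stdGaussian _ hcard (by omega)]
  have h1 : ((2 * (d - 1) : ℕ) : ℝ) = 2 * (d - 1) := by
    push_cast [Nat.cast_sub (show 1 ≤ d by omega)]
    ring
  rw [h1, show (2 * ((d : ℝ) - 1) + 1) / 2 = d - 1 / 2 by ring,
    show 2 * ((d : ℝ) - 1) / 2 = d - 1 by ring]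

/-- The limiting mean errors are integrals against the Gaussian `limitLaw ρ`, so one pair of
functions serves every basis and every pure state. -/
theorem exists_mean_errors (hd : 2 ≤ d) :
    ∃ Etr EHS : Op d → ℝ,
      (∀ ρ ∈ fullRankStates d,
        Tendsto (fun N : ℕ => (covariant d).meanTr N ((covariant d).blue ρ) ρ) atTop
          (𝓝 (Etr ρ)) ∧
        Tendsto (fun N : ℕ => (covariant d).meanHS N ((covariant d).blue ρ) ρ) atTop
          (𝓝 (EHS ρ))) ∧
      ∀ (e : OrthonormalBasis (Fin d) ℂ (EuclideanSpace ℂ (Fin d))) (k : Fin d),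
        Tendsto Etr (𝓝[fullRankStates d] ketbra (e k) (e k))
          (𝓝 (Real.Gamma ((d : ℝ) - 1 / 2) / Real.Gamma ((d : ℝ) - 1))) ∧
        Tendsto EHS (𝓝[fullRankStates d] ketbra (e k) (e k))
          (𝓝 (√2 * (Real.Gamma ((d : ℝ) - 1 / 2) / Real.Gamma ((d : ℝ) - 1)))) := by
  have hd0 : d ≠ 0 := by omega
  have hHS : ∀ A : Op d, hsNorm A ≤ 1 * hsNorm A := fun A => (one_mul _).ge
  refine ⟨fun ρ => ∫ x, trNorm (ofCoord x) ∂(limitLaw ρ : Measure (CoordSpace d)),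
    fun ρ => ∫ x, hsNorm (ofCoord x) ∂(limitLaw ρ : Measure (CoordSpace d)),
    fun ρ hρ => ⟨tendsto_mean_deviation hd0 hρ continuous_trNorm trNorm_nonneg trNorm_le,
      tendsto_mean_deviation hd0 hρ continuous_hsNorm hsNorm_nonneg hHS⟩, fun e k => ⟨?_, ?_⟩⟩
  · have h := tendsto_mean_pureLaw e k hd0 continuous_trNorm trNorm_nonneg trNorm_le
    simp_rw [trNorm_tangentOp] at h
    rw [integral_const_mul, integral_norm_tangent k hd,
      inv_mul_cancel_left₀ (by positivity : (√2 : ℝ) ≠ 0)] at h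
    exact h
  · have h := tendsto_mean_pureLaw e k hd0 continuous_hsNorm hsNorm_nonneg hHS
    simp_rw [hsNorm_tangentOp] at h
    rwa [integral_norm_tangent k hd] at h

end PureMeanErrors

end Tomography

end

/-! ### Assembly of the theorem -/

open Tomography

theorem mainTheorem6 :
    (∀ d : ℕ, 2 ≤ d →
      -- optimality of the scaled MSE matrix of the covariant measurement at full-rank states
      (covariant d).IsPOVM ∧
      (∀ ρ ∈ fullRankStates d,
        IsUnit ((covariant d).frame ρ) ∧
        (covariant d).IsReconstruction ((covariant d).blue ρ) ∧
        (covariant d).SquareIntegrable ((covariant d).blue ρ) ρ ∧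
        ∀ N : ℕ, 1 ≤ N →
          (covariant d).mseMatrix N ((covariant d).blue ρ) ρ =
            (covariant d).optMSEMatrix ρ ∧
          (∀ Θ : UnitVec d → Op d,
            (covariant d).IsReconstruction Θ →
            (covariant d).SquareIntegrable Θ ρ →
            ((covariant d).mseMatrix N Θ ρ -
              (covariant d).optMSEMatrix ρ).PosSemidef) ∧
          (covariant d).scaledMSE N ((covariant d).blue ρ) ρ =
            ((covariant d).optMSEMatrix ρ).trace.re) ∧
      -- the limit at the pure state `|e k⟩⟨e k|`
      (∀ (e : OrthonormalBasis (Fin d) ℂ (EuclideanSpace ℂ (Fin d))) (k : Fin d),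
        Tendsto (covariant d).optMSEMatrix
          (𝓝[fullRankStates d] ketbra (e k) (e k))
          (𝓝 (pureLimit e k)) ∧
        IsStarProjection (pureLimit e k) ∧
        (pureLimit e k).rank = 2 * (d - 1) ∧
        (∀ N : ℕ, 1 ≤ N →
          Tendsto
            (fun ρ => (covariant d).scaledMSE N ((covariant d).blue ρ) ρ)
            (𝓝[fullRankStates d] ketbra (e k) (e k))
            (𝓝 (2 * ((d : ℝ) - 1))))) ∧
      -- comparison with minimal tomography at pure states
      (∀ P : Fin (d ^ 2) → Op d,
        (discrete P).IsPOVM → (discrete P).IsInfoComplete →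
        ∃ Θ : Fin (d ^ 2) → Op d,
          (∀ Θ', (discrete P).IsReconstruction Θ' ↔ Θ' = Θ) ∧
          ∀ N : ℕ, 1 ≤ N →
            ((d : ℝ) + 2) / 2 * (2 * ((d : ℝ) - 1)) ≤
              ∫ ψ, (discrete P).scaledMSE N Θ (ketbra ψ.1 ψ.1)
                ∂haarVec d) ∧
      (∀ P : Fin (d ^ 2) → Op d, IsSIC P →
        (discrete P).IsPOVM ∧ (discrete P).IsInfoComplete ∧
        ∀ Θ, (discrete P).IsReconstruction Θ →
          ∀ N : ℕ, 1 ≤ N → ∀ ψ : UnitVec d,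
            (discrete P).scaledMSE N Θ (ketbra ψ.1 ψ.1) =
              ((d : ℝ) + 2) / 2 * (2 * ((d : ℝ) - 1))) ∧
      -- the scaled mean trace distance and the scaled mean HS distance in the large-sample limit
      (∃ Etr EHS : Op d → ℝ,
        (∀ ρ ∈ fullRankStates d,
          Tendsto
            (fun N : ℕ => (covariant d).meanTr N ((covariant d).blue ρ) ρ)
            atTop (𝓝 (Etr ρ)) ∧
          Tendsto
            (fun N : ℕ => (covariant d).meanHS N ((covariant d).blue ρ) ρ)
            atTop (𝓝 (EHS ρ))) ∧
        ∀ (e : OrthonormalBasis (Fin d) ℂ (EuclideanSpace ℂ (Fin d))) (k : Fin d),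
          Tendsto Etr (𝓝[fullRankStates d] ketbra (e k) (e k))
            (𝓝 (Real.Gamma ((d : ℝ) - 1 / 2) / Real.Gamma ((d : ℝ) - 1))) ∧
          Tendsto EHS (𝓝[fullRankStates d] ketbra (e k) (e k))
            (𝓝 (√2 * (Real.Gamma ((d : ℝ) - 1 / 2) / Real.Gamma ((d : ℝ) - 1)))))) ∧
    Asymptotics.IsEquivalent atTop
      (fun d : ℕ => Real.Gamma ((d : ℝ) - 1 / 2) / Real.Gamma ((d : ℝ) - 1))
      (fun d : ℕ => √((d : ℝ) - 1)) := by
  refine ⟨fun d hd => ?_, Gamma_ratio_isEquivalent⟩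
  have hd0 : d ≠ 0 := by omega
  refine ⟨covariant_isPOVM d, fun ρ hρ => ?_, fun e k => ?_, fun P hP hI => ?_, fun P hP => ?_,
    exists_mean_errors hd⟩
  · exact ⟨(covariant_frame_posDef hd0 hρ.1).isUnit, covariant_isReconstruction_blue hd0 hρ,
      covariant_squareIntegrable_blue hρ, fun N hN => ⟨covariant_mseMatrix_blue hd0 hρ hN,
      fun Θ hrec hsq => covariant_mseMatrix_optimal hd0 hρ hN hrec hsq,
      covariant_scaledMSE_blue hd0 hρ hN⟩⟩
  · exact ⟨tendsto_optMSEMatrix hd0 e k, pureLimit_isStarProjection e k, rank_pureLimit e k,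
      fun N hN => tendsto_scaledMSE_blue hd0 e k hN⟩
  · obtain ⟨Θ, hΘ⟩ := exists_reconstruction hd0 hP hI
    exact ⟨Θ, fun Θ' => ⟨reconstruction_unique hΘ, fun h => h ▸ hΘ⟩,
      fun N hN => le_integral_scaledMSE_discrete hd0 hP hΘ hN⟩
  · obtain ⟨ψ, hψ, hin⟩ := hP
    have hpovm := sic_isPOVM hd0 hψ hin
    exact ⟨hpovm, isInfoComplete_of_isReconstruction hpovm (sic_isReconstruction hd0 hψ hin),
      fun Θ hΘ N hN φ => sic_scaledMSE hd0 hψ hin hΘ hN φ⟩
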